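/- Let $\Bbbk=\mathbb R$ or $\mathbb C$. Let $u,v,w$ be functions of $x^1,\dots,x^5$ (or of $x^1,\dots,x^6$), write $u_i=\partial_i u$, etc., and set $$\begin{aligned} Q_1&=\partial_2\partial_3-\partial_1\partial_4+u_1\partial_2^2+(v_1-u_2)\partial_1\partial_2-v_2\partial_1^2,\\ Q_2&=\partial_3^2-\partial_1\partial_5+u_1\partial_2\partial_3+v_1\partial_1\partial_3-u_3\partial_1\partial_2+(w-v_3)\partial_1^2,\\ Q_3&=\partial_3\partial_4-\partial_2\partial_5+u_2\partial_2\partial_3-u_3\partial_2^2+v_2\partial_1\partial_3+(w-v_3)\partial_1\partial_2,\\ Q_4&=\partial_3\partial_4-\partial_1\partial_6+u_1\partial_2\partial_4+v_1\partial_1\partial_4+(w-u_4)\partial_1\partial_2-v_4\partial_1^2,\\ Q_5&=\partial_4^2-\partial_2\partial_6+u_2\partial_2\partial_4+v_2\partial_1\partial_4+(w-u_4)\partial_2^2-v_4\partial_1\partial_2,\\ Q_6&=\partial_4\partial_5-\partial_3\partial_6+(v_3-w)\partial_1\partial_4+(w-u_4)\partial_2\partial_3+u_3\partial_2\partial_4-v_4\partial_1\partial_3,\\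 R_1&=u_1\partial_2\partial_3+v_1\partial_2\partial_4-u_2\partial_1\partial_3-v_2\partial_1\partial_4,\\ R_2&=u_1\partial_3\partial_4+v_1\partial_4^2-\partial_1\partial_5-u_4\partial_1\partial_3-(v_4+w)\partial_1\partial_4,\\ R_3&=u_2\partial_3\partial_4+v_2\partial_4^2-\partial_2\partial_5-u_4\partial_2\partial_3-(v_4+w)\partial_2\partial_4,\\ R_4&=v_1\partial_3\partial_4+u_1\partial_3^2-\partial_1\partial_6-v_3\partial_1\partial_4-(u_3+w)\partial_1\partial_3,\\ R_5&=v_2\partial_3\partial_4+u_2\partial_3^2-\partial_2\partial_6-v_3\partial_2\partial_4-(u_3+w)\partial_2\partial_3,\\ R_6&=\partial_3\partial_5-\partial_4\partial_6+u_4\partial_3^2-v_3\partial_4^2+(v_4-u_3)\partial_3\partial_4. \end{aligned}$$ Consider the following systems, which govern involutive scroll structures. * (triple): $Q_1(u)=w_1$, $Q_1(v)=-w_2$, $Q_1(w)=0$; $Q_2(u)=-u_1w_1$, $Q_2(v)=u_1w_2$, $Q_2(w)=-w_1^2$; $Q_3(u)=-w_3-u_1w_2$, $Q_3(v)=w_4+v_2w_1-(v_1-u_2)w_2$,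 $Q_3(w)=-w_1w_2$. * (triple1): $Q_4(u)=w_3+(v_1-u_2)w_1+u_1w_2$, $Q_4(v)=-w_4-v_2w_1$, $Q_4(w)=-w_1w_2$; $Q_5(u)=v_2w_1$, $Q_5(v)=-v_2w_2$, $Q_5(w)=-w_2^2$; $Q_6(u)=w_5+(v_3-w)w_1+u_1w_4-u_2w_3+u_3w_2$, $Q_6(v)=-w_6+v_1w_4-v_2w_3+(w-u_4)w_2-v_4w_1$, $Q_6(w)=w_1w_4-w_2w_3$. * (alttriple): $R_1(u)=u_1w_2-u_2w_1$, $R_1(v)=v_1w_2-v_2w_1$, $R_1(w)=0$; $R_2(u)=u_1w_4$, $R_2(v)=-u_1w_3$, $R_2(w)=w_1w_4$; $R_3(u)=u_2w_4$, $R_3(v)=-u_2w_3$, $R_3(w)=w_2w_4$. * (triple2): $R_4(u)=-v_1w_4$, $R_4(v)=v_1w_3$, $R_4(w)=w_1w_3$; $R_5(u)=-v_2w_4$, $R_5(v)=v_2w_3$, $R_5(w)=w_2w_3$; $R_6(u)=-w_5-(v_4+w)w_4-u_4w_3$, $R_6(v)=w_6+(u_3+w)w_3+v_3w_4$, $R_6(w)=0$.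 Here (triple) and (alttriple) are systems in the 5 variables $x^1,\dots,x^5$, while (triple)+(triple1) and (alttriple)+(triple2) are systems in the 6 variables $x^1,\dots,x^6$. Let $d\in\{5,6\}$ be the number of independent variables and let $U$ be a product of $d+3$ connected nonempty open subsets of $\Bbbk$, one for each of the variables $x^1,\dots,x^d,u,v,w$. A point symmetry over $U$ is a smooth (holomorphic if $\Bbbk=\mathbb C$) vector field $V=\sum_i a^i\partial_{x^i}+b^1\partial_u+b^2\partial_v+b^3\partial_w$ on $U$, with $a^i,b^j$ functions of all $d+3$ variables, such that the Lie derivatives of the defining equations of the system along the second prolongation of $V$ vanish at all 2-jets over $U$ that satisfy the system. Say that a space of vector fields on $U$ *depends on* given numbers of functions of given independent variables if it is in bijection with the tuples of arbitrary smooth (holomorphic) functions on $U$ of these variables alone, the bijection and its inverse both being given by linear differential operators of finite order with smooth (holomorphic) coefficients on $U$. **Proposition.** The point symmetry algebras of the four systems depend on finitely many functions of two variables and functions of one variable. Precisely: 1. (triple): 9 functions of $(x^4,x^5)$ and one function of $x^5$; 2. (alttriple): 2 functions of $(x^1,x^2)$ and 6 functions of $(x^3,x^5)$ (8 functions of two variables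 in all), and one function of $x^5$; 3. (triple)+(triple1): 11 functions of $(x^5,x^6)$; 4. (alttriple)+(triple2): 2 functions of $(x^1,x^2)$ and 8 functions of $(x^5,x^6)$ (10 functions of two variables in all). No further functions or constants occur. In particular symmetries do not reduce the number of functions of three variables on which involutive scroll structures depend, in the following sense: for each of the systems and each point of $U$, the space of $k$-jets at that point of the point symmetries has dimension $O(k^2)$ as $k\to\infty$ (whereas the $k$-jets of one arbitrary function of three variables form a space of dimension $\binom{k+3}{3}$). -/

import Mathlib

open scoped ContDiff

namespace ScrollSym

/-! ## Jets

There are `d` independent variables `x` and `m` dependent variables. The independent variables are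
labelled by `Fin d`, the label of `x^i` being the class of `i` modulo `d`: thus `1, …, d` are the `d`
distinct labels, and the numeral `d` denotes the same label as `0`. -/

/-- Labels of the coordinates on the space of 0-jets: `Sum.inl i` is an independent variable,
`Sum.inr α` a dependent one. -/
abbrev Coord (d m : ℕ) : Type := Fin d ⊕ Fin m

/-- Arrays `(x^i, u^α, u^α_i, u^α_ij)`. Second-order jets are the arrays that are symmetric in the
last two indices, see `Jet2.IsJet`. -/
abbrev Jet2 (R : Type*) (d m : ℕ) : Type _ :=
  (Fin d → R) × (Fin m → R) × (Fin m → Fin d → R) × (Fin m → Fin d → Fin d → R)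

namespace Jet2

/-- The underlying 0-jet. -/
def base {R : Type*} {d m : ℕ} (J : Jet2 R d m) : Coord d m → R := Sum.elim J.1 J.2.1

/-- The value `u^α`. -/
def val {R : Type*} {d m : ℕ} (J : Jet2 R d m) (α : Fin m) : R := J.2.1 α

/-- The first derivative `u^α_i`. -/
def d1 {R : Type*} {d m : ℕ} (J : Jet2 R d m) (α : Fin m) (i : Fin d) : R := J.2.2.1 α i

/-- The second derivative `u^α_ij`. -/
def d2 {R : Type*} {d m : ℕ} (J : Jet2 R d m) (α : Fin m) (i j : Fin d) : R := J.2.2.2 α i j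

/-- Symmetry of the second derivatives. -/
def IsJet {R : Type*} {d m : ℕ} (J : Jet2 R d m) : Prop := ∀ α i j, J.d2 α i j = J.d2 α j i

end Jet2

/-! ## The four PDE systems

The dependent variables are `u = u^0`, `v = u^1`, `w = u^2`. A system is the list of functions on the
space of 2-jets whose vanishing is required. -/

section Systems

variable {R : Type*} [CommRing R] {d : ℕ} [NeZero d]

/-- `u_i` -/
def u (J : Jet2 R d 3) (i : Fin d) : R := J.d1 0 i
/-- `v_i` -/
def v (J : Jet2 R d 3) (i : Fin d) : R := J.d1 1 i
/-- `w_i` -/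
def w (J : Jet2 R d 3) (i : Fin d) : R := J.d1 2 i
/-- the value of the dependent variable `w` -/
def w₀ (J : Jet2 R d 3) : R := J.val 2

/-- The operator `Q₁` applied to the dependent variable `s`; similarly below. -/
def Q₁ (J : Jet2 R d 3) (s : Fin 3) : R :=
  J.d2 s 2 3 - J.d2 s 1 4 + u J 1 * J.d2 s 2 2 + (v J 1 - u J 2) * J.d2 s 1 2 - v J 2 * J.d2 s 1 1

def Q₂ (J : Jet2 R d 3) (s : Fin 3) : R :=
  J.d2 s 3 3 - J.d2 s 1 5 + u J 1 * J.d2 s 2 3 + v J 1 * J.d2 s 1 3 - u J 3 * J.d2 s 1 2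
    + (w₀ J - v J 3) * J.d2 s 1 1

def Q₃ (J : Jet2 R d 3) (s : Fin 3) : R :=
  J.d2 s 3 4 - J.d2 s 2 5 + u J 2 * J.d2 s 2 3 - u J 3 * J.d2 s 2 2 + v J 2 * J.d2 s 1 3
    + (w₀ J - v J 3) * J.d2 s 1 2

def Q₄ (J : Jet2 R d 3) (s : Fin 3) : R :=
  J.d2 s 3 4 - J.d2 s 1 6 + u J 1 * J.d2 s 2 4 + v J 1 * J.d2 s 1 4
    + (w₀ J - u J 4) * J.d2 s 1 2 - v J 4 * J.d2 s 1 1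

def Q₅ (J : Jet2 R d 3) (s : Fin 3) : R :=
  J.d2 s 4 4 - J.d2 s 2 6 + u J 2 * J.d2 s 2 4 + v J 2 * J.d2 s 1 4
    + (w₀ J - u J 4) * J.d2 s 2 2 - v J 4 * J.d2 s 1 2

def Q₆ (J : Jet2 R d 3) (s : Fin 3) : R :=
  J.d2 s 4 5 - J.d2 s 3 6 + (v J 3 - w₀ J) * J.d2 s 1 4 + (w₀ J - u J 4) * J.d2 s 2 3
    + u J 3 * J.d2 s 2 4 - v J 4 * J.d2 s 1 3

def R₁ (J : Jet2 R d 3) (s : Fin 3) : R :=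
  u J 1 * J.d2 s 2 3 + v J 1 * J.d2 s 2 4 - u J 2 * J.d2 s 1 3 - v J 2 * J.d2 s 1 4

def R₂ (J : Jet2 R d 3) (s : Fin 3) : R :=
  u J 1 * J.d2 s 3 4 + v J 1 * J.d2 s 4 4 - J.d2 s 1 5 - u J 4 * J.d2 s 1 3
    - (v J 4 + w₀ J) * J.d2 s 1 4

def R₃ (J : Jet2 R d 3) (s : Fin 3) : R :=
  u J 2 * J.d2 s 3 4 + v J 2 * J.d2 s 4 4 - J.d2 s 2 5 - u J 4 * J.d2 s 2 3
    - (v J 4 + w₀ J) * J.d2 s 2 4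

def R₄ (J : Jet2 R d 3) (s : Fin 3) : R :=
  v J 1 * J.d2 s 3 4 + u J 1 * J.d2 s 3 3 - J.d2 s 1 6 - v J 3 * J.d2 s 1 4
    - (u J 3 + w₀ J) * J.d2 s 1 3

def R₅ (J : Jet2 R d 3) (s : Fin 3) : R :=
  v J 2 * J.d2 s 3 4 + u J 2 * J.d2 s 3 3 - J.d2 s 2 6 - v J 3 * J.d2 s 2 4
    - (u J 3 + w₀ J) * J.d2 s 2 3

def R₆ (J : Jet2 R d 3) (s : Fin 3) : R :=
  J.d2 s 3 5 - J.d2 s 4 6 + u J 4 * J.d2 s 3 3 - v J 3 * J.d2 s 4 4 + (v J 4 - u J 3) * J.d2 s 3 4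

/-- Conformal self-duality hierarchy, commuting vector fields: the equations `[X₁, X₂] = 0`, `[X₁, X₃] = 0`,
`[X₂, X₃] = 0`. -/
def triple (R : Type*) [CommRing R] (d : ℕ) [NeZero d] : List (Jet2 R d 3 → R) :=
  [fun J => Q₁ J 0 - w J 1,
   fun J => Q₁ J 1 + w J 2,
   fun J => Q₁ J 2,
   fun J => Q₂ J 0 + u J 1 * w J 1,
   fun J => Q₂ J 1 - u J 1 * w J 2,
   fun J => Q₂ J 2 + w J 1 ^ 2,
   fun J => Q₃ J 0 + w J 3 + u J 1 * w J 2,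
   fun J => Q₃ J 1 - (w J 4 + v J 2 * w J 1 - (v J 1 - u J 2) * w J 2),
   fun J => Q₃ J 2 + w J 1 * w J 2]

/-- Commuting vector fields, next flow: the equations `[X₁, X₄] = 0`, `[X₂, X₄] = 0`, `[X₃, X₄] = 0`. -/
def triple1 (R : Type*) [CommRing R] (d : ℕ) [NeZero d] : List (Jet2 R d 3 → R) :=
  [fun J => Q₄ J 0 - (w J 3 + (v J 1 - u J 2) * w J 1 + u J 1 * w J 2),
   fun J => Q₄ J 1 + w J 4 + v J 2 * w J 1,
   fun J => Q₄ J 2 + w J 1 * w J 2,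
   fun J => Q₅ J 0 - v J 2 * w J 1,
   fun J => Q₅ J 1 + v J 2 * w J 2,
   fun J => Q₅ J 2 + w J 2 ^ 2,
   fun J => Q₆ J 0 - (w J 5 + (v J 3 - w₀ J) * w J 1 + u J 1 * w J 4 - u J 2 * w J 3
      + u J 3 * w J 2),
   fun J => Q₆ J 1 - (-w J 6 + v J 1 * w J 4 - v J 2 * w J 3 + (w₀ J - u J 4) * w J 2
      - v J 4 * w J 1),
   fun J => Q₆ J 2 - (w J 1 * w J 4 - w J 2 * w J 3)]

/-- Conformal self-duality hierarchy, alternative form: involutivity of `⟨Y₁, Y₂, Y₃⟩`. -/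
def alttriple (R : Type*) [CommRing R] (d : ℕ) [NeZero d] : List (Jet2 R d 3 → R) :=
  [fun J => R₁ J 0 - (u J 1 * w J 2 - u J 2 * w J 1),
   fun J => R₁ J 1 - (v J 1 * w J 2 - v J 2 * w J 1),
   fun J => R₁ J 2,
   fun J => R₂ J 0 - u J 1 * w J 4,
   fun J => R₂ J 1 + u J 1 * w J 3,
   fun J => R₂ J 2 - w J 1 * w J 4,
   fun J => R₃ J 0 - u J 2 * w J 4,
   fun J => R₃ J 1 + u J 2 * w J 3,
   fun J => R₃ J 2 - w J 2 * w J 4]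

/-- Alternative form, next flow: the further equations for involutivity of `⟨Y₁, Y₂, Y₃, Y₄⟩`. -/
def triple2 (R : Type*) [CommRing R] (d : ℕ) [NeZero d] : List (Jet2 R d 3 → R) :=
  [fun J => R₄ J 0 + v J 1 * w J 4,
   fun J => R₄ J 1 - v J 1 * w J 3,
   fun J => R₄ J 2 - w J 1 * w J 3,
   fun J => R₅ J 0 + v J 2 * w J 4,
   fun J => R₅ J 1 - v J 2 * w J 3,
   fun J => R₅ J 2 - w J 2 * w J 3,
   fun J => R₆ J 0 + w J 5 + (v J 4 + w₀ J) * w J 4 + u J 4 * w J 3,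
   fun J => R₆ J 1 - (w J 6 + (u J 3 + w₀ J) * w J 3 + v J 3 * w J 4),
   fun J => R₆ J 2]

end Systems

/-! ## Point symmetries -/

noncomputable section

/-- Partial derivative in the `i`-th coordinate. -/
def pd {𝕜 : Type*} [RCLike 𝕜] {ι : Type*} [Fintype ι] [DecidableEq ι] (i : ι)
    (g : (ι → 𝕜) → 𝕜) : (ι → 𝕜) → 𝕜 :=
  fun z => fderiv 𝕜 g z (Pi.single i 1)

/-- Total derivative `D_i g` of a function `g` of the 0-jet:
`g_{x^i} + u^β_i g_{u^β}`. -/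
def totalD {𝕜 : Type*} [RCLike 𝕜] {d m : ℕ} (i : Fin d) (g : (Coord d m → 𝕜) → 𝕜)
    (J : Jet2 𝕜 d m) : 𝕜 :=
  pd (.inl i) g J.base + ∑ β, J.d1 β i * pd (.inr β) g J.base

/-- Second total derivative `D_i D_j g` of a function `g` of the 0-jet. -/
def totalDD {𝕜 : Type*} [RCLike 𝕜] {d m : ℕ} (i j : Fin d) (g : (Coord d m → 𝕜) → 𝕜)
    (J : Jet2 𝕜 d m) : 𝕜 :=
  pd (.inl i) (pd (.inl j) g) J.base
    + ∑ β, J.d1 β i * pd (.inr β) (pd (.inl j) g) J.base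
    + ∑ β, J.d1 β j * pd (.inl i) (pd (.inr β) g) J.base
    + ∑ β, ∑ γ, J.d1 β i * J.d1 γ j * pd (.inr β) (pd (.inr γ) g) J.base
    + ∑ β, J.d2 β i j * pd (.inr β) g J.base

/-- A vector field `∑ aⁱ ∂_{xⁱ} + ∑ b^α ∂_{u^α}` on (an open set of) the space of 0-jets, given by its
components: `aⁱ = V (inl i)` and `b^α = V (inr α)`. All of them may depend on all variables. -/
abbrev VField (𝕜 : Type*) (d m : ℕ) : Type _ := Coord d m → (Coord d m → 𝕜) → 𝕜

/-- The second prolongation of a vector field, evaluated at a 2-jet; its components are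
`aⁱ`, `b^α`, `b^α_i = D_i b^α - (D_i a^k) u^α_k` and
`b^α_ij = D_i D_j b^α - (D_i D_j a^k) u^α_k - (D_i a^k) u^α_jk - (D_j a^k) u^α_ik`. -/
def prolong {𝕜 : Type*} [RCLike 𝕜] {d m : ℕ} (V : VField 𝕜 d m) (J : Jet2 𝕜 d m) : Jet2 𝕜 d m :=
  (fun i => V (.inl i) J.base,
   fun α => V (.inr α) J.base,
   fun α i => totalD i (V (.inr α)) J - ∑ k, totalD i (V (.inl k)) J * J.d1 α k,
   fun α i j => totalDD i j (V (.inr α)) J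
      - ∑ k, (totalDD i j (V (.inl k)) J * J.d1 α k
          + totalD i (V (.inl k)) J * J.d2 α j k + totalD j (V (.inl k)) J * J.d2 α i k))

/-- The (infinitesimal) point symmetries, over the open set `U` of 0-jets, of the PDE system `Sys`:
smooth (for `𝕜 = ℂ`: holomorphic) vector fields on `U` such that the Lie derivatives of the defining
equations along the second prolongation vanish on the system. -/
def pointSymmetries {𝕜 : Type*} [RCLike 𝕜] {d m : ℕ} (Sys : List (Jet2 𝕜 d m → 𝕜))
    (U : Set (Coord d m → 𝕜)) : Set (VField 𝕜 d m) :=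
  {V | (∀ c, ContDiffOn 𝕜 ∞ (V c) U) ∧
    ∀ J : Jet2 𝕜 d m, J.IsJet → J.base ∈ U → (∀ F ∈ Sys, F J = 0) →
      ∀ F ∈ Sys, lineDeriv 𝕜 F J (prolong V J) = 0}

/-! ## Functional freedom -/

/-- Scalar linear differential operators of finite order, with coefficients that are smooth on `U`,
acting on `κ`-tuples of functions: generated from the components by partial derivatives,
multiplication by functions and sums. -/
inductive IsDiffOp {𝕜 : Type*} [RCLike 𝕜] {ι κ : Type*} [Fintype ι] [DecidableEq ι]
    (U : Set (ι → 𝕜)) : ((κ → (ι → 𝕜) → 𝕜) → (ι → 𝕜) → 𝕜) → Prop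
  | zero : IsDiffOp U (fun _ _ => 0)
  | comp (k : κ) : IsDiffOp U (fun f => f k)
  | deriv (i : ι) (T : (κ → (ι → 𝕜) → 𝕜) → (ι → 𝕜) → 𝕜) :
      IsDiffOp U T → IsDiffOp U (fun f => pd i (T f))
  | mul (a : (ι → 𝕜) → 𝕜) (T : (κ → (ι → 𝕜) → 𝕜) → (ι → 𝕜) → 𝕜) :
      ContDiffOn 𝕜 ∞ a U → IsDiffOp U T → IsDiffOp U (fun f z => a z * T f z)
  | add (S T : (κ → (ι → 𝕜) → 𝕜) → (ι → 𝕜) → 𝕜) :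
      IsDiffOp U S → IsDiffOp U T → IsDiffOp U (fun f z => S f z + T f z)

/-- Tuples of smooth functions on `U`, the `k`-th of which is a function of the independent variables
`x^i`, `i ∈ args k`, alone: `(args k).card` is the number of its arguments. -/
def parameterTuples {𝕜 : Type*} [RCLike 𝕜] {d m : ℕ} {κ : Type*} (U : Set (Coord d m → 𝕜))
    (args : κ → Finset (Fin d)) : Set (κ → (Coord d m → 𝕜) → 𝕜) :=
  {f | ∀ k, ContDiffOn 𝕜 ∞ (f k) U ∧
    ∀ z ∈ U, ∀ z' ∈ U, (∀ i ∈ args k, z (.inl i) = z' (.inl i)) → f k z = f k z'}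

/-- The space `S` of vector fields on `U` depends exactly on arbitrary functions, one for each `k : κ`,
of the arguments `args k`: it is parametrised bijectively (over `U`) by such tuples of functions, by
means of a linear differential operator `P` whose inverse `Q` is a linear differential operator too. -/
def DependsOnFunctions {𝕜 : Type*} [RCLike 𝕜] {d m : ℕ} {κ : Type*} (U : Set (Coord d m → 𝕜))
    (S : Set (VField 𝕜 d m)) (args : κ → Finset (Fin d)) : Prop :=
  ∃ (P : (κ → (Coord d m → 𝕜) → 𝕜) → VField 𝕜 d m)
    (Q : VField 𝕜 d m → κ → (Coord d m → 𝕜) → 𝕜),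
    (∀ c, IsDiffOp U (fun f => P f c)) ∧ (∀ k, IsDiffOp U (fun V => Q V k)) ∧
    (∀ f ∈ parameterTuples U args, P f ∈ S ∧ ∀ k, Set.EqOn (Q (P f) k) (f k) U) ∧
    (∀ V ∈ S, Q V ∈ parameterTuples U args ∧ ∀ c, Set.EqOn (P (Q V) c) (V c) U)

/-- All partial derivatives of order at most `k` of the components of `V` at `z`. -/
def jetAt {𝕜 : Type*} [RCLike 𝕜] {d m : ℕ} (k : ℕ) (z : Coord d m → 𝕜) (V : VField 𝕜 d m) :
    ((n : Fin (k + 1)) × (Fin n → Coord d m)) × Coord d m → 𝕜 :=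
  fun p => (List.ofFn p.1.2).foldr pd (V p.2) z

/-- The dimension of the space of `k`-jets at `z` of the vector fields in `S`. -/
def jetDim {𝕜 : Type*} [RCLike 𝕜] {d m : ℕ} (S : Set (VField 𝕜 d m)) (z : Coord d m → 𝕜) (k : ℕ) :
    ℕ :=
  Module.finrank 𝕜 (Submodule.span 𝕜 (jetAt k z '' S))

end

end ScrollSym

namespace ScrollSym

set_option linter.unusedSectionVars false

/-! ## The differential algebra of smooth functions on an open set -/

section SmoothAlgebra

variable {𝕜 : Type*} [RCLike 𝕜] {ι : Type*} [Fintype ι] [DecidableEq ι]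

open TopologicalSpace

/-! Every equation of the four systems is quasilinear: one of the operators `Q₁`, …, `R₆`, whose
symbol is a quadratic form in covectors with coefficients given by the 1-jet, is applied to u, v or
w and equated to a first-order expression. If ξ is null for all symbols at some 1-jet, then adding ξ
⊗ ξ to the second derivatives of w leads from one 2-jet on the system to another. Subtracting the
symmetry conditions for the w-equations at these two jets leaves only the statement that the
prolonged vector field is tangent to the family of null cones (`triple_null` and its analogues).

This statement is linear in the first derivatives of the vector field and contains no second
derivatives. It is evaluated on finitely many null covectors over finitely many 1-jets. For (triple)
at the zero 1-jet with w = 0 the null covectors are (a, b, aλ, bλ, aλ²) and their limits, the cone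
over a cubic scroll; with (triple1) one gets (a, b, aλ, bλ, aλ², bλ²). Elimination shows that the
components along x depend on x alone and that most first derivatives of the remaining components are
combinations of theirs (`triple_relations`, `alttriple_relations`, `full_relations`,
`altfull_relations`). It suffices to do this where w = 0: the systems are unchanged when a constant
is added to w and slopes of u and v are shifted accordingly (`IsJetSymmetry.shift`). The few
relations still missing come from the complete symmetry condition at jets with prescribed w_1, w_2.

The relations form an overdetermined linear system for the vector field, which is integrated step by
step: mixed derivatives show that a suitable remainder does not depend on one variable after
another, until it is a function of two variables or of one (`exists_tripleP` etc.). The outcome is a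
differential operator P from parameters to vector fields, and an operator Q that recovers the
parameters successively by differentiation and subtraction. Conversely, every P f is a symmetry:
after the system is used to eliminate principal second derivatives, or to supply multiples of the
equations of `R₁`, the linearised equations are polynomial identities (`tripleP_mem` etc.).

Since P has some finite order R, the k-jet of P f at a point is a fixed linear combination of
derivatives of order at most k + R of functions of at most two variables, so there are O(k²)
relevant numbers (`jetDim_isBigO`). -/

theorem pd_eqOn {U : Set (ι → 𝕜)} (hU : IsOpen U) (c : ι) {f g : (ι → 𝕜) → 𝕜}
    (h : Set.EqOn f g U) : Set.EqOn (pd c f) (pd c g) U := fun z hz => by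
  simp only [pd]
  rw [(Filter.eventuallyEq_of_mem (hU.mem_nhds hz) h).fderiv_eq]

theorem contDiffOn_pd {U : Set (ι → 𝕜)} (hU : IsOpen U) (c : ι) {f : (ι → 𝕜) → 𝕜}
    (h : ContDiffOn 𝕜 ∞ f U) : ContDiffOn 𝕜 ∞ (pd c f) U :=
  (h.fderiv_of_isOpen hU (by simp)).clm_apply contDiffOn_const

theorem pd_comm {U : Set (ι → 𝕜)} (hU : IsOpen U) (c c' : ι) {f : (ι → 𝕜) → 𝕜}
    (h : ContDiffOn 𝕜 ∞ f U) : Set.EqOn (pd c (pd c' f)) (pd c' (pd c f)) U := fun z hz => by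
  have hf : ContDiffAt 𝕜 ∞ f z := h.contDiffAt (hU.mem_nhds hz)
  have hd : DifferentiableAt 𝕜 (fderiv 𝕜 f) z :=
    ((h.fderiv_of_isOpen hU (m := ∞) (by simp)).contDiffAt (hU.mem_nhds hz)).differentiableAt
      (by simp)
  have key : ∀ a b : ι, pd a (pd b f) z
      = fderiv 𝕜 (fderiv 𝕜 f) z (Pi.single a 1) (Pi.single b 1) := fun a b => by
    change fderiv 𝕜 (fun y => fderiv 𝕜 f y (Pi.single b 1)) z (Pi.single a 1) = _
    rw [fderiv_clm_apply hd (differentiableAt_const _)]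
    simp
  rw [key, key]
  exact (hf.isSymmSndFDerivAt (by
    simp only [minSmoothness_of_isRCLikeNormedField]; exact WithTop.coe_le_coe.2 le_top)).eq _ _

/-- The algebra of smooth functions on the open set `U`. -/
def smoothSubalgebra (U : Opens (ι → 𝕜)) : Subalgebra 𝕜 (U → 𝕜) where
  carrier := {f | ∃ g : (ι → 𝕜) → 𝕜, ContDiffOn 𝕜 ∞ g U ∧ ∀ z : U, g z = f z}
  mul_mem' := by
    rintro f f' ⟨g, hg, hf⟩ ⟨g', hg', hf'⟩
    exact ⟨fun z => g z * g' z, hg.mul hg', fun z => by simp [hf, hf']⟩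
  add_mem' := by
    rintro f f' ⟨g, hg, hf⟩ ⟨g', hg', hf'⟩
    exact ⟨fun z => g z + g' z, hg.add hg', fun z => by simp [hf, hf']⟩
  algebraMap_mem' r := ⟨fun _ => r, contDiffOn_const, fun z => rfl⟩

/-- The type of smooth functions on the open set `U`. -/
def SmoothAlg (U : Opens (ι → 𝕜)) : Type _ := smoothSubalgebra U

variable {U : Opens (ι → 𝕜)}

/-- Passing to this ring identifies functions that agree on `U`. With the commuting derivations `D`
it is a differential ring in which identities between derivatives are accessible to `ring`,
`linear_combination` and `grind`. -/
instance : CommRing (SmoothAlg U) := inferInstanceAs (CommRing (smoothSubalgebra U))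

instance : Algebra 𝕜 (SmoothAlg U) := inferInstanceAs (Algebra 𝕜 (smoothSubalgebra U))

namespace SmoothAlg

/-- The element of `SmoothAlg U` given by a function that is smooth on `U`. -/
def mk (f : (ι → 𝕜) → 𝕜) (hf : ContDiffOn 𝕜 ∞ f U) : SmoothAlg U :=
  ⟨fun z => f z, f, hf, fun _ => rfl⟩

/-- Extension by zero. -/
noncomputable def lift (f : SmoothAlg U) : (ι → 𝕜) → 𝕜 := Function.extend Subtype.val f.1 0

/-- Evaluation at a point of `U`. -/
def evalAt (z : U) : SmoothAlg U →ₐ[𝕜] 𝕜 :=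
  (Pi.evalAlgHom 𝕜 (fun _ : U => 𝕜) z).comp (smoothSubalgebra U).val

theorem ext' {f g : SmoothAlg U} (h : ∀ z, evalAt z f = evalAt z g) : f = g :=
  Subtype.ext (funext h)

@[simp] theorem evalAt_mk (z : U) (f : (ι → 𝕜) → 𝕜) (hf : ContDiffOn 𝕜 ∞ f U) :
    evalAt z (mk f hf) = f z := rfl

theorem lift_apply (f : SmoothAlg U) (z : U) : f.lift z = evalAt z f :=
  Subtype.val_injective.extend_apply _ _ _

theorem contDiffOn_lift (f : SmoothAlg U) : ContDiffOn 𝕜 ∞ f.lift U := by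
  obtain ⟨g, hg, h⟩ := f.2
  exact hg.congr fun z hz => (f.lift_apply ⟨z, hz⟩).trans (h ⟨z, hz⟩).symm

theorem mk_lift (f : SmoothAlg U) : mk f.lift f.contDiffOn_lift = f :=
  ext' fun z => f.lift_apply z

theorem mk_eq_mk {f g : (ι → 𝕜) → 𝕜} {hf : ContDiffOn 𝕜 ∞ f U} {hg : ContDiffOn 𝕜 ∞ g U} :
    mk f hf = mk g hg ↔ Set.EqOn f g U :=
  ⟨fun h z hz => congrArg (evalAt ⟨z, hz⟩) h, fun h => ext' fun z => h z.2⟩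

theorem lift_mk_eqOn (f : (ι → 𝕜) → 𝕜) (hf : ContDiffOn 𝕜 ∞ f U) :
    Set.EqOn (mk f hf).lift f U := fun z hz => lift_apply _ ⟨z, hz⟩

theorem differentiableAt_lift (f : SmoothAlg U) (z : U) : DifferentiableAt 𝕜 f.lift z :=
  (f.contDiffOn_lift.contDiffAt (U.2.mem_nhds z.2)).differentiableAt (by simp)

end SmoothAlg

open SmoothAlg

/-- The partial derivative in the `c`-th coordinate, on `SmoothAlg U`. -/
noncomputable def D (c : ι) (f : SmoothAlg U) : SmoothAlg U :=
  SmoothAlg.mk (pd c f.lift) (contDiffOn_pd U.2 c f.contDiffOn_lift)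

theorem D_add (c : ι) (f g : SmoothAlg U) : D c (f + g) = D c f + D c g := ext' fun z => by
  have h : Set.EqOn (f + g).lift (f.lift + g.lift) U := fun z hz => by
    simp [lift_apply _ ⟨z, hz⟩]
  rw [D, evalAt_mk, pd_eqOn U.2 c h z.2, pd,
    fderiv_add (f.differentiableAt_lift z) (g.differentiableAt_lift z)]
  rfl

theorem D_mul (c : ι) (f g : SmoothAlg U) : D c (f * g) = D c f * g + f * D c g := ext' fun z => by
  have h : Set.EqOn (f * g).lift (f.lift * g.lift) U := fun z hz => by
    simp [lift_apply _ ⟨z, hz⟩]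
  rw [D, evalAt_mk, pd_eqOn U.2 c h z.2, pd,
    fderiv_mul (f.differentiableAt_lift z) (g.differentiableAt_lift z), lift_apply, lift_apply,
    add_comm, mul_comm (D c f), map_add, map_mul, map_mul]
  rfl

theorem D_algebraMap (c : ι) (r : 𝕜) : D c (algebraMap 𝕜 (SmoothAlg U) r) = 0 := ext' fun z => by
  have h : Set.EqOn (algebraMap 𝕜 (SmoothAlg U) r).lift (fun _ => r) U := fun z hz => by
    simp [lift_apply _ ⟨z, hz⟩]
  rw [D, evalAt_mk, pd_eqOn U.2 c h z.2, pd]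
  simp

theorem D_zero (c : ι) : D c (0 : SmoothAlg U) = 0 := by simpa using D_algebraMap (U := U) c 0

theorem D_ofNat (c : ι) (n : ℕ) [n.AtLeastTwo] : D c (OfNat.ofNat n : SmoothAlg U) = 0 := by
  rw [← map_ofNat (algebraMap 𝕜 (SmoothAlg U)) n, D_algebraMap]

theorem D_neg (c : ι) (f : SmoothAlg U) : D c (-f) = -D c f :=
  eq_neg_of_add_eq_zero_left (by rw [← D_add, neg_add_cancel, D_zero])

theorem D_sub (c : ι) (f g : SmoothAlg U) : D c (f - g) = D c f - D c g := by
  rw [sub_eq_add_neg, D_add, D_neg, sub_eq_add_neg]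

theorem D_mk (c : ι) (f : (ι → 𝕜) → 𝕜) (hf : ContDiffOn 𝕜 ∞ f U) :
    D c (SmoothAlg.mk f hf) = SmoothAlg.mk (pd c f) (contDiffOn_pd U.2 c hf) :=
  mk_eq_mk.2 (pd_eqOn U.2 c (lift_mk_eqOn f hf))

theorem D_comm (c c' : ι) (f : SmoothAlg U) : D c (D c' f) = D c' (D c f) := by
  rw [← f.mk_lift]
  simp only [D_mk, mk_eq_mk]
  exact pd_comm U.2 c c' f.contDiffOn_lift

/-- The constant function `1 / 2`. -/
noncomputable def half : SmoothAlg U := algebraMap 𝕜 _ (1 / 2)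

theorem D_half (c : ι) : D c (half : SmoothAlg U) = 0 := D_algebraMap _ _

theorem evalAt_half (z : U) : evalAt z half = (1 / 2 : 𝕜) := AlgHom.commutes _ _

theorem two_mul_half : 2 * (half : SmoothAlg U) = 1 :=
  ext' fun z => by simp [evalAt_half, map_ofNat]

/-- The coordinate functions. -/
def X (c : ι) : SmoothAlg U := SmoothAlg.mk (fun z => z c) (contDiff_apply 𝕜 𝕜 c).contDiffOn

theorem D_X (c c' : ι) : D c (X c' : SmoothAlg U) = if c = c' then 1 else 0 := by
  refine ext' fun z => ?_
  rw [X, D_mk, evalAt_mk, pd]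
  have : fderiv 𝕜 (fun z : ι → 𝕜 => z c') z = ContinuousLinearMap.proj c' :=
    (ContinuousLinearMap.proj (R := 𝕜) (φ := fun _ : ι => 𝕜) c').fderiv
  rw [this]
  by_cases h : c = c'
  · subst h; simp
  · simp [h, Ne.symm h]

@[simp] theorem evalAt_X (z : U) (c : ι) : evalAt z (X c) = z.1 c := rfl

/-- On a product of connected open sets, a function with vanishing derivatives in some coordinates
depends on the others alone. -/
theorem eq_of_forall_D_eq_zero {I : ι → Set 𝕜} (hI : ∀ c, IsOpen (I c) ∧ IsConnected (I c))
    (hU : (U : Set (ι → 𝕜)) = Set.pi Set.univ I) (s : Finset ι) (f : SmoothAlg U)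
    (hf : ∀ c ∉ s, D c f = 0) (z z' : U) (h : ∀ c ∈ s, z.1 c = z'.1 c) :
    evalAt z f = evalAt z' f := by
  have mem : ∀ y : ι → 𝕜, (∀ c, y c ∈ I c) → y ∈ U := fun y hy => by
    rw [← SetLike.mem_coe, hU]; simpa using hy
  have mem' : ∀ y : U, ∀ c, y.1 c ∈ I c := fun y c => by
    have := y.2; rw [← SetLike.mem_coe, hU] at this; exact this c trivial
  -- The slice of a box along a coordinate is the connected open set `I c`, on which the restricted
  -- function has derivative zero.
  have step : ∀ c ∉ s, ∀ y ∈ U, ∀ t ∈ I c, f.lift (Function.update y c t) = f.lift y := by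
    intro c hc y hy t ht
    have hline : ∀ t ∈ I c, Function.update y c t ∈ U := fun t ht => mem _ fun c' => by
      by_cases h : c' = c
      · subst h; simpa using ht
      · simpa [h] using mem' ⟨y, hy⟩ c'
    have hd : ∀ t ∈ I c, HasDerivAt (fun t => f.lift (Function.update y c t)) 0 t := by
      intro t ht
      have h1 := (f.differentiableAt_lift ⟨_, hline t ht⟩).hasFDerivAt.comp_hasDerivAt t
        (hasDerivAt_update y c t)
      have h2 : fderiv 𝕜 f.lift (Function.update y c t) (Pi.single c 1) = 0 :=
        congrArg (evalAt ⟨_, hline t ht⟩) (hf c hc)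
      rwa [h2] at h1
    have := (hI c).1.is_const_of_deriv_eq_zero (hI c).2.isPreconnected
      (fun t ht => (hd t ht).differentiableAt.differentiableWithinAt)
      (fun t ht => (hd t ht).deriv) ht (mem' ⟨y, hy⟩ c)
    simpa using this
  -- The coordinates outside `s` are exchanged one at a time; as `U` is a product, no intermediate
  -- point leaves it.
  have main : ∀ T : Finset ι, Disjoint T s →
      ∃ y ∈ U, f.lift y = f.lift z.1 ∧ ∀ c, y c = if c ∈ T then z'.1 c else z.1 c := by
    intro T
    induction T using Finset.induction_on with
    | empty => exact fun _ => ⟨z, z.2, rfl, by simp⟩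
    | insert c T hcT ih =>
      intro hd
      rw [Finset.disjoint_insert_left] at hd
      obtain ⟨y, hy, h1, h2⟩ := ih hd.2
      refine ⟨Function.update y c (z'.1 c), mem _ fun c' => ?_,
        (step c hd.1 y hy _ (mem' z' c)).trans h1, fun c' => ?_⟩
      · by_cases h : c' = c
        · subst h; simpa using mem' z' c'
        · simpa [h] using mem' ⟨y, hy⟩ c'
      · by_cases h : c' = c
        · subst h; simp
        · simp [h, h2]
  obtain ⟨y, hy, h1, h2⟩ := main sᶜ disjoint_compl_left
  have : y = z'.1 := funext fun c => by
    rw [h2]; by_cases hc : c ∈ s <;> simp [hc, h]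
  rw [← f.lift_apply, ← f.lift_apply, ← h1, this]

/-- A function of some of the coordinates has vanishing derivatives in the others. -/
theorem D_eq_zero_of_forall_eq (s : Finset ι) (f : SmoothAlg U)
    (hf : ∀ z z' : U, (∀ c ∈ s, z.1 c = z'.1 c) → evalAt z f = evalAt z' f) (c : ι) (hc : c ∉ s) :
    D c f = 0 := by
  refine ext' fun z => ?_
  have hz : Function.update z.1 c (z.1 c) = z.1 := Function.update_eq_self c z.1
  have h1 : HasDerivAt (f.lift ∘ Function.update z.1 c) (fderiv 𝕜 f.lift z (Pi.single c 1)) (z.1 c) :=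
    ((f.differentiableAt_lift z).hasFDerivAt.congr_of_eventuallyEq (by rfl)).comp_hasDerivAt_of_eq
      (z.1 c) (hasDerivAt_update z.1 c (z.1 c)) hz.symm
  -- Openness of `U` is enough here: close to `z` the coordinate line stays inside `U`, and there
  -- `f` is constant.
  have h2 : (f.lift ∘ Function.update z.1 c) =ᶠ[nhds (z.1 c)] fun _ => f.lift z.1 := by
    have hcont : Continuous (Function.update z.1 c) := continuous_const.update c continuous_id
    have : ∀ᶠ t in nhds (z.1 c), Function.update z.1 c t ∈ U :=
      hcont.continuousAt.eventually_mem (U.2.mem_nhds (hz.symm ▸ z.2))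
    filter_upwards [this] with t ht
    refine (f.lift_apply ⟨_, ht⟩).trans ((hf ⟨_, ht⟩ z fun c' hc' => ?_).trans (f.lift_apply z).symm)
    have : c' ≠ c := fun h => hc (h ▸ hc')
    simp [this]
  exact (h1.congr_of_eventuallyEq h2.symm).unique (hasDerivAt_const (z.1 c) (f.lift z.1))

end SmoothAlgebra

end ScrollSym

namespace ScrollSym

set_option linter.unusedSectionVars false

/-! ## Differential operators and functional freedom -/

section Operators

variable {𝕜 : Type*} [RCLike 𝕜] {ι : Type*} [Fintype ι] [DecidableEq ι]

open TopologicalSpace SmoothAlg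

variable {U : Opens (ι → 𝕜)} {κ : Type*}

/-- Linear differential operators acting on tuples of elements of `SmoothAlg U`. -/
inductive IsAlgOp : ((κ → SmoothAlg U) → SmoothAlg U) → Prop
  | zero : IsAlgOp fun _ => 0
  | comp (k : κ) : IsAlgOp fun f => f k
  | deriv (c : ι) (T : (κ → SmoothAlg U) → SmoothAlg U) : IsAlgOp T → IsAlgOp fun f => D c (T f)
  | mul (a : SmoothAlg U) (T : (κ → SmoothAlg U) → SmoothAlg U) : IsAlgOp T → IsAlgOp fun f => a * T f
  | add (S T : (κ → SmoothAlg U) → SmoothAlg U) :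
      IsAlgOp S → IsAlgOp T → IsAlgOp fun f => S f + T f

namespace IsAlgOp

variable {S T : (κ → SmoothAlg U) → SmoothAlg U}

theorem neg (hT : IsAlgOp T) : IsAlgOp fun f => -T f := by
  simpa only [neg_one_mul] using hT.mul (-1)

theorem sub (hS : IsAlgOp S) (hT : IsAlgOp T) : IsAlgOp fun f => S f - T f := by
  simpa only [sub_eq_add_neg] using hS.add _ _ hT.neg

/-- `IsDiffOp` acts on functions on the whole space, with arbitrary values outside `U`. Induction
along the constructors gives such a representative for every operator on the differential ring, its
coefficients being extended by zero. -/
theorem exists_isDiffOp (hT : IsAlgOp T) : ∃ T' : (κ → (ι → 𝕜) → 𝕜) → (ι → 𝕜) → 𝕜,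
    IsDiffOp (U : Set (ι → 𝕜)) T' ∧ ∀ (f : κ → (ι → 𝕜) → 𝕜) (hf : ∀ k, ContDiffOn 𝕜 ∞ (f k) U),
      ∃ h : ContDiffOn 𝕜 ∞ (T' f) U, SmoothAlg.mk (T' f) h = T fun k => SmoothAlg.mk (f k) (hf k) := by
  induction hT with
  | zero => exact ⟨_, .zero, fun f hf => ⟨contDiffOn_const, rfl⟩⟩
  | comp k => exact ⟨_, .comp k, fun f hf => ⟨hf k, rfl⟩⟩
  | deriv c T _ ih =>
    obtain ⟨T', h1, h2⟩ := ih
    refine ⟨_, .deriv c T' h1, fun f hf => ?_⟩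
    obtain ⟨h, h3⟩ := h2 f hf
    exact ⟨contDiffOn_pd U.2 c h, (D_mk c _ h).symm.trans (congrArg (D c) h3)⟩
  | mul a T _ ih =>
    obtain ⟨T', h1, h2⟩ := ih
    refine ⟨_, .mul a.lift T' a.contDiffOn_lift h1, fun f hf => ?_⟩
    obtain ⟨h, h3⟩ := h2 f hf
    exact ⟨a.contDiffOn_lift.mul h, ext' fun z => by simp [← h3, lift_apply]⟩
  | add S T _ _ ih ih' =>
    obtain ⟨S', h1, h2⟩ := ih
    obtain ⟨T', h1', h2'⟩ := ih'
    refine ⟨_, .add S' T' h1 h1', fun f hf => ?_⟩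
    obtain ⟨h, h3⟩ := h2 f hf
    obtain ⟨h', h3'⟩ := h2' f hf
    exact ⟨h.add h', ext' fun z => by simp [← h3, ← h3']⟩

end IsAlgOp

theorem contDiffOn_foldr_pd (w : List ι) {f : (ι → 𝕜) → 𝕜} (hf : ContDiffOn 𝕜 ∞ f U) :
    ∃ h : ContDiffOn 𝕜 ∞ (w.foldr pd f) U,
      SmoothAlg.mk (w.foldr pd f) h = w.foldr D (SmoothAlg.mk f hf) := by
  induction w with
  | nil => exact ⟨hf, rfl⟩
  | cons c w ih =>
    obtain ⟨h, h'⟩ := ih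
    exact ⟨contDiffOn_pd U.2 c h, (D_mk c _ h).symm.trans (congrArg (D c) h')⟩

end Operators

section Freedom

variable {𝕜 : Type*} [RCLike 𝕜] {d m : ℕ}

open TopologicalSpace SmoothAlg

variable {U : Opens (Coord d m → 𝕜)} {κ : Type*}

/-- The vanishing of all partial derivatives except those in the independent variables in `s`. -/
def DependsOnly (s : Finset (Fin d)) (f : SmoothAlg U) : Prop :=
  (∀ β, D (.inr β) f = 0) ∧ ∀ i ∉ s, D (.inl i) f = 0

/-- This equivalence makes "function of certain variables alone" a linear differential condition.
That vanishing derivatives suffice depends on `U` being a product of connected sets. -/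
theorem dependsOnly_iff {I : Coord d m → Set 𝕜} (hI : ∀ c, IsOpen (I c) ∧ IsConnected (I c))
    (hU : (U : Set (Coord d m → 𝕜)) = Set.pi Set.univ I) (s : Finset (Fin d)) (f : SmoothAlg U) :
    DependsOnly s f ↔ ∀ z z' : U, (∀ i ∈ s, z.1 (.inl i) = z'.1 (.inl i)) →
      evalAt z f = evalAt z' f := by
  constructor
  · refine fun h z z' hz => eq_of_forall_D_eq_zero hI hU (s.map .inl) f ?_ z z' (by simpa using hz)
    rintro (i | β) hc
    · exact h.2 i (by simpa using hc)
    · exact h.1 β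
  · intro h
    have key := D_eq_zero_of_forall_eq (s.map .inl) f fun z z' hz => h z z' (by simpa using hz)
    exact ⟨fun β => key _ (by simp), fun i hi => key _ (by simpa using hi)⟩

/-- All analysis is left behind here: it remains to exhibit mutually inverse operators on the
differential ring. The identity `hPQ` is asked of all tuples, symmetric or not, because it will hold
by construction of `Q`. -/
theorem dependsOnFunctions_of_isAlgOp {I : Coord d m → Set 𝕜}
    (hI : ∀ c, IsOpen (I c) ∧ IsConnected (I c))
    (hU : (U : Set (Coord d m → 𝕜)) = Set.pi Set.univ I) {S : Set (VField 𝕜 d m)}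
    {A : Set (Coord d m → SmoothAlg U)} {args : κ → Finset (Fin d)}
    (hS : ∀ V, V ∈ S ↔ ∃ h : ∀ c, ContDiffOn 𝕜 ∞ (V c) U, (fun c => SmoothAlg.mk (V c) (h c)) ∈ A)
    {P : (κ → SmoothAlg U) → Coord d m → SmoothAlg U} {Q : (Coord d m → SmoothAlg U) → κ → SmoothAlg U}
    (hP : ∀ c, IsAlgOp fun f => P f c) (hQ : ∀ k, IsAlgOp fun V => Q V k)
    (hPA : ∀ f, (∀ k, DependsOnly (args k) (f k)) → P f ∈ A) (hQP : ∀ f,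
      (∀ k, DependsOnly (args k) (f k)) → ∀ k, Q (P f) k = f k)
    (hQA : ∀ V ∈ A, ∀ k, DependsOnly (args k) (Q V k)) (hPQ : ∀ V c, P (Q V) c = V c) :
    DependsOnFunctions (U : Set (Coord d m → 𝕜)) S args := by
  choose P' hP1 hP2 using fun c => (hP c).exists_isDiffOp
  choose Q' hQ1 hQ2 using fun k => (hQ k).exists_isDiffOp
  refine ⟨fun f c => P' c f, fun V k => Q' k V, hP1, hQ1, fun f hf => ?_, fun V hV => ?_⟩
  · choose hs hP3 using fun c => hP2 c f fun k => (hf k).1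
    have hdep : ∀ k, DependsOnly (args k) (SmoothAlg.mk (f k) (hf k).1) := fun k =>
      (dependsOnly_iff hI hU _ _).2 fun z z' h => (hf k).2 z z.2 z' z'.2 h
    have hPf : (fun c => SmoothAlg.mk (P' c f) (hs c)) = P fun k => SmoothAlg.mk (f k) (hf k).1 :=
      funext hP3
    refine ⟨(hS _).2 ⟨hs, hPf ▸ hPA _ hdep⟩, fun k => ?_⟩
    obtain ⟨h, hk⟩ := hQ2 k _ hs
    rw [hPf, hQP _ hdep k, mk_eq_mk] at hk
    exact hk
  · obtain ⟨hs, hA⟩ := (hS V).1 hV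
    choose hq hQ3 using fun k => hQ2 k V hs
    have hQV : (fun k => SmoothAlg.mk (Q' k V) (hq k)) = Q fun c => SmoothAlg.mk (V c) (hs c) :=
      funext hQ3
    refine ⟨fun k => ⟨hq k, fun z hz z' hz' h => ?_⟩, fun c => ?_⟩
    · have := hQA _ hA k
      rw [← hQ3 k, dependsOnly_iff hI hU] at this
      exact this ⟨z, hz⟩ ⟨z', hz'⟩ h
    · obtain ⟨h, hc⟩ := hP2 c _ hq
      rw [hQV, hPQ, mk_eq_mk] at hc
      exact hc

/-! ### Dimension of the jet spaces -/

/-- The functionals on tuples of functions of `(x^{a k}, x^{b k})` which read off a derivative. -/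
noncomputable def readOff (z : U) (a b : κ → Fin d) (Z : Set (κ → SmoothAlg U)) (n : ℕ)
    (p : κ × Fin (n + 1) × Fin (n + 1)) (f : Z) : 𝕜 :=
  evalAt z ((D (.inl (a p.1)))^[p.2.1] ((D (.inl (b p.1)))^[p.2.2] (f.1 p.1)))

/-- The functionals depending linearly on the derivatives of order at most `n`. -/
noncomputable def jetFunctionals (z : U) (a b : κ → Fin d) (Z : Set (κ → SmoothAlg U)) (n : ℕ) :
    Submodule 𝕜 (Z → 𝕜) := Submodule.span 𝕜 (Set.range (readOff z a b Z n))

theorem jetFunctionals_mono (z : U) (a b : κ → Fin d) (Z : Set (κ → SmoothAlg U)) {n n' : ℕ}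
    (h : n ≤ n') : jetFunctionals z a b Z n ≤ jetFunctionals z a b Z n' := by
  refine Submodule.span_mono ?_
  rintro _ ⟨⟨k, i, j⟩, rfl⟩
  exact ⟨⟨k, ⟨i, by omega⟩, ⟨j, by omega⟩⟩, rfl⟩

theorem foldr_D_zero (w : List (Coord d m)) : w.foldr D (0 : SmoothAlg U) = 0 := by
  induction w with
  | nil => rfl
  | cons c w ih => rw [List.foldr_cons, ih, D_zero]

theorem foldr_D_add (w : List (Coord d m)) (f g : SmoothAlg U) :
    w.foldr D (f + g) = w.foldr D f + w.foldr D g := by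
  induction w with
  | nil => rfl
  | cons c w ih => rw [List.foldr_cons, ih, D_add]; rfl

theorem iterate_D_comm (c c' : Coord d m) (n : ℕ) (f : SmoothAlg U) :
    D c ((D c')^[n] f) = (D c')^[n] (D c f) :=
  (Function.Commute.iterate_right (fun g => D_comm c c' g : Function.Commute (D c) (D c')) n) f

theorem iterate_D_zero (c : Coord d m) (n : ℕ) : (D c)^[n] (0 : SmoothAlg U) = 0 :=
  Function.iterate_fixed (D_zero c) n

/-- Derivatives commute, so a word containing a foreign direction annihilates `f`, and any other
word can be sorted. Which case occurs, and with which exponents, depends on the word only and not on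
`f`; hence the coefficients in the jet estimate are uniform. -/
theorem foldr_D_of_dependsOnly (a b : Fin d) (w : List (Coord d m)) :
    (∀ f : SmoothAlg U, DependsOnly {a, b} f → w.foldr D f = 0) ∨
      ∃ i j, i + j ≤ w.length ∧ ∀ f : SmoothAlg U, DependsOnly {a, b} f →
        w.foldr D f = (D (.inl a))^[i] ((D (.inl b))^[j] f) := by
  induction w with
  | nil => exact .inr ⟨0, 0, le_rfl, fun _ _ => rfl⟩
  | cons c w ih =>
    rcases ih with ih | ⟨i, j, hij, ih⟩
    · exact .inl fun f hf => by rw [List.foldr_cons, ih f hf, D_zero]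
    · by_cases ha : c = .inl a
      · refine .inr ⟨i + 1, j, by simp only [List.length_cons]; omega, fun f hf => ?_⟩
        rw [List.foldr_cons, ih f hf, ha, Function.iterate_succ_apply']
      by_cases hb : c = .inl b
      · refine .inr ⟨i, j + 1, by simp only [List.length_cons]; omega, fun f hf => ?_⟩
        rw [List.foldr_cons, ih f hf, hb, iterate_D_comm, Function.iterate_succ_apply']
      · refine .inl fun f hf => ?_
        have : D c f = 0 := by
          rcases c with c | c
          · exact hf.2 c (by simpa using ⟨fun h => ha (by rw [h]), fun h => hb (by rw [h])⟩)
          · exact hf.1 c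
        rw [List.foldr_cons, ih f hf, iterate_D_comm, iterate_D_comm, this, iterate_D_zero,
          iterate_D_zero]

/-- `g` is a differential expression of order at most `r` in tuples of functions of two variables. -/
def HasOrder (z : U) (a b : κ → Fin d) (Z : Set (κ → SmoothAlg U)) (r : ℕ) (g : Z → SmoothAlg U) :
    Prop :=
  ∀ w : List (Coord d m), (fun f => evalAt z (w.foldr D (g f))) ∈ jetFunctionals z a b Z (w.length + r)

variable {z : U} {a b : κ → Fin d} {Z : Set (κ → SmoothAlg U)}

theorem HasOrder.comp (hZ : ∀ f ∈ Z, ∀ k, DependsOnly {a k, b k} (f k)) (k : κ) :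
    HasOrder z a b Z 0 fun f : Z => f.1 k := fun w => by
  rcases foldr_D_of_dependsOnly (U := U) (a k) (b k) w with h | ⟨i, j, hij, h⟩
  · have : (fun f : Z => evalAt z (w.foldr D (f.1 k))) = 0 := funext fun f => by
      simp [h _ (hZ f.1 f.2 k)]
    rw [this]
    exact Submodule.zero_mem _
  · refine Submodule.subset_span ⟨⟨k, ⟨i, by omega⟩, ⟨j, by omega⟩⟩, funext fun f => ?_⟩
    rw [h _ (hZ f.1 f.2 k)]; rfl

theorem HasOrder.mono {r r' : ℕ} {g : Z → SmoothAlg U} (hg : HasOrder z a b Z r g) (h : r ≤ r') :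
    HasOrder z a b Z r' g := fun w => jetFunctionals_mono _ _ _ _ (by omega) (hg w)

theorem HasOrder.deriv {r : ℕ} {g : Z → SmoothAlg U} (hg : HasOrder z a b Z r g) (c : Coord d m) :
    HasOrder z a b Z (r + 1) fun f => D c (g f) := fun w => by
  have := hg (w ++ [c])
  simp only [List.foldr_append, List.foldr_cons, List.foldr_nil, List.length_append,
    List.length_singleton] at this
  exact jetFunctionals_mono _ _ _ _ (by omega) this

/-- Leibniz' rule, applied to the innermost derivative of the word. What remains is a shorter word
acting on `D c s * g` and on `s * D c g`; the second factor has order one more, which the shorter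
word makes up for. Hence the generalisation over `s`, `g` and `r`. -/
theorem HasOrder.mul {r : ℕ} {g : Z → SmoothAlg U} (hg : HasOrder z a b Z r g) (s : SmoothAlg U) :
    HasOrder z a b Z r fun f => s * g f := fun w => by
  induction w using List.reverseRecOn generalizing s g r with
  | nil => simpa [Pi.smul_def] using Submodule.smul_mem _ (evalAt z s) (hg [])
  | append_singleton w c ih =>
    simp only [List.foldr_append, List.foldr_cons, List.foldr_nil, List.length_append,
      List.length_singleton, D_mul, foldr_D_add, map_add]
    exact Submodule.add_mem _ (jetFunctionals_mono _ _ _ _ (by omega) (ih hg (D c s)))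
      (jetFunctionals_mono _ _ _ _ (by omega) (ih (hg.deriv c) s))

theorem IsAlgOp.hasOrder (hZ : ∀ f ∈ Z, ∀ k, DependsOnly {a k, b k} (f k))
    {T : (κ → SmoothAlg U) → SmoothAlg U} (hT : IsAlgOp T) :
    ∃ r, HasOrder z a b Z r fun f : Z => T f := by
  induction hT with
  | zero => exact ⟨0, fun w => by
      simp only [foldr_D_zero, map_zero]
      exact (jetFunctionals z a b Z _).zero_mem⟩
  | comp k => exact ⟨0, .comp hZ k⟩
  | deriv c T _ ih => exact ih.imp' _ fun r hr => hr.deriv c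
  | mul s T _ ih => exact ih.imp fun r hr => hr.mul s
  | add S T _ _ ih ih' =>
    obtain ⟨r, hr⟩ := ih
    obtain ⟨r', hr'⟩ := ih'
    refine ⟨max r r', fun w => ?_⟩
    simpa only [foldr_D_add, map_add, Pi.add_def] using
      Submodule.add_mem _ (hr.mono (le_max_left r r') w) (hr'.mono (le_max_right r r') w)

/-- A family of vector fields that is parametrised, by means of a differential operator, by finitely
many functions of two variables has jet spaces of quadratically growing dimension. -/
theorem jetDim_isBigO [Fintype κ] {S : Set (VField 𝕜 d m)} {A : Set (Coord d m → SmoothAlg U)}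
    (hS : ∀ V, V ∈ S ↔ ∃ h : ∀ c, ContDiffOn 𝕜 ∞ (V c) U, (fun c => SmoothAlg.mk (V c) (h c)) ∈ A)
    {P : (κ → SmoothAlg U) → Coord d m → SmoothAlg U}
    (hP : ∀ c, IsAlgOp fun f => P f c) {args : κ → Finset (Fin d)} (a b : κ → Fin d)
    (hab : ∀ k, args k ⊆ {a k, b k})
    (hA : ∀ V ∈ A, ∃ f, (∀ k, DependsOnly (args k) (f k)) ∧ P f = V)
    (z : Coord d m → 𝕜) (hz : z ∈ (U : Set (Coord d m → 𝕜))) :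
    (fun k : ℕ => (jetDim S z k : ℝ)) =O[Filter.atTop] fun k : ℕ => (k : ℝ) ^ 2 := by
  set Z : Set (κ → SmoothAlg U) := {f | ∀ k, DependsOnly (args k) (f k)} with hZdef
  have hZ : ∀ f ∈ Z, ∀ k, DependsOnly {a k, b k} (f k) := fun f hf k =>
    ⟨(hf k).1, fun i hi => (hf k).2 i fun h => hi (hab k h)⟩
  choose r hr using fun c => (hP c).hasOrder (z := ⟨z, hz⟩) hZ
  obtain ⟨R, hR⟩ : ∃ R, ∀ c, r c ≤ R := ⟨Finset.univ.sup r, fun c => Finset.le_sup (Finset.mem_univ c)⟩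
  -- A function of two variables has at most `(k + R + 1) ^ 2` mixed derivatives with both exponents
  -- at most `k + R`.
  have bound : ∀ k, jetDim S z k ≤ Fintype.card κ * ((k + R + 1) * (k + R + 1)) := by
    intro k
    have hmem : ∀ p : ((n : Fin (k + 1)) × (Fin n → Coord d m)) × Coord d m,
        (fun f : Z => evalAt ⟨z, hz⟩ ((List.ofFn p.1.2).foldr D (P f.1 p.2))) ∈
          jetFunctionals ⟨z, hz⟩ a b Z (k + R) := fun p => by
      refine jetFunctionals_mono _ _ _ _ ?_ ((hr p.2).mono (hR p.2) (List.ofFn p.1.2))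
      rw [List.length_ofFn]
      have := p.1.1.2
      omega
    simp only [jetFunctionals, Submodule.mem_span_range_iff_exists_fun] at hmem
    -- The coefficients `C` do not depend on the parameters. So all jets lie in the span of the
    -- vectors `C · q`, one for each functional `q` that reads off a derivative.
    choose C hC using hmem
    have hle : Submodule.span 𝕜 (jetAt k z '' S) ≤ Submodule.span 𝕜 (Set.range fun q p => C p q) := by
      refine Submodule.span_le.2 ?_
      rintro _ ⟨V, hV, rfl⟩
      obtain ⟨hs, hVA⟩ := (hS V).1 hV
      obtain ⟨f, hf, hPf⟩ := hA _ hVA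
      refine (Submodule.mem_span_range_iff_exists_fun 𝕜).2
        ⟨fun q => readOff ⟨z, hz⟩ a b Z (k + R) q ⟨f, hf⟩, funext fun p => ?_⟩
      have h1 := congrFun (hC p) ⟨f, hf⟩
      obtain ⟨h2, h3⟩ := contDiffOn_foldr_pd (List.ofFn p.1.2) (hs p.2)
      have h4 := congrArg (evalAt ⟨z, hz⟩) h3
      simp only [hPf, ← h4, evalAt_mk] at h1
      simpa [jetAt, mul_comm] using h1
    refine (Submodule.finrank_mono hle).trans ((finrank_range_le_card _).trans_eq ?_)
    simp
  refine Asymptotics.IsBigO.of_bound (Fintype.card κ * ((R + 2 : ℝ) * (R + 2)))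
    (Filter.eventually_atTop.2 ⟨1, fun k hk => ?_⟩)
  have h1 : (jetDim S z k : ℝ) ≤ Fintype.card κ * ((k + R + 1) * (k + R + 1)) := mod_cast bound k
  have hk' : (1 : ℝ) ≤ k := mod_cast hk
  -- The difference of the two sides is `(R + 1) * (k - 1)`.
  have h2 : (k + R + 1 : ℝ) ≤ (R + 2) * k := by nlinarith [(Nat.cast_nonneg R : (0 : ℝ) ≤ R)]
  have h3 : (0 : ℝ) ≤ k + R + 1 := by positivity
  rw [Real.norm_of_nonneg (by positivity), Real.norm_of_nonneg (by positivity)]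
  calc (jetDim S z k : ℝ) ≤ Fintype.card κ * ((k + R + 1) * (k + R + 1)) := h1
    _ ≤ Fintype.card κ * (((R + 2) * k) * ((R + 2) * k)) := by gcongr
    _ = _ := by ring

end Freedom

end ScrollSym

namespace ScrollSym

set_option linter.unusedSectionVars false

/-! ## Linearised equations and jets of symmetries -/

section Linearisation

variable {R : Type*} [CommRing R] {d : ℕ} [NeZero d]

/-- The linearisation of `Q₁` at `J`, applied to `K`; similarly below. -/
def dQ₁ (J K : Jet2 R d 3) (s : Fin 3) : R :=
  K.d2 s 2 3 - K.d2 s 1 4 + (u J 1 * K.d2 s 2 2 + u K 1 * J.d2 s 2 2) + ((v J 1 - u J 2) * 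
    K.d2 s 1 2 + (v K 1 - u K 2) * J.d2 s 1 2) - (v J 2 * K.d2 s 1 1 + v K 2 * J.d2 s 1 1)

def dQ₂ (J K : Jet2 R d 3) (s : Fin 3) : R :=
  K.d2 s 3 3 - K.d2 s 1 5 + (u J 1 * K.d2 s 2 3 + u K 1 * J.d2 s 2 3) + (v J 1 * K.d2 s 1 3 + v
    K 1 * J.d2 s 1 3) - (u J 3 * K.d2 s 1 2 + u K 3 * J.d2 s 1 2) + ((w₀ J - v J 3) * K.d2 s 1 1
    + (w₀ K - v K 3) * J.d2 s 1 1)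

def dQ₃ (J K : Jet2 R d 3) (s : Fin 3) : R :=
  K.d2 s 3 4 - K.d2 s 2 5 + (u J 2 * K.d2 s 2 3 + u K 2 * J.d2 s 2 3) - (u J 3 * K.d2 s 2 2 + u
    K 3 * J.d2 s 2 2) + (v J 2 * K.d2 s 1 3 + v K 2 * J.d2 s 1 3) + ((w₀ J - v J 3) * K.d2 s 1 2
    + (w₀ K - v K 3) * J.d2 s 1 2)

def dQ₄ (J K : Jet2 R d 3) (s : Fin 3) : R :=
  K.d2 s 3 4 - K.d2 s 1 6 + (u J 1 * K.d2 s 2 4 + u K 1 * J.d2 s 2 4) + (v J 1 * K.d2 s 1 4 + v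
    K 1 * J.d2 s 1 4) + ((w₀ J - u J 4) * K.d2 s 1 2 + (w₀ K - u K 4) * J.d2 s 1 2) - (v J 4 *
    K.d2 s 1 1 + v K 4 * J.d2 s 1 1)

def dQ₅ (J K : Jet2 R d 3) (s : Fin 3) : R :=
  K.d2 s 4 4 - K.d2 s 2 6 + (u J 2 * K.d2 s 2 4 + u K 2 * J.d2 s 2 4) + (v J 2 * K.d2 s 1 4 + v
    K 2 * J.d2 s 1 4) + ((w₀ J - u J 4) * K.d2 s 2 2 + (w₀ K - u K 4) * J.d2 s 2 2) - (v J 4 *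
    K.d2 s 1 2 + v K 4 * J.d2 s 1 2)

def dQ₆ (J K : Jet2 R d 3) (s : Fin 3) : R :=
  K.d2 s 4 5 - K.d2 s 3 6 + ((v J 3 - w₀ J) * K.d2 s 1 4 + (v K 3 - w₀ K) * J.d2 s 1 4) + ((w₀ J
    - u J 4) * K.d2 s 2 3 + (w₀ K - u K 4) * J.d2 s 2 3) + (u J 3 * K.d2 s 2 4 + u K 3 * J.d2 s
    2 4) - (v J 4 * K.d2 s 1 3 + v K 4 * J.d2 s 1 3)

def dR₁ (J K : Jet2 R d 3) (s : Fin 3) : R :=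
  (u J 1 * K.d2 s 2 3 + u K 1 * J.d2 s 2 3) + (v J 1 * K.d2 s 2 4 + v K 1 * J.d2 s 2 4) - (u J 2
    * K.d2 s 1 3 + u K 2 * J.d2 s 1 3) - (v J 2 * K.d2 s 1 4 + v K 2 * J.d2 s 1 4)

def dR₂ (J K : Jet2 R d 3) (s : Fin 3) : R :=
  (u J 1 * K.d2 s 3 4 + u K 1 * J.d2 s 3 4) + (v J 1 * K.d2 s 4 4 + v K 1 * J.d2 s 4 4) - K.d2 s
    1 5 - (u J 4 * K.d2 s 1 3 + u K 4 * J.d2 s 1 3) - ((v J 4 + w₀ J) * K.d2 s 1 4 + (v K 4 + w₀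
    K) * J.d2 s 1 4)

def dR₃ (J K : Jet2 R d 3) (s : Fin 3) : R :=
  (u J 2 * K.d2 s 3 4 + u K 2 * J.d2 s 3 4) + (v J 2 * K.d2 s 4 4 + v K 2 * J.d2 s 4 4) - K.d2 s
    2 5 - (u J 4 * K.d2 s 2 3 + u K 4 * J.d2 s 2 3) - ((v J 4 + w₀ J) * K.d2 s 2 4 + (v K 4 + w₀
    K) * J.d2 s 2 4)

def dR₄ (J K : Jet2 R d 3) (s : Fin 3) : R :=
  (v J 1 * K.d2 s 3 4 + v K 1 * J.d2 s 3 4) + (u J 1 * K.d2 s 3 3 + u K 1 * J.d2 s 3 3) - K.d2 s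
    1 6 - (v J 3 * K.d2 s 1 4 + v K 3 * J.d2 s 1 4) - ((u J 3 + w₀ J) * K.d2 s 1 3 + (u K 3 + w₀
    K) * J.d2 s 1 3)

def dR₅ (J K : Jet2 R d 3) (s : Fin 3) : R :=
  (v J 2 * K.d2 s 3 4 + v K 2 * J.d2 s 3 4) + (u J 2 * K.d2 s 3 3 + u K 2 * J.d2 s 3 3) - K.d2 s
    2 6 - (v J 3 * K.d2 s 2 4 + v K 3 * J.d2 s 2 4) - ((u J 3 + w₀ J) * K.d2 s 2 3 + (u K 3 + w₀
    K) * J.d2 s 2 3)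

def dR₆ (J K : Jet2 R d 3) (s : Fin 3) : R :=
  K.d2 s 3 5 - K.d2 s 4 6 + (u J 4 * K.d2 s 3 3 + u K 4 * J.d2 s 3 3) - (v J 3 * K.d2 s 4 4 + v
    K 3 * J.d2 s 4 4) + ((v J 4 - u J 3) * K.d2 s 3 4 + (v K 4 - u K 3) * J.d2 s 3 4)

end Linearisation

section Jets

variable {𝕜 : Type*} [RCLike 𝕜] {d m : ℕ}

/-- All equations are polynomials of degree at most two in the jet coordinates. On a line the
coefficient of t² is then forced by the value at t = 1, which turns the hypothesis into an identity
for `ring`. -/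
theorem lineDeriv_eq_of_quadratic {F : Jet2 𝕜 d m → 𝕜} {J K : Jet2 𝕜 d m} {L : 𝕜}
    (h : ∀ t : 𝕜, F (J + t • K) = F J + t * L + t ^ 2 * (F (J + K) - F J - L)) :
    lineDeriv 𝕜 F J K = L := by
  have h1 : HasDerivAt (fun t : 𝕜 => F (J + t • K))
      (0 + 1 * L + (2 : ℕ) * (0 : 𝕜) ^ (2 - 1) * (F (J + K) - F J - L)) 0 := by
    simp only [h]
    exact (((hasDerivAt_const _ _).add ((hasDerivAt_id (0 : 𝕜)).mul_const L)).add
      ((hasDerivAt_pow 2 (0 : 𝕜)).mul_const _))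
  rw [lineDeriv, h1.deriv]
  simp

/-- The 2-jet with given base point, first and second derivatives. -/
def jet (x : Coord d m → 𝕜) (p : Fin m → Fin d → 𝕜) (q : Fin m → Fin d → Fin d → 𝕜) : Jet2 𝕜 d m :=
  (fun i => x (.inl i), fun α => x (.inr α), p, q)

/-- `∂_i` of the component `c` of a vector field along a 1-jet, in terms of the first derivatives
`A₁ c c'` of its components. -/
def total (A₁ : Coord d m → Coord d m → 𝕜) (p : Fin m → Fin d → 𝕜) (i : Fin d) (c : Coord d m) : 𝕜 :=
  A₁ c (.inl i) + ∑ β, p β i * A₁ c (.inr β)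

/-- The first prolongation in terms of the first derivatives of the components of the vector field. -/
def prolong₁ (A₁ : Coord d m → Coord d m → 𝕜) (p : Fin m → Fin d → 𝕜) (α : Fin m) (i : Fin d) : 𝕜 :=
  total A₁ p i (.inr α) - ∑ k, total A₁ p i (.inl k) * p α k

/-- The second total derivative in terms of first and second derivatives. -/
def total₂ (A₁ : Coord d m → Coord d m → 𝕜) (A₂ : Coord d m → Coord d m → Coord d m → 𝕜)
    (p : Fin m → Fin d → 𝕜) (q : Fin m → Fin d → Fin d → 𝕜) (i j : Fin d) (c : Coord d m) : 𝕜 :=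
  A₂ c (.inl i) (.inl j) + ∑ β, p β i * A₂ c (.inr β) (.inl j) + ∑ β, p β j * A₂ c (.inl i) (.inr β)
    + ∑ β, ∑ γ, p β i * p γ j * A₂ c (.inr β) (.inr γ) + ∑ β, q β i j * A₁ c (.inr β)

/-- The second prolongation in terms of the 2-jet `A₀, A₁, A₂` of the vector field. -/
def prolong₂ (A₀ : Coord d m → 𝕜) (A₁ : Coord d m → Coord d m → 𝕜)
    (A₂ : Coord d m → Coord d m → Coord d m → 𝕜) (p : Fin m → Fin d → 𝕜)
    (q : Fin m → Fin d → Fin d → 𝕜) : Jet2 𝕜 d m :=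
  (fun i => A₀ (.inl i), fun α => A₀ (.inr α), prolong₁ A₁ p, fun α i j => total₂ A₁ A₂ p q i j (.inr α)
    - ∑ k, (total₂ A₁ A₂ p q i j (.inl k) * p α k
      + total A₁ p i (.inl k) * q α j k + total A₁ p j (.inl k) * q α i k))

/-- `A₀, A₁, A₂` is the 2-jet at `x` of a vector field that satisfies the symmetry condition at all
2-jets over `x`. -/
def IsJetSymmetry (Sys : List (Jet2 𝕜 d m → 𝕜)) (x : Coord d m → 𝕜) (A₀ : Coord d m → 𝕜)
    (A₁ : Coord d m → Coord d m → 𝕜) (A₂ : Coord d m → Coord d m → Coord d m → 𝕜) : Prop :=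
  ∀ p q, (∀ α i j, q α i j = q α j i) → (∀ F ∈ Sys, F (jet x p q) = 0) →
    ∀ F ∈ Sys, lineDeriv 𝕜 F (jet x p q) (prolong₂ A₀ A₁ A₂ p q) = 0

open TopologicalSpace SmoothAlg

/-- The point symmetries, as tuples of elements of `SmoothAlg U`. -/
def algSymmetries (Sys : List (Jet2 𝕜 d m → 𝕜)) (U : Opens (Coord d m → 𝕜)) :
    Set (Coord d m → SmoothAlg U) :=
  {V | ∀ z : U, IsJetSymmetry Sys z.1 (fun c => evalAt z (V c)) (fun c i => evalAt z (D i (V c)))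
    fun c i j => evalAt z (D i (D j (V c)))}

/-- The symmetry condition over a point involves the vector field through its 2-jet there only, so
it can be read in the differential ring as well as on functions. -/
theorem mem_pointSymmetries_iff (Sys : List (Jet2 𝕜 d m → 𝕜)) (U : Opens (Coord d m → 𝕜))
    (V : VField 𝕜 d m) : V ∈ pointSymmetries Sys (U : Set (Coord d m → 𝕜)) ↔
      ∃ h : ∀ c, ContDiffOn 𝕜 ∞ (V c) U, (fun c => SmoothAlg.mk (V c) (h c)) ∈ algSymmetries Sys U := by
  have base : ∀ x : Coord d m → 𝕜, Sum.elim (fun i => x (.inl i)) (fun α => x (.inr α)) = x :=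
    fun x => Sum.elim_comp_inl_inr x
  constructor
  · rintro ⟨h, hV⟩
    refine ⟨h, fun z p q hq hF F hFS => ?_⟩
    have hb : (jet z.1 p q).base = z.1 := base z.1
    have := hV (jet z.1 p q) hq (hb.symm ▸ z.2) hF F hFS
    simp only [prolong, totalD, totalDD, hb] at this
    simp only [D_mk, evalAt_mk]
    exact this
  · rintro ⟨h, hV⟩
    refine ⟨h, ?_⟩
    rintro ⟨x, y, p, q⟩ hq hz hF F hFS
    have := hV ⟨_, hz⟩ p q hq hF F hFS
    simp only [D_mk, evalAt_mk] at this
    exact this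

/-- The change of the second derivatives of the dependent variable `w` by the square of a covector. -/
def addSq (q : Fin 3 → Fin d → Fin d → 𝕜) (ξ : Fin d → 𝕜) (α : Fin 3) (i j : Fin d) : 𝕜 :=
  q α i j + if α = 2 then ξ i * ξ j else 0

theorem addSq_symm {q : Fin 3 → Fin d → Fin d → 𝕜} (hq : ∀ α i j, q α i j = q α j i)
    (ξ : Fin d → 𝕜) (α i j) : addSq q ξ α i j = addSq q ξ α j i := by
  rw [addSq, addSq, hq, mul_comm]

/-- The covector `ξ` with all components contracted with the total derivatives of a vector field. -/
def contract (A₁ : Coord d 3 → Coord d 3 → 𝕜) (p : Fin 3 → Fin d → 𝕜) (ξ : Fin d → 𝕜) (i : Fin d) : 𝕜 :=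
  ∑ k, total A₁ p i (.inl k) * ξ k

/-- The jet whose second derivatives are given by the square of the covector `ξ`. -/
def sqJet (x : Coord d 3 → 𝕜) (p : Fin 3 → Fin d → 𝕜) (ξ : Fin d → 𝕜) : Jet2 𝕜 d 3 :=
  jet x p fun _ i j => ξ i * ξ j

/-- The variation of `sqJet` under a vector field. -/
def sqJetVar (A₀ : Coord d 3 → 𝕜) (A₁ : Coord d 3 → Coord d 3 → 𝕜) (p : Fin 3 → Fin d → 𝕜)
    (ξ : Fin d → 𝕜) : Jet2 𝕜 d 3 :=
  jet A₀ (prolong₁ A₁ p) fun _ i j => -(contract A₁ p ξ i * ξ j + contract A₁ p ξ j * ξ i)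

theorem total₂_addSq (A₁ : Coord d 3 → Coord d 3 → 𝕜) (A₂ : Coord d 3 → Coord d 3 → Coord d 3 → 𝕜)
    (p : Fin 3 → Fin d → 𝕜) (q : Fin 3 → Fin d → Fin d → 𝕜) (ξ : Fin d → 𝕜) (i j : Fin d)
    (c : Coord d 3) :
    total₂ A₁ A₂ p (addSq q ξ) i j c = total₂ A₁ A₂ p q i j c + ξ i * ξ j * A₁ c (.inr 2) := by
  simp only [total₂, addSq, add_mul, Finset.sum_add_distrib, ite_mul, zero_mul, Finset.sum_ite_eq',
    Finset.mem_univ, if_true]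
  ring

/-- The second prolongation is affine in the second derivatives. Its linear part acts on a square ξ
⊗ ξ by a scalar, which becomes irrelevant for null ξ, and by minus the total derivatives of the
x-components acting on either factor, as on covectors; the latter is what `sqJetVar` records. -/
theorem prolong₂_addSq_d2 (A₀ : Coord d 3 → 𝕜) (A₁ : Coord d 3 → Coord d 3 → 𝕜)
    (A₂ : Coord d 3 → Coord d 3 → Coord d 3 → 𝕜) (p : Fin 3 → Fin d → 𝕜)
    (q : Fin 3 → Fin d → Fin d → 𝕜) (ξ : Fin d → 𝕜) (i j : Fin d) :
    (prolong₂ A₀ A₁ A₂ p (addSq q ξ)).d2 2 i j = (prolong₂ A₀ A₁ A₂ p q).d2 2 i j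
      + (A₁ (.inr 2) (.inr 2) - ∑ k, A₁ (.inl k) (.inr 2) * p 2 k) * (ξ i * ξ j)
      + (sqJetVar A₀ A₁ p ξ).d2 2 i j := by
  have key : ∑ k, (total₂ A₁ A₂ p (addSq q ξ) i j (.inl k) * p 2 k
      + total A₁ p i (.inl k) * addSq q ξ 2 j k + total A₁ p j (.inl k) * addSq q ξ 2 i k)
      = ∑ k, (total₂ A₁ A₂ p q i j (.inl k) * p 2 k
      + total A₁ p i (.inl k) * q 2 j k + total A₁ p j (.inl k) * q 2 i k)
      + (∑ k, A₁ (.inl k) (.inr 2) * p 2 k) * (ξ i * ξ j)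
      + (contract A₁ p ξ i * ξ j + contract A₁ p ξ j * ξ i) := by
    simp only [contract, Finset.sum_mul, ← Finset.sum_add_distrib]
    refine Finset.sum_congr rfl fun k _ => ?_
    simp only [total₂_addSq, addSq, if_true]
    ring
  change total₂ A₁ A₂ p (addSq q ξ) i j (.inr 2) - _
    = total₂ A₁ A₂ p q i j (.inr 2) - _ + _ + -(contract A₁ p ξ i * ξ j + contract A₁ p ξ j * ξ i)
  rw [key, total₂_addSq]
  ring

end Jets

end ScrollSym

namespace ScrollSym

set_option linter.unusedSectionVars false

/-! ### Linearisation of the systems, and their behaviour under addition of a square. -/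

section LinearisedSystems

variable {𝕜 : Type*} [RCLike 𝕜] {d : ℕ} [NeZero d]

theorem d1_smul (K : Jet2 𝕜 d 3) (t : 𝕜) (α : Fin 3) (i : Fin d) :
    (t • K).d1 α i = t * K.d1 α i := rfl

theorem d2_smul (K : Jet2 𝕜 d 3) (t : 𝕜) (α : Fin 3) (i j : Fin d) :
    (t • K).d2 α i j = t * K.d2 α i j := rfl

theorem val_smul (K : Jet2 𝕜 d 3) (t : 𝕜) (α : Fin 3) :
    (t • K).val α = t * K.val α := rfl

theorem d1_add (J K : Jet2 𝕜 d 3) (α : Fin 3) (i : Fin d) :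
    (J + K).d1 α i = J.d1 α i + K.d1 α i := rfl

theorem d2_add (J K : Jet2 𝕜 d 3) (α : Fin 3) (i j : Fin d) :
    (J + K).d2 α i j = J.d2 α i j + K.d2 α i j := rfl

theorem val_add (J K : Jet2 𝕜 d 3) (α : Fin 3) : (J + K).val α = J.val α + K.val α := rfl

theorem triple_lineDeriv_iff {J K : Jet2 𝕜 d 3} : (∀ F ∈ triple 𝕜 d, lineDeriv 𝕜 F J K = 0) ↔
    dQ₁ J K 0 - w K 1 = 0 ∧ dQ₁ J K 1 + w K 2 = 0 ∧ dQ₁ J K 2 = 0 ∧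
    dQ₂ J K 0 + (u J 1 * w K 1 + u K 1 * w J 1) = 0 ∧
    dQ₂ J K 1 - (u J 1 * w K 2 + u K 1 * w J 2) = 0 ∧
    dQ₂ J K 2 + 2 * w J 1 * w K 1 = 0 ∧
    dQ₃ J K 0 + w K 3 + (u J 1 * w K 2 + u K 1 * w J 2) = 0 ∧
    dQ₃ J K 1 - (w K 4 + (v J 2 * w K 1 + v K 2 * w J 1)
      - ((v J 1 - u J 2) * w K 2 + (v K 1 - u K 2) * w J 2)) = 0 ∧
    dQ₃ J K 2 + (w J 1 * w K 2 + w K 1 * w J 2) = 0 := by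
  simp only [triple, List.forall_mem_cons, List.not_mem_nil, false_implies,
    implies_true, and_true]
  repeat' refine and_congr ?_ ?_
  all_goals
    refine Iff.of_eq (congrArg (· = (0 : 𝕜)) (lineDeriv_eq_of_quadratic fun t => ?_))
    simp only [Q₁, Q₂, Q₃, dQ₁, dQ₂, dQ₃, u, v, w, w₀, d1_smul, d2_smul, val_smul, d1_add,
      d2_add, val_add]
    ring

theorem triple1_lineDeriv_iff {J K : Jet2 𝕜 d 3} : (∀ F ∈ triple1 𝕜 d, lineDeriv 𝕜 F J K = 0) ↔
    dQ₄ J K 0 - (w K 3 + ((v J 1 - u J 2) * w K 1 + (v K 1 - u K 2) * w J 1)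
      + (u J 1 * w K 2 + u K 1 * w J 2)) = 0 ∧
    dQ₄ J K 1 + w K 4 + (v J 2 * w K 1 + v K 2 * w J 1) = 0 ∧
    dQ₄ J K 2 + (w J 1 * w K 2 + w K 1 * w J 2) = 0 ∧
    dQ₅ J K 0 - (v J 2 * w K 1 + v K 2 * w J 1) = 0 ∧
    dQ₅ J K 1 + (v J 2 * w K 2 + v K 2 * w J 2) = 0 ∧
    dQ₅ J K 2 + 2 * w J 2 * w K 2 = 0 ∧
    dQ₆ J K 0 - (w K 5 + ((v J 3 - w₀ J) * w K 1 + (v K 3 - w₀ K) * w J 1)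
      + (u J 1 * w K 4 + u K 1 * w J 4) - (u J 2 * w K 3 + u K 2 * w J 3)
      + (u J 3 * w K 2 + u K 3 * w J 2)) = 0 ∧
    dQ₆ J K 1 - (-w K 6 + (v J 1 * w K 4 + v K 1 * w J 4) - (v J 2 * w K 3 + v K 2 * w J 3)
      + ((w₀ J - u J 4) * w K 2 + (w₀ K - u K 4) * w J 2) - (v J 4 * w K 1 + v K 4 * w J 1)) = 0 ∧
    dQ₆ J K 2 - (w J 1 * w K 4 + w K 1 * w J 4 - (w J 2 * w K 3 + w K 2 * w J 3)) = 0 := by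
  simp only [triple1, List.forall_mem_cons, List.not_mem_nil, false_implies,
    implies_true, and_true]
  repeat' refine and_congr ?_ ?_
  all_goals
    refine Iff.of_eq (congrArg (· = (0 : 𝕜)) (lineDeriv_eq_of_quadratic fun t => ?_))
    simp only [Q₄, Q₅, Q₆, dQ₄, dQ₅, dQ₆, u, v, w, w₀, d1_smul, d2_smul, val_smul, d1_add,
      d2_add, val_add]
    ring

theorem alttriple_lineDeriv_iff {J K : Jet2 𝕜 d 3} : (∀ F ∈ alttriple 𝕜 d, lineDeriv 𝕜 F J K = 0) ↔
    dR₁ J K 0 - (u J 1 * w K 2 + u K 1 * w J 2 - (u J 2 * w K 1 + u K 2 * w J 1)) = 0 ∧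
    dR₁ J K 1 - (v J 1 * w K 2 + v K 1 * w J 2 - (v J 2 * w K 1 + v K 2 * w J 1)) = 0 ∧
    dR₁ J K 2 = 0 ∧
    dR₂ J K 0 - (u J 1 * w K 4 + u K 1 * w J 4) = 0 ∧
    dR₂ J K 1 + (u J 1 * w K 3 + u K 1 * w J 3) = 0 ∧
    dR₂ J K 2 - (w J 1 * w K 4 + w K 1 * w J 4) = 0 ∧
    dR₃ J K 0 - (u J 2 * w K 4 + u K 2 * w J 4) = 0 ∧
    dR₃ J K 1 + (u J 2 * w K 3 + u K 2 * w J 3) = 0 ∧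
    dR₃ J K 2 - (w J 2 * w K 4 + w K 2 * w J 4) = 0 := by
  simp only [alttriple, List.forall_mem_cons, List.not_mem_nil, false_implies,
    implies_true, and_true]
  repeat' refine and_congr ?_ ?_
  all_goals
    refine Iff.of_eq (congrArg (· = (0 : 𝕜)) (lineDeriv_eq_of_quadratic fun t => ?_))
    simp only [R₁, R₂, R₃, dR₁, dR₂, dR₃, u, v, w, w₀, d1_smul, d2_smul, val_smul, d1_add,
      d2_add, val_add]
    ring

theorem triple2_lineDeriv_iff {J K : Jet2 𝕜 d 3} : (∀ F ∈ triple2 𝕜 d, lineDeriv 𝕜 F J K = 0) ↔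
    dR₄ J K 0 + (v J 1 * w K 4 + v K 1 * w J 4) = 0 ∧
    dR₄ J K 1 - (v J 1 * w K 3 + v K 1 * w J 3) = 0 ∧
    dR₄ J K 2 - (w J 1 * w K 3 + w K 1 * w J 3) = 0 ∧
    dR₅ J K 0 + (v J 2 * w K 4 + v K 2 * w J 4) = 0 ∧
    dR₅ J K 1 - (v J 2 * w K 3 + v K 2 * w J 3) = 0 ∧
    dR₅ J K 2 - (w J 2 * w K 3 + w K 2 * w J 3) = 0 ∧
    dR₆ J K 0 + w K 5 + ((v J 4 + w₀ J) * w K 4 + (v K 4 + w₀ K) * w J 4)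
      + (u J 4 * w K 3 + u K 4 * w J 3) = 0 ∧
    dR₆ J K 1 - (w K 6 + ((u J 3 + w₀ J) * w K 3 + (u K 3 + w₀ K) * w J 3)
      + (v J 3 * w K 4 + v K 3 * w J 4)) = 0 ∧
    dR₆ J K 2 = 0 := by
  simp only [triple2, List.forall_mem_cons, List.not_mem_nil, false_implies,
    implies_true, and_true]
  repeat' refine and_congr ?_ ?_
  all_goals
    refine Iff.of_eq (congrArg (· = (0 : 𝕜)) (lineDeriv_eq_of_quadratic fun t => ?_))
    simp only [R₄, R₅, R₆, dR₄, dR₅, dR₆, u, v, w, w₀, d1_smul, d2_smul, val_smul, d1_add,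
      d2_add, val_add]
    ring

/-- `E` is an expression that is linear in the second derivatives, and `dE` its linearisation. -/
structure IsQuasilinear (E : Jet2 𝕜 d 3 → Fin 3 → 𝕜) (dE : Jet2 𝕜 d 3 → Jet2 𝕜 d 3 → Fin 3 → 𝕜) :
    Prop where
  apply_addSq (x p q ξ s) : E (jet x p (addSq q ξ)) s
    = E (jet x p q) s + if s = 2 then E (sqJet x p ξ) 2 else 0
  var_addSq (x A₀ A₁ A₂ p q ξ) :
    dE (jet x p (addSq q ξ)) (prolong₂ A₀ A₁ A₂ p (addSq q ξ)) 2
      = dE (jet x p q) (prolong₂ A₀ A₁ A₂ p q) 2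
        + (A₁ (.inr 2) (.inr 2) - ∑ k, A₁ (.inl k) (.inr 2) * p 2 k) * E (sqJet x p ξ) 2
        + dE (sqJet x p ξ) (sqJetVar A₀ A₁ p ξ) 2

theorem jet_d1 (x : Coord d 3 → 𝕜) (p : Fin 3 → Fin d → 𝕜) (q : Fin 3 → Fin d → Fin d → 𝕜) :
    (jet x p q).d1 = p := rfl

theorem jet_d2 (x : Coord d 3 → 𝕜) (p : Fin 3 → Fin d → 𝕜) (q : Fin 3 → Fin d → Fin d → 𝕜) :
    (jet x p q).d2 = q := rfl

theorem jet_val (x : Coord d 3 → 𝕜) (p : Fin 3 → Fin d → 𝕜) (q : Fin 3 → Fin d → Fin d → 𝕜)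
    (α : Fin 3) : (jet x p q).val α = x (.inr α) := rfl

theorem prolong₂_d1 (A₀ : Coord d 3 → 𝕜) (A₁ A₂) (p : Fin 3 → Fin d → 𝕜) (q) :
    (prolong₂ A₀ A₁ A₂ p q).d1 = prolong₁ A₁ p := rfl

theorem prolong₂_val (A₀ : Coord d 3 → 𝕜) (A₁ A₂) (p : Fin 3 → Fin d → 𝕜) (q) (α) :
    (prolong₂ A₀ A₁ A₂ p q).val α = A₀ (.inr α) := rfl

theorem sqJetVar_d1 (A₀ : Coord d 3 → 𝕜) (A₁) (p : Fin 3 → Fin d → 𝕜) (ξ) :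
    (sqJetVar A₀ A₁ p ξ).d1 = prolong₁ A₁ p := rfl

theorem sqJetVar_val (A₀ : Coord d 3 → 𝕜) (A₁) (p : Fin 3 → Fin d → 𝕜) (ξ) (α) :
    (sqJetVar A₀ A₁ p ξ).val α = A₀ (.inr α) := rfl

/-- The coefficients of the operator live on the 1-jet, which `addSq` does not touch, and only the
second derivatives of w are changed. So both identities follow from linearity in the second
derivatives. The other eleven operators behave in the same way. -/
theorem isQuasilinear_Q₁ : IsQuasilinear (𝕜 := 𝕜) (d := d) Q₁ dQ₁ where
  apply_addSq x p q ξ s := by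
    by_cases hs : s = 2
    · simp only [hs, Q₁, sqJet, jet_d1, jet_d2, u, v, addSq, if_true]
      ring
    · simp [hs, Q₁, jet_d1, jet_d2, u, v, addSq]
  var_addSq x A₀ A₁ A₂ p q ξ := by
    simp only [Q₁, dQ₁, u, v, prolong₂_addSq_d2, sqJet, jet_d1, jet_d2, addSq, if_true,
      prolong₂_d1, sqJetVar_d1]
    ring

theorem isQuasilinear_Q₂ : IsQuasilinear (𝕜 := 𝕜) (d := d) Q₂ dQ₂ where
  apply_addSq x p q ξ s := by
    by_cases hs : s = 2
    · simp only [hs, Q₂, sqJet, jet_d1, jet_d2, jet_val, u, v, w₀, addSq, if_true]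
      ring
    · simp [hs, Q₂, jet_d1, jet_d2, jet_val, u, v, w₀, addSq]
  var_addSq x A₀ A₁ A₂ p q ξ := by
    simp only [Q₂, dQ₂, u, v, w₀, prolong₂_addSq_d2, sqJet, jet_d1, jet_d2, addSq, if_true,
      prolong₂_d1, sqJetVar_d1, jet_val, prolong₂_val, sqJetVar_val]
    ring

theorem isQuasilinear_Q₃ : IsQuasilinear (𝕜 := 𝕜) (d := d) Q₃ dQ₃ where
  apply_addSq x p q ξ s := by
    by_cases hs : s = 2
    · simp only [hs, Q₃, sqJet, jet_d1, jet_d2, jet_val, u, v, w₀, addSq, if_true]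
      ring
    · simp [hs, Q₃, jet_d1, jet_d2, jet_val, u, v, w₀, addSq]
  var_addSq x A₀ A₁ A₂ p q ξ := by
    simp only [Q₃, dQ₃, u, v, w₀, prolong₂_addSq_d2, sqJet, jet_d1, jet_d2, addSq, if_true,
      prolong₂_d1, sqJetVar_d1, jet_val, prolong₂_val, sqJetVar_val]
    ring

theorem isQuasilinear_Q₄ : IsQuasilinear (𝕜 := 𝕜) (d := d) Q₄ dQ₄ where
  apply_addSq x p q ξ s := by
    by_cases hs : s = 2
    · simp only [hs, Q₄, sqJet, jet_d1, jet_d2, jet_val, u, v, w₀, addSq, if_true]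
      ring
    · simp [hs, Q₄, jet_d1, jet_d2, jet_val, u, v, w₀, addSq]
  var_addSq x A₀ A₁ A₂ p q ξ := by
    simp only [Q₄, dQ₄, u, v, w₀, prolong₂_addSq_d2, sqJet, jet_d1, jet_d2, addSq, if_true,
      prolong₂_d1, sqJetVar_d1, jet_val, prolong₂_val, sqJetVar_val]
    ring

theorem isQuasilinear_Q₅ : IsQuasilinear (𝕜 := 𝕜) (d := d) Q₅ dQ₅ where
  apply_addSq x p q ξ s := by
    by_cases hs : s = 2
    · simp only [hs, Q₅, sqJet, jet_d1, jet_d2, jet_val, u, v, w₀, addSq, if_true]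
      ring
    · simp [hs, Q₅, jet_d1, jet_d2, jet_val, u, v, w₀, addSq]
  var_addSq x A₀ A₁ A₂ p q ξ := by
    simp only [Q₅, dQ₅, u, v, w₀, prolong₂_addSq_d2, sqJet, jet_d1, jet_d2, addSq, if_true,
      prolong₂_d1, sqJetVar_d1, jet_val, prolong₂_val, sqJetVar_val]
    ring

theorem isQuasilinear_Q₆ : IsQuasilinear (𝕜 := 𝕜) (d := d) Q₆ dQ₆ where
  apply_addSq x p q ξ s := by
    by_cases hs : s = 2
    · simp only [hs, Q₆, sqJet, jet_d1, jet_d2, jet_val, u, v, w₀, addSq, if_true]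
      ring
    · simp [hs, Q₆, jet_d1, jet_d2, jet_val, u, v, w₀, addSq]
  var_addSq x A₀ A₁ A₂ p q ξ := by
    simp only [Q₆, dQ₆, u, v, w₀, prolong₂_addSq_d2, sqJet, jet_d1, jet_d2, addSq, if_true,
      prolong₂_d1, sqJetVar_d1, jet_val, prolong₂_val, sqJetVar_val]
    ring

theorem isQuasilinear_R₁ : IsQuasilinear (𝕜 := 𝕜) (d := d) R₁ dR₁ where
  apply_addSq x p q ξ s := by
    by_cases hs : s = 2
    · simp only [hs, R₁, sqJet, jet_d1, jet_d2, u, v, addSq, if_true]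
      ring
    · simp [hs, R₁, jet_d1, jet_d2, u, v, addSq]
  var_addSq x A₀ A₁ A₂ p q ξ := by
    simp only [R₁, dR₁, u, v, prolong₂_addSq_d2, sqJet, jet_d1, jet_d2, addSq, if_true,
      prolong₂_d1, sqJetVar_d1]
    ring

theorem isQuasilinear_R₂ : IsQuasilinear (𝕜 := 𝕜) (d := d) R₂ dR₂ where
  apply_addSq x p q ξ s := by
    by_cases hs : s = 2
    · simp only [hs, R₂, sqJet, jet_d1, jet_d2, jet_val, u, v, w₀, addSq, if_true]
      ring
    · simp [hs, R₂, jet_d1, jet_d2, jet_val, u, v, w₀, addSq]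
  var_addSq x A₀ A₁ A₂ p q ξ := by
    simp only [R₂, dR₂, u, v, w₀, prolong₂_addSq_d2, sqJet, jet_d1, jet_d2, addSq, if_true,
      prolong₂_d1, sqJetVar_d1, jet_val, prolong₂_val, sqJetVar_val]
    ring

theorem isQuasilinear_R₃ : IsQuasilinear (𝕜 := 𝕜) (d := d) R₃ dR₃ where
  apply_addSq x p q ξ s := by
    by_cases hs : s = 2
    · simp only [hs, R₃, sqJet, jet_d1, jet_d2, jet_val, u, v, w₀, addSq, if_true]
      ring
    · simp [hs, R₃, jet_d1, jet_d2, jet_val, u, v, w₀, addSq]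
  var_addSq x A₀ A₁ A₂ p q ξ := by
    simp only [R₃, dR₃, u, v, w₀, prolong₂_addSq_d2, sqJet, jet_d1, jet_d2, addSq, if_true,
      prolong₂_d1, sqJetVar_d1, jet_val, prolong₂_val, sqJetVar_val]
    ring

theorem isQuasilinear_R₄ : IsQuasilinear (𝕜 := 𝕜) (d := d) R₄ dR₄ where
  apply_addSq x p q ξ s := by
    by_cases hs : s = 2
    · simp only [hs, R₄, sqJet, jet_d1, jet_d2, jet_val, u, v, w₀, addSq, if_true]
      ring
    · simp [hs, R₄, jet_d1, jet_d2, jet_val, u, v, w₀, addSq]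
  var_addSq x A₀ A₁ A₂ p q ξ := by
    simp only [R₄, dR₄, u, v, w₀, prolong₂_addSq_d2, sqJet, jet_d1, jet_d2, addSq, if_true,
      prolong₂_d1, sqJetVar_d1, jet_val, prolong₂_val, sqJetVar_val]
    ring

theorem isQuasilinear_R₅ : IsQuasilinear (𝕜 := 𝕜) (d := d) R₅ dR₅ where
  apply_addSq x p q ξ s := by
    by_cases hs : s = 2
    · simp only [hs, R₅, sqJet, jet_d1, jet_d2, jet_val, u, v, w₀, addSq, if_true]
      ring
    · simp [hs, R₅, jet_d1, jet_d2, jet_val, u, v, w₀, addSq]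
  var_addSq x A₀ A₁ A₂ p q ξ := by
    simp only [R₅, dR₅, u, v, w₀, prolong₂_addSq_d2, sqJet, jet_d1, jet_d2, addSq, if_true,
      prolong₂_d1, sqJetVar_d1, jet_val, prolong₂_val, sqJetVar_val]
    ring

theorem isQuasilinear_R₆ : IsQuasilinear (𝕜 := 𝕜) (d := d) R₆ dR₆ where
  apply_addSq x p q ξ s := by
    by_cases hs : s = 2
    · simp only [hs, R₆, sqJet, jet_d1, jet_d2, u, v, addSq, if_true]
      ring
    · simp [hs, R₆, jet_d1, jet_d2, u, v, addSq]
  var_addSq x A₀ A₁ A₂ p q ξ := by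
    simp only [R₆, dR₆, u, v, prolong₂_addSq_d2, sqJet, jet_d1, jet_d2, addSq, if_true,
      prolong₂_d1, sqJetVar_d1]
    ring

end LinearisedSystems

end ScrollSym

namespace ScrollSym

set_option linter.unusedSectionVars false

/-! ## Galilean shifts -/

section Shift

variable {𝕜 : Type*} [RCLike 𝕜] {d : ℕ}

/-- Derivatives along the coordinates, in terms of those along the coordinates, after subtraction of a
function with constant derivatives `p₀` from the dependent variables. -/
def horiz (p₀ : Fin 3 → Fin d → 𝕜) (f : Coord d 3 → 𝕜) : Coord d 3 → 𝕜
  | .inl i => f (.inl i) + ∑ β, p₀ β i * f (.inr β)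
  | .inr β => f (.inr β)

/-- Components of vectors after subtraction of a function with constant derivatives `p₀` from the
dependent variables. -/
def vert (p₀ : Fin 3 → Fin d → 𝕜) (f : Coord d 3 → 𝕜) : Coord d 3 → 𝕜
  | .inl k => f (.inl k)
  | .inr α => f (.inr α) - ∑ k, p₀ α k * f (.inl k)

/-- The first derivatives of the components of a vector field after a shift by `p₀`. -/
def shift₁ (p₀ : Fin 3 → Fin d → 𝕜) (A₁ : Coord d 3 → Coord d 3 → 𝕜) (c i : Coord d 3) : 𝕜 :=
  vert p₀ (fun c => horiz p₀ (A₁ c) i) c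

/-- The second derivatives of the components of a vector field after a shift by `p₀`. -/
def shift₂ (p₀ : Fin 3 → Fin d → 𝕜) (A₂ : Coord d 3 → Coord d 3 → Coord d 3 → 𝕜) (c i j : Coord d 3) :
    𝕜 :=
  vert p₀ (fun c => horiz p₀ (fun i => horiz p₀ (A₂ c i) j) i) c

theorem horiz_add_sum (p₀ π : Fin 3 → Fin d → 𝕜) (f : Coord d 3 → 𝕜) (i : Fin d) :
    horiz p₀ f (.inl i) + ∑ β, π β i * horiz p₀ f (.inr β)
      = f (.inl i) + ∑ β, (p₀ + π) β i * f (.inr β) := by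
  simp only [horiz, Pi.add_apply, add_mul, Finset.sum_add_distrib]
  ring

theorem vert_add (p₀ : Fin 3 → Fin d → 𝕜) (f g : Coord d 3 → 𝕜) (c : Coord d 3) :
    vert p₀ (fun c => f c + g c) c = vert p₀ f c + vert p₀ g c := by
  cases c
  · rfl
  · simp only [vert, mul_add, Finset.sum_add_distrib]
    ring

theorem vert_mul (p₀ : Fin 3 → Fin d → 𝕜) (a : 𝕜) (f : Coord d 3 → 𝕜) (c : Coord d 3) :
    vert p₀ (fun c => a * f c) c = a * vert p₀ f c := by
  cases c
  · rfl
  · simp only [vert, mul_sub, Finset.mul_sum, mul_left_comm]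

theorem total_shift (p₀ π : Fin 3 → Fin d → 𝕜) (A₁ : Coord d 3 → Coord d 3 → 𝕜) (i : Fin d)
    (c : Coord d 3) : total (shift₁ p₀ A₁) π i c = vert p₀ (total A₁ (p₀ + π) i) c := by
  have : total A₁ (p₀ + π) i = fun c => horiz p₀ (A₁ c) (.inl i)
      + (π 0 i * horiz p₀ (A₁ c) (.inr 0) + π 1 i * horiz p₀ (A₁ c) (.inr 1)
        + π 2 i * horiz p₀ (A₁ c) (.inr 2)) := by
    funext c
    rw [total, ← horiz_add_sum, Fin.sum_univ_three]
  rw [this]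
  simp only [vert_add, vert_mul, total, shift₁, Fin.sum_univ_three]

theorem total₂_shift (p₀ π : Fin 3 → Fin d → 𝕜) (A₁ : Coord d 3 → Coord d 3 → 𝕜)
    (A₂ : Coord d 3 → Coord d 3 → Coord d 3 → 𝕜) (q : Fin 3 → Fin d → Fin d → 𝕜) (i j : Fin d)
    (c : Coord d 3) :
    total₂ (shift₁ p₀ A₁) (shift₂ p₀ A₂) π q i j c = vert p₀ (total₂ A₁ A₂ (p₀ + π) q i j) c := by
  have : total₂ A₁ A₂ (p₀ + π) q i j = fun c =>
      horiz p₀ (fun i => horiz p₀ (A₂ c i) (.inl j)) (.inl i)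
      + (π 0 i * horiz p₀ (fun i => horiz p₀ (A₂ c i) (.inl j)) (.inr 0)
        + π 1 i * horiz p₀ (fun i => horiz p₀ (A₂ c i) (.inl j)) (.inr 1)
        + π 2 i * horiz p₀ (fun i => horiz p₀ (A₂ c i) (.inl j)) (.inr 2))
      + (π 0 j * horiz p₀ (fun i => horiz p₀ (A₂ c i) (.inr 0)) (.inl i)
        + π 1 j * horiz p₀ (fun i => horiz p₀ (A₂ c i) (.inr 1)) (.inl i)
        + π 2 j * horiz p₀ (fun i => horiz p₀ (A₂ c i) (.inr 2)) (.inl i))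
      + (π 0 i * π 0 j * A₂ c (.inr 0) (.inr 0) + π 0 i * π 1 j * A₂ c (.inr 0) (.inr 1)
        + π 0 i * π 2 j * A₂ c (.inr 0) (.inr 2)
        + (π 1 i * π 0 j * A₂ c (.inr 1) (.inr 0) + π 1 i * π 1 j * A₂ c (.inr 1) (.inr 1)
        + π 1 i * π 2 j * A₂ c (.inr 1) (.inr 2))
        + (π 2 i * π 0 j * A₂ c (.inr 2) (.inr 0) + π 2 i * π 1 j * A₂ c (.inr 2) (.inr 1)
        + π 2 i * π 2 j * A₂ c (.inr 2) (.inr 2)))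
      + (q 0 i j * A₁ c (.inr 0) + q 1 i j * A₁ c (.inr 1) + q 2 i j * A₁ c (.inr 2)) := by
    funext c
    simp only [total₂, horiz, Fin.sum_univ_three, Pi.add_apply]
    ring
  rw [this]
  simp only [vert_add, vert_mul, total₂, shift₁, shift₂, Fin.sum_univ_three, horiz]

/-- Naturality of prolongation under subtraction of a function with gradient `p₀` from the dependent
variables: `horiz` is the chain rule for derivatives and `vert` the change of components. The values
`A₀` stay as they are, because on the jets over a single point the change of variables is a
translation, whose differential is the identity. -/
theorem prolong₂_shift (p₀ π : Fin 3 → Fin d → 𝕜) (A₀ : Coord d 3 → 𝕜)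
    (A₁ : Coord d 3 → Coord d 3 → 𝕜) (A₂ : Coord d 3 → Coord d 3 → Coord d 3 → 𝕜)
    (q : Fin 3 → Fin d → Fin d → 𝕜) :
    prolong₂ A₀ (shift₁ p₀ A₁) (shift₂ p₀ A₂) π q = prolong₂ A₀ A₁ A₂ (p₀ + π) q := by
  have h1 : prolong₁ (shift₁ p₀ A₁) π = prolong₁ A₁ (p₀ + π) := by
    funext α i
    simp only [prolong₁, total_shift, vert, sub_sub, ← Finset.sum_add_distrib]
    congr 1
    refine Finset.sum_congr rfl fun k _ => ?_
    simp only [Pi.add_apply]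
    ring
  rw [prolong₂, prolong₂, h1]
  refine congrArg (Prod.mk _) (congrArg (Prod.mk _) (congrArg (Prod.mk _) ?_))
  funext α i j
  simp only [total₂_shift, total_shift, vert, sub_sub, ← Finset.sum_add_distrib]
  congr 1
  refine Finset.sum_congr rfl fun k _ => ?_
  simp only [Pi.add_apply]
  ring

/-- If every equation is invariant under translation by a fixed jet, its derivatives at a jet and at
the translated one in the same direction agree, and so do the sets of jets on the system. -/
theorem IsJetSymmetry.shift {Sys : List (Jet2 𝕜 d 3 → 𝕜)} {x A₀ : Coord d 3 → 𝕜} {A₁ A₂}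
    (h : IsJetSymmetry Sys x A₀ A₁ A₂) {x₀ : Coord d 3 → 𝕜} {p₀ : Fin 3 → Fin d → 𝕜}
    (hinv : ∀ F ∈ Sys, ∀ J, F (jet x₀ p₀ 0 + J) = F J) :
    IsJetSymmetry Sys (x - x₀) A₀ (shift₁ p₀ A₁) (shift₂ p₀ A₂) := by
  intro π q hq hF F hFS
  have key : jet x (p₀ + π) q = jet x₀ p₀ 0 + jet (x - x₀) π q := by
    simp only [jet, Prod.mk_add_mk, zero_add]
    congr 1
    · funext i; simp
    · congr 1
      funext i; simp
  have := h (p₀ + π) q hq (fun F hFS => by rw [key, hinv F hFS]; exact hF F hFS) F hFS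
  rw [key, lineDeriv] at this
  rw [prolong₂_shift, lineDeriv]
  simpa only [add_assoc, hinv F hFS] using this

end Shift

/-! ### Null covectors of the symbols, and invariance of the systems under shifts. -/

section NullCovectors

variable {𝕜 : Type*} [RCLike 𝕜] {d : ℕ} [NeZero d]

theorem u_jet (x : Coord d 3 → 𝕜) (p q) (i : Fin d) : u (jet x p q) i = p 0 i := rfl

theorem v_jet (x : Coord d 3 → 𝕜) (p q) (i : Fin d) : v (jet x p q) i = p 1 i := rfl

theorem w_jet (x : Coord d 3 → 𝕜) (p q) (i : Fin d) : w (jet x p q) i = p 2 i := rfl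

theorem w₀_jet (x : Coord d 3 → 𝕜) (p q) : w₀ (jet x p q) = x (.inr 2) := rfl

/-- The shift by `t` in the directions of `v_3` and `u_4`, under which the systems `triple` and
`triple1` are invariant. -/
def slope (t : 𝕜) (α : Fin 3) (i : Fin d) : 𝕜 :=
  if α = 1 ∧ i = 3 ∨ α = 0 ∧ i = 4 then t else 0

/-- The shift by `t` in the directions of `v_4` and `u_3`, under which the systems `alttriple` and
`triple2` are invariant. -/
def altSlope (t : 𝕜) (α : Fin 3) (i : Fin d) : 𝕜 :=
  if α = 1 ∧ i = 4 ∨ α = 0 ∧ i = 3 then -t else 0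

/-- The point all of whose coordinates vanish, except that the value of `w` is `t`. -/
def offset (t : 𝕜) (c : Coord d 3) : 𝕜 := if c = .inr 2 then t else 0

/-- The 1-jet whose only nonzero entry is the derivative of the dependent variable `α` in the
direction `i`. -/
def unit (α : Fin 3) (i : Fin d) (β : Fin 3) (j : Fin d) : 𝕜 := if j = i then if β = α then 1 else 0 else 0

/-- Lets `simp` identify the last variable, written `5` or `6` in the systems, with the entry `0` of
a sum over `Fin d`. -/
theorem ofNat_self : (5 : Fin 5) = 0 ∧ (6 : Fin 6) = 0 := ⟨rfl, rfl⟩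

/-- The second derivatives whose only nonzero entries are those of the dependent variable `α` in the
directions `i, j`. -/
def unit₂ (α : Fin 3) (i j : Fin d) (c : 𝕜) (β : Fin 3) (k l : Fin d) : 𝕜 :=
  if β = α then if k = i then if l = j then c else 0 else if k = j then if l = i then c else 0 else 0 else 0

theorem unit₂_symm {α : Fin 3} {i j : Fin d} (h : i ≠ j) (c : 𝕜) (β k l) :
    unit₂ α i j c β k l = unit₂ α i j c β l k := by
  unfold unit₂
  split_ifs <;> simp_all

theorem total_zero (A₁ : Coord d 3 → Coord d 3 → 𝕜) (i : Fin d) (c : Coord d 3) :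
    total A₁ 0 i c = A₁ c (.inl i) := by simp [total]

theorem prolong₁_zero (A₁ : Coord d 3 → Coord d 3 → 𝕜) (β : Fin 3) (i : Fin d) :
    prolong₁ A₁ 0 β i = A₁ (.inr β) (.inl i) := by simp [prolong₁, total]

theorem total_unit (A₁ : Coord d 3 → Coord d 3 → 𝕜) (α : Fin 3) (j i : Fin d) (c : Coord d 3) :
    total A₁ (unit α j) i c = A₁ c (.inl i) + if i = j then A₁ c (.inr α) else 0 := by
  by_cases h : i = j <;> simp [total, unit, h]

theorem prolong₁_unit (A₁ : Coord d 3 → Coord d 3 → 𝕜) (α : Fin 3) (j : Fin d) (β : Fin 3) (i : Fin d) :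
    prolong₁ A₁ (unit α j) β i = A₁ (.inr β) (.inl i) + (if i = j then A₁ (.inr β) (.inr α) else 0)
      - if β = α then A₁ (.inl j) (.inl i) + (if i = j then A₁ (.inl j) (.inr α) else 0) else 0 := by
  by_cases h : β = α <;> simp [prolong₁, total_unit, unit, h]

/-- For null ξ the jets with second derivatives `q` and `addSq q ξ` both lie on the system. In the
difference of the symmetry conditions for the three w-equations all terms containing `q`, and all
terms of first order, cancel. What is left says that the vector field is tangent to the family of
null cones at ξ; it depends on `A₀` and `A₁` but not on `A₂`. -/
theorem triple_null {x A₀ : Coord d 3 → 𝕜} {A₁ A₂}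
    (h : IsJetSymmetry (triple 𝕜 d) x A₀ A₁ A₂) {p q} (hq : ∀ α i j, q α i j = q α j i)
    (hF : ∀ F ∈ triple 𝕜 d, F (jet x p q) = 0) (ξ : Fin d → 𝕜)
    (H : Q₁ (sqJet x p ξ) 2 = 0 ∧ Q₂ (sqJet x p ξ) 2 = 0 ∧ Q₃ (sqJet x p ξ) 2 = 0) :
    dQ₁ (sqJet x p ξ) (sqJetVar A₀ A₁ p ξ) 2 = 0 ∧ dQ₂ (sqJet x p ξ) (sqJetVar A₀ A₁ p ξ) 2 = 0 ∧
      dQ₃ (sqJet x p ξ) (sqJetVar A₀ A₁ p ξ) 2 = 0 := by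
  obtain ⟨h1, h2, h3⟩ := H
  have hF' : ∀ F ∈ triple 𝕜 d, F (jet x p (addSq q ξ)) = 0 := by
    simp only [triple, List.forall_mem_cons, isQuasilinear_Q₁.apply_addSq,
      isQuasilinear_Q₂.apply_addSq, isQuasilinear_Q₃.apply_addSq, h1, h2, h3, ite_self, add_zero,
      u_jet, v_jet, w_jet, List.not_mem_nil, false_implies, implies_true, and_true] at hF ⊢
    exact hF
  have e := triple_lineDeriv_iff.1 (h p q hq hF)
  have e' := triple_lineDeriv_iff.1 (h p _ (addSq_symm hq ξ) hF')
  -- By `h1`, `h2`, `h3` the scalar part of the variation is multiplied by zero.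
  rw [isQuasilinear_Q₁.var_addSq, isQuasilinear_Q₂.var_addSq, isQuasilinear_Q₃.var_addSq, h1, h2,
    h3] at e'
  obtain ⟨-, -, e1, -, -, e2, -, -, e3⟩ := e
  obtain ⟨-, -, e1', -, -, e2', -, -, e3'⟩ := e'
  simp only [w, jet_d1, prolong₂_d1] at e2 e3 e2' e3'
  exact ⟨by linear_combination e1' - e1, by linear_combination e2' - e2,
    by linear_combination e3' - e3⟩

theorem full_null {x A₀ : Coord d 3 → 𝕜} {A₁ A₂}
    (h : IsJetSymmetry (triple 𝕜 d ++ triple1 𝕜 d) x A₀ A₁ A₂) {p q}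
    (hq : ∀ α i j, q α i j = q α j i)
    (hF : ∀ F ∈ triple 𝕜 d ++ triple1 𝕜 d, F (jet x p q) = 0) (ξ : Fin d → 𝕜)
    (H : Q₁ (sqJet x p ξ) 2 = 0 ∧ Q₂ (sqJet x p ξ) 2 = 0 ∧ Q₃ (sqJet x p ξ) 2 = 0 ∧
      Q₄ (sqJet x p ξ) 2 = 0 ∧ Q₅ (sqJet x p ξ) 2 = 0 ∧ Q₆ (sqJet x p ξ) 2 = 0) :
    dQ₁ (sqJet x p ξ) (sqJetVar A₀ A₁ p ξ) 2 = 0 ∧ dQ₂ (sqJet x p ξ) (sqJetVar A₀ A₁ p ξ) 2 = 0 ∧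
      dQ₃ (sqJet x p ξ) (sqJetVar A₀ A₁ p ξ) 2 = 0 ∧ dQ₄ (sqJet x p ξ) (sqJetVar A₀ A₁ p ξ) 2 = 0 ∧
      dQ₅ (sqJet x p ξ) (sqJetVar A₀ A₁ p ξ) 2 = 0 ∧ dQ₆ (sqJet x p ξ) (sqJetVar A₀ A₁ p ξ) 2 = 0 := by
  obtain ⟨h1, h2, h3, h4, h5, h6⟩ := H
  have hF' : ∀ F ∈ triple 𝕜 d ++ triple1 𝕜 d, F (jet x p (addSq q ξ)) = 0 := by
    simp only [triple, triple1, List.cons_append, List.nil_append, List.forall_mem_cons,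
      isQuasilinear_Q₁.apply_addSq, isQuasilinear_Q₂.apply_addSq, isQuasilinear_Q₃.apply_addSq,
      isQuasilinear_Q₄.apply_addSq, isQuasilinear_Q₅.apply_addSq, isQuasilinear_Q₆.apply_addSq,
      h1, h2, h3, h4, h5, h6, ite_self, add_zero, u_jet, v_jet, w_jet, w₀_jet, List.not_mem_nil,
      false_implies, implies_true, and_true] at hF ⊢
    exact hF
  obtain ⟨e, f⟩ := List.forall_mem_append.1 (h p q hq hF)
  obtain ⟨e', f'⟩ := List.forall_mem_append.1 (h p _ (addSq_symm hq ξ) hF')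
  have e := triple_lineDeriv_iff.1 e
  have e' := triple_lineDeriv_iff.1 e'
  have f := triple1_lineDeriv_iff.1 f
  have f' := triple1_lineDeriv_iff.1 f'
  rw [isQuasilinear_Q₁.var_addSq, isQuasilinear_Q₂.var_addSq, isQuasilinear_Q₃.var_addSq, h1, h2,
    h3] at e'
  rw [isQuasilinear_Q₄.var_addSq, isQuasilinear_Q₅.var_addSq, isQuasilinear_Q₆.var_addSq, h4, h5,
    h6] at f'
  obtain ⟨-, -, e1, -, -, e2, -, -, e3⟩ := e
  obtain ⟨-, -, e1', -, -, e2', -, -, e3'⟩ := e'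
  obtain ⟨-, -, e4, -, -, e5, -, -, e6⟩ := f
  obtain ⟨-, -, e4', -, -, e5', -, -, e6'⟩ := f'
  simp only [w, jet_d1, prolong₂_d1] at e2 e3 e2' e3' e4 e4' e5 e5' e6 e6'
  exact ⟨by linear_combination e1' - e1, by linear_combination e2' - e2,
    by linear_combination e3' - e3, by linear_combination e4' - e4, by linear_combination e5' - e5,
    by linear_combination e6' - e6⟩

theorem alttriple_null {x A₀ : Coord d 3 → 𝕜} {A₁ A₂}
    (h : IsJetSymmetry (alttriple 𝕜 d) x A₀ A₁ A₂) {p q} (hq : ∀ α i j, q α i j = q α j i)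
    (hF : ∀ F ∈ alttriple 𝕜 d, F (jet x p q) = 0) (ξ : Fin d → 𝕜)
    (H : R₁ (sqJet x p ξ) 2 = 0 ∧ R₂ (sqJet x p ξ) 2 = 0 ∧ R₃ (sqJet x p ξ) 2 = 0) :
    dR₁ (sqJet x p ξ) (sqJetVar A₀ A₁ p ξ) 2 = 0 ∧ dR₂ (sqJet x p ξ) (sqJetVar A₀ A₁ p ξ) 2 = 0 ∧
      dR₃ (sqJet x p ξ) (sqJetVar A₀ A₁ p ξ) 2 = 0 := by
  obtain ⟨h1, h2, h3⟩ := H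
  have hF' : ∀ F ∈ alttriple 𝕜 d, F (jet x p (addSq q ξ)) = 0 := by
    simp only [alttriple, List.forall_mem_cons, isQuasilinear_R₁.apply_addSq,
      isQuasilinear_R₂.apply_addSq, isQuasilinear_R₃.apply_addSq, h1, h2, h3, ite_self, add_zero,
      u_jet, v_jet, w_jet, List.not_mem_nil, false_implies, implies_true, and_true] at hF ⊢
    exact hF
  have e := alttriple_lineDeriv_iff.1 (h p q hq hF)
  have e' := alttriple_lineDeriv_iff.1 (h p _ (addSq_symm hq ξ) hF')
  rw [isQuasilinear_R₁.var_addSq, isQuasilinear_R₂.var_addSq, isQuasilinear_R₃.var_addSq, h1, h2,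
    h3] at e'
  obtain ⟨-, -, e1, -, -, e2, -, -, e3⟩ := e
  obtain ⟨-, -, e1', -, -, e2', -, -, e3'⟩ := e'
  simp only [w, jet_d1, prolong₂_d1] at e2 e3 e2' e3'
  exact ⟨by linear_combination e1' - e1, by linear_combination e2' - e2,
    by linear_combination e3' - e3⟩

theorem altfull_null {x A₀ : Coord d 3 → 𝕜} {A₁ A₂}
    (h : IsJetSymmetry (alttriple 𝕜 d ++ triple2 𝕜 d) x A₀ A₁ A₂) {p q}
    (hq : ∀ α i j, q α i j = q α j i)
    (hF : ∀ F ∈ alttriple 𝕜 d ++ triple2 𝕜 d, F (jet x p q) = 0) (ξ : Fin d → 𝕜)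
    (H : R₁ (sqJet x p ξ) 2 = 0 ∧ R₂ (sqJet x p ξ) 2 = 0 ∧ R₃ (sqJet x p ξ) 2 = 0 ∧
      R₄ (sqJet x p ξ) 2 = 0 ∧ R₅ (sqJet x p ξ) 2 = 0 ∧ R₆ (sqJet x p ξ) 2 = 0) :
    dR₁ (sqJet x p ξ) (sqJetVar A₀ A₁ p ξ) 2 = 0 ∧ dR₂ (sqJet x p ξ) (sqJetVar A₀ A₁ p ξ) 2 = 0 ∧
      dR₃ (sqJet x p ξ) (sqJetVar A₀ A₁ p ξ) 2 = 0 ∧ dR₄ (sqJet x p ξ) (sqJetVar A₀ A₁ p ξ) 2 = 0 ∧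
      dR₅ (sqJet x p ξ) (sqJetVar A₀ A₁ p ξ) 2 = 0 ∧ dR₆ (sqJet x p ξ) (sqJetVar A₀ A₁ p ξ) 2 = 0 := by
  obtain ⟨h1, h2, h3, h4, h5, h6⟩ := H
  have hF' : ∀ F ∈ alttriple 𝕜 d ++ triple2 𝕜 d, F (jet x p (addSq q ξ)) = 0 := by
    simp only [alttriple, triple2, List.cons_append, List.nil_append, List.forall_mem_cons,
      isQuasilinear_R₁.apply_addSq, isQuasilinear_R₂.apply_addSq, isQuasilinear_R₃.apply_addSq,
      isQuasilinear_R₄.apply_addSq, isQuasilinear_R₅.apply_addSq, isQuasilinear_R₆.apply_addSq,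
      h1, h2, h3, h4, h5, h6, ite_self, add_zero, u_jet, v_jet, w_jet, w₀_jet, List.not_mem_nil,
      false_implies, implies_true, and_true] at hF ⊢
    exact hF
  obtain ⟨e, f⟩ := List.forall_mem_append.1 (h p q hq hF)
  obtain ⟨e', f'⟩ := List.forall_mem_append.1 (h p _ (addSq_symm hq ξ) hF')
  have e := alttriple_lineDeriv_iff.1 e
  have e' := alttriple_lineDeriv_iff.1 e'
  have f := triple2_lineDeriv_iff.1 f
  have f' := triple2_lineDeriv_iff.1 f'
  rw [isQuasilinear_R₁.var_addSq, isQuasilinear_R₂.var_addSq, isQuasilinear_R₃.var_addSq, h1, h2,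
    h3] at e'
  rw [isQuasilinear_R₄.var_addSq, isQuasilinear_R₅.var_addSq, isQuasilinear_R₆.var_addSq, h4, h5,
    h6] at f'
  obtain ⟨-, -, e1, -, -, e2, -, -, e3⟩ := e
  obtain ⟨-, -, e1', -, -, e2', -, -, e3'⟩ := e'
  obtain ⟨-, -, e4, -, -, e5, -, -, e6⟩ := f
  obtain ⟨-, -, e4', -, -, e5', -, -, e6'⟩ := f'
  simp only [w, jet_d1, prolong₂_d1] at e2 e3 e2' e3' e4 e4' e5 e5' e6 e6'
  exact ⟨by linear_combination e1' - e1, by linear_combination e2' - e2,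
    by linear_combination e3' - e3, by linear_combination e4' - e4, by linear_combination e5' - e5,
    by linear_combination e6' - e6⟩

/-- The value of w occurs only in the combination w − v₃, v₃ occurs nowhere else, and u₄ does not
occur at all; in `triple1` the combinations are w − v₃ and w − u₄. The shift leaves these fixed. -/
theorem slope_invariant (t : 𝕜) :
    ∀ F ∈ triple 𝕜 5, ∀ J, F (jet (offset t) (slope t) 0 + J) = F J := by
  simp only [triple, List.forall_mem_cons, Q₁, Q₂, Q₃, u, v, w, w₀, d1_add, d2_add, val_add,
    jet_d1, jet_d2, jet_val, slope, offset, Pi.zero_apply, zero_add]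
  simp [show (5 : Fin 5) = 0 from rfl]

theorem slope_invariant' (t : 𝕜) :
    ∀ F ∈ triple 𝕜 6 ++ triple1 𝕜 6, ∀ J, F (jet (offset t) (slope t) 0 + J) = F J := by
  simp only [triple, triple1, List.cons_append, List.nil_append, List.forall_mem_cons, Q₁, Q₂, Q₃,
    Q₄, Q₅, Q₆, u, v, w, w₀, d1_add, d2_add, val_add,
    jet_d1, jet_d2, jet_val, slope, offset, Pi.zero_apply, zero_add]
  simp [show (6 : Fin 6) = 0 from rfl]

/-- Here the value of w occurs only in v₄ + w; with `triple2` also u₃ + w and v₄ − u₃ appear, and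
all of them are fixed by the shift. -/
theorem altSlope_invariant (t : 𝕜) :
    ∀ F ∈ alttriple 𝕜 5, ∀ J, F (jet (offset t) (altSlope t) 0 + J) = F J := by
  simp only [alttriple, List.forall_mem_cons, R₁, R₂, R₃, u, v, w, w₀, d1_add, d2_add, val_add,
    jet_d1, jet_d2, jet_val, altSlope, offset, Pi.zero_apply, zero_add]
  have e : ∀ a b : 𝕜, -t + a + (t + b) = a + b := fun a b => by ring
  simp [e, show (5 : Fin 5) = 0 from rfl]

theorem altSlope_invariant' (t : 𝕜) :
    ∀ F ∈ alttriple 𝕜 6 ++ triple2 𝕜 6, ∀ J, F (jet (offset t) (altSlope t) 0 + J) = F J := by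
  simp only [alttriple, triple2, List.cons_append, List.nil_append, List.forall_mem_cons, R₁, R₂, R₃,
    R₄, R₅, R₆, u, v, w, w₀, d1_add, d2_add, val_add,
    jet_d1, jet_d2, jet_val, altSlope, offset, Pi.zero_apply, zero_add]
  have e : ∀ a b : 𝕜, -t + a + (t + b) = a + b := fun a b => by ring
  simp [e, show (6 : Fin 6) = 0 from rfl]

end NullCovectors

end ScrollSym

namespace ScrollSym

set_option linter.unusedSectionVars false

set_option linter.unusedSimpArgs false

/-! ### First-order relations obtained from null covectors at points with w = 0. -/

section FirstOrder

variable {𝕜 : Type*} [RCLike 𝕜]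

/-- The linear relations between the first derivatives `A` of the components of a symmetry of the system `triple`.
The value of `w` is `t`, and that of the `w`-component is `W`. -/
structure TripleRelations {R : Type*} [CommRing R] (t W : R) (A : Coord 5 3 → Coord 5 3 → R) : Prop where
  base : ∀ k β, A (.inl k) (.inr β) = 0
  a21 : A (.inl 2) (.inl 1) = 0
  a31 : A (.inl 3) (.inl 1) = 0
  a32 : A (.inl 3) (.inl 2) = 0
  a41 : A (.inl 4) (.inl 1) = 0
  a42 : A (.inl 4) (.inl 2) = 0
  a43 : A (.inl 4) (.inl 3) = 0
  a51 : A (.inl 0) (.inl 1) = 0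
  a52 : A (.inl 0) (.inl 2) = 0
  a53 : A (.inl 0) (.inl 3) = 0
  a54 : A (.inl 0) (.inl 4) = 0
  a34 : A (.inl 3) (.inl 4) = A (.inl 1) (.inl 2)
  a44 : A (.inl 4) (.inl 4) = A (.inl 2) (.inl 2) + A (.inl 3) (.inl 3) - A (.inl 1) (.inl 1)
  a45 : A (.inl 4) (.inl 0) = A (.inl 2) (.inl 3)
  a55 : A (.inl 0) (.inl 0) = 2 * A (.inl 3) (.inl 3) - A (.inl 1) (.inl 1)
  u1 : A (.inr 0) (.inl 1) = A (.inl 2) (.inl 3)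
  u2 : A (.inr 0) (.inl 2) = A (.inl 1) (.inl 3) + A (.inl 2) (.inl 4) - A (.inl 3) (.inl 0)
  u3 : A (.inr 0) (.inl 3) = A (.inl 2) (.inl 0)
  uu : A (.inr 0) (.inr 0) = A (.inl 1) (.inl 1) + A (.inl 2) (.inl 2) - A (.inl 3) (.inl 3)
  uv : A (.inr 0) (.inr 1) = 0
  v1 : A (.inr 1) (.inl 1) = 2 * A (.inl 1) (.inl 3) - A (.inl 3) (.inl 0)
  v2 : A (.inr 1) (.inl 2) = A (.inl 1) (.inl 4)
  v3 : A (.inr 1) (.inl 3) = W + A (.inl 1) (.inl 0) - t * (2 * A (.inl 1) (.inl 1) - 2 * A (.inl 3)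
    (.inl 3))
  vu : A (.inr 1) (.inr 0) = A (.inl 1) (.inl 2)
  vv : A (.inr 1) (.inr 1) = 2 * A (.inl 1) (.inl 1) - A (.inl 3) (.inl 3)

set_option maxHeartbeats 4000000 in
-- The tangency condition is tested at the zero 1-jet and at four 1-jets with a single nonzero
-- entry, u₁, u₂, v₁ or w₅. All first-order terms of the equations vanish there, so zero second
-- derivatives give a jet on the system. Each null covector then contributes three linear equations
-- in the entries of `A₁`, and the relations are their consequences by elimination.
theorem triple_relations {x A₀ : Coord 5 3 → 𝕜} {A₁ A₂} (hx : x (.inr 2) = 0) (h : IsJetSymmetry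
    (triple 𝕜 5) x A₀ A₁ A₂) : TripleRelations 0 (A₀ (.inr 2)) A₁ := by
  have hF0 : ∀ F ∈ triple 𝕜 5, F (jet x (0) 0) = 0 := by
    simp [triple, Q₁, Q₂, Q₃, jet_d2, u_jet, v_jet, w_jet, w₀_jet, hx, ofNat_self]
  -- The vector starts with ξ₅ because the label of x⁵ is `0`.
  have N0 := fun ξ₁ ξ₂ ξ₃ ξ₄ ξ₅ => triple_null h (fun _ _ _ => rfl) hF0 ![ξ₅, ξ₁, ξ₂, ξ₃, ξ₄]
  have hF1 : ∀ F ∈ triple 𝕜 5, F (jet x (unit 0 1) 0) = 0 := by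
    simp [triple, Q₁, Q₂, Q₃, jet_d2, u_jet, v_jet, w_jet, w₀_jet, hx, unit, ofNat_self]
  have N1 := fun ξ₁ ξ₂ ξ₃ ξ₄ ξ₅ => triple_null h (fun _ _ _ => rfl) hF1 ![ξ₅, ξ₁, ξ₂, ξ₃, ξ₄]
  have hF2 : ∀ F ∈ triple 𝕜 5, F (jet x (unit 0 2) 0) = 0 := by
    simp [triple, Q₁, Q₂, Q₃, jet_d2, u_jet, v_jet, w_jet, w₀_jet, hx, unit, ofNat_self]
  have N2 := fun ξ₁ ξ₂ ξ₃ ξ₄ ξ₅ => triple_null h (fun _ _ _ => rfl) hF2 ![ξ₅, ξ₁, ξ₂, ξ₃, ξ₄]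
  have hF3 : ∀ F ∈ triple 𝕜 5, F (jet x (unit 1 1) 0) = 0 := by
    simp [triple, Q₁, Q₂, Q₃, jet_d2, u_jet, v_jet, w_jet, w₀_jet, hx, unit, ofNat_self]
  have N3 := fun ξ₁ ξ₂ ξ₃ ξ₄ ξ₅ => triple_null h (fun _ _ _ => rfl) hF3 ![ξ₅, ξ₁, ξ₂, ξ₃, ξ₄]
  -- The slope w₅ does not enter the symbols, so the null cone is that of the zero 1-jet; but total
  -- derivatives along x⁵ now contain derivatives in w, which gives access to ∂_w of the
  -- x-components.
  have hF4 : ∀ F ∈ triple 𝕜 5, F (jet x (unit 2 0) 0) = 0 := by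
    simp [triple, Q₁, Q₂, Q₃, jet_d2, u_jet, v_jet, w_jet, w₀_jet, hx, unit, ofNat_self]
  have N4 := fun ξ₁ ξ₂ ξ₃ ξ₄ ξ₅ => triple_null h (fun _ _ _ => rfl) hF4 ![ξ₅, ξ₁, ξ₂, ξ₃, ξ₄]
  simp only [Q₁, Q₂, Q₃, dQ₁, dQ₂, dQ₃, u, v, w₀, sqJet, sqJetVar, jet_d1, jet_d2, jet_val,
    contract, hx, Fin.sum_univ_five, Matrix.cons_val, total_zero, prolong₁_zero, Fin.reduceEq,
    Fin.isValue, if_true, if_false, and_self, Pi.zero_apply, zero_mul, mul_zero, add_zero, zero_add,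
    sub_zero, zero_sub, neg_zero, mul_one, one_mul, sub_self, ofNat_self] at N0
  simp only [Q₁, Q₂, Q₃, dQ₁, dQ₂, dQ₃, u, v, w₀, sqJet, sqJetVar, jet_d1, jet_d2, jet_val,
    contract, hx, Fin.sum_univ_five, Matrix.cons_val, total_unit, prolong₁_unit, unit, Fin.reduceEq,
    Fin.isValue, if_true, if_false, and_self, Pi.zero_apply, zero_mul, mul_zero, add_zero, zero_add,
    sub_zero, zero_sub, neg_zero, mul_one, one_mul, sub_self, ofNat_self] at N1 N2 N3 N4
  -- Points (a, b, aλ, bλ, aλ²) of the scroll with λ = 0, ∞, 1, −1. At the other 1-jets the symbols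
  -- are deformed by the slope, and the covectors are adapted accordingly.
  have e1 := N0 1 0 0 0 0 (by norm_num)
  have e2 := N0 0 1 0 0 0 (by norm_num)
  have e3 := N0 0 0 0 1 0 (by norm_num)
  have e4 := N0 0 0 0 0 1 (by norm_num)
  have e5 := N0 1 1 0 0 0 (by norm_num)
  have e6 := N0 0 1 0 1 0 (by norm_num)
  have e7 := N0 0 0 0 1 1 (by norm_num)
  have e8 := N0 1 0 1 0 1 (by norm_num)
  have e9 := N0 1 0 (-1) 0 1 (by norm_num)
  have e10 := N0 1 1 1 1 1 (by norm_num)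
  have e11 := N0 1 1 (-1) (-1) 1 (by norm_num)
  have e12 := N1 0 0 0 1 0 (by norm_num)
  have e13 := N1 0 0 0 0 1 (by norm_num)
  have e14 := N1 0 1 (-1) 0 0 (by norm_num)
  have e15 := N1 1 1 0 1 0 (by norm_num)
  have e16 := N1 1 1 (-1) 0 0 (by norm_num)
  have e17 := N1 1 0 1 0 1 (by norm_num)
  have e18 := N1 1 0 (-1) 0 1 (by norm_num)
  have e19 := N2 1 0 0 0 0 (by norm_num)
  have e20 := N2 1 1 0 (-1) 0 (by norm_num)
  have e21 := N3 0 1 0 0 0 (by norm_num)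
  have e22 := N3 0 0 0 1 0 (by norm_num)
  have e23 := N3 0 0 0 0 1 (by norm_num)
  have e24 := N3 1 0 (-1) 0 0 (by norm_num)
  have e25 := N3 0 1 0 1 0 (by norm_num)
  have e26 := N3 1 1 0 1 0 (by norm_num)
  have e27 := N3 1 0 1 0 2 (by norm_num)
  have e28 := N4 1 0 0 0 0 (by norm_num)
  have e29 := N4 0 1 0 0 0 (by norm_num)
  have e30 := N4 0 1 0 1 0 (by norm_num)
  have e31 := N4 1 0 1 0 1 (by norm_num)
  have e32 := N4 1 0 (-1) 0 1 (by norm_num)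
  -- The coefficients from here on are the certificates of a Gaussian elimination; relations already
  -- obtained serve as input for the later ones.
  have a21 : A₁ (.inl 2) (.inl 1) = 0 := by linear_combination e6.1 - e2.1 - e3.1 - e3.2.2
  have a41 : A₁ (.inl 4) (.inl 1) = 0 := by linear_combination e3.1
  have a43 : A₁ (.inl 4) (.inl 3) = 0 := by linear_combination -e3.2.2
  have a51 : A₁ (.inl 0) (.inl 1) = 0 := by linear_combination e4.2.1
  have a52 : A₁ (.inl 0) (.inl 2) = 0 := by linear_combination e4.2.2
  have a34 : A₁ (.inl 3) (.inl 4) = A₁ (.inl 1) (.inl 2) := by linear_combination (1 / 2) * e8.1 -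
    (1 / 2) * e9.1 + a52
  have a44 : A₁ (.inl 4) (.inl 4) = A₁ (.inl 2) (.inl 2) + A₁ (.inl 3) (.inl 3) - A₁ (.inl 1) (.inl
    1) := by linear_combination (1 / 2) * e10.1 - a34 - a21 - (1 / 2) * e11.1 + a43 - a51 + a52
  have a45 : A₁ (.inl 4) (.inl 0) = A₁ (.inl 2) (.inl 3) := by linear_combination e6.2.2 - e2.2.2 +
    a43
  have a55 : A₁ (.inl 0) (.inl 0) = 2 * A₁ (.inl 3) (.inl 3) - A₁ (.inl 1) (.inl 1) := by
    linear_combination (1 / 2) * e9.2.1 + (1 / 2) * e8.2.1 - e1.2.1 - a51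
  have u1 : A₁ (.inr 0) (.inl 1) = A₁ (.inl 2) (.inl 3) := by linear_combination e2.1
  have u2 : A₁ (.inr 0) (.inl 2) = A₁ (.inl 1) (.inl 3) + A₁ (.inl 2) (.inl 4) - A₁ (.inl 3) (.inl
    0) := by linear_combination u1 + e8.2.1 - e1.2.1 - a55 - e10.1 + a44 + a21 + e8.1 + a41 - e7.2.2
    - 2 * a43 + a52
  have u3 : A₁ (.inr 0) (.inl 3) = A₁ (.inl 2) (.inl 0) := by linear_combination -e2.2.2
  have v1 : A₁ (.inr 1) (.inl 1) = 2 * A₁ (.inl 1) (.inl 3) - A₁ (.inl 3) (.inl 0) := by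
    linear_combination e5.1 - u1 + u2 - e1.1
  have v2 : A₁ (.inr 1) (.inl 2) = A₁ (.inl 1) (.inl 4) := by linear_combination -e1.1
  have v3 : A₁ (.inr 1) (.inl 3) = A₀ (.inr 2) + A₁ (.inl 1) (.inl 0) := by
    linear_combination -e1.2.1
  have a3u : A₁ (.inl 3) (.inr 0) = 0 := by linear_combination -(1 / 2) * e18.2.1 + e14.1 - u2 - v2
    - e16.1 - a34 + (1 / 2) * e17.2.1 - e8.2.1 + v1 - v3 + a55 + a51 + a52
  have a4u : A₁ (.inl 4) (.inr 0) = 0 := by linear_combination e12.1 - a41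
  have a5u : A₁ (.inl 0) (.inr 0) = 0 := by linear_combination e13.2.1 - a51
  have uu : A₁ (.inr 0) (.inr 0) = A₁ (.inl 1) (.inl 1) + A₁ (.inl 2) (.inl 2) - A₁ (.inl 3) (.inl
    3) := by linear_combination 2 * e14.1 - u1 - e16.1 - a34 + e17.2.1 - u2 - v2 - a3u - e8.2.1 + v1
    - a5u + a52
  have vu : A₁ (.inr 1) (.inr 0) = A₁ (.inl 1) (.inl 2) := by linear_combination u2 - v1 + v2 +
    e16.1 - e14.1 + a34
  have a1u : A₁ (.inl 1) (.inr 0) = 0 := by linear_combination v2 + e19.1 + vu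
  have a2u : A₁ (.inl 2) (.inr 0) = 0 := by linear_combination -(1 / 3) * e15.1 + uu - (1 / 3) * u1
    + (1 / 3) * u2 + vu - (1 / 3) * v1 + (1 / 3) * v2 + a44 + a21 + a4u + (1 / 3) * a41 - a43 + (2 /
    3) * e20.1 - (2 / 3) * a1u
  have a31 : A₁ (.inl 3) (.inl 1) = 0 := by linear_combination e8.2.1 + v3 - a55 - a51 - e15.1 + uu
    + u1 - u2 + vu - v2 + a44 + a2u + a21 + a4u + a41 - 2 * e7.2.2 - 3 * a43 + 2 * a52
  have a32 : A₁ (.inl 3) (.inl 2) = 0 := by linear_combination e14.1 - uu - u1 + a1u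
  have a42 : A₁ (.inl 4) (.inl 2) = 0 := by linear_combination e7.2.2 + a43 - a52 - (1 / 2) * e8.2.1
    + (1 / 2) * v1 - (1 / 2) * v3 + (1 / 2) * a55 + (1 / 2) * a31 + (1 / 2) * a51
  have a53 : A₁ (.inl 0) (.inl 3) = 0 := by linear_combination -e7.2.2 + a42 - a43 + a52
  have a54 : A₁ (.inl 0) (.inl 4) = 0 := by linear_combination e8.1 + v2 - a34 + a32 + a52
  have a1v : A₁ (.inl 1) (.inr 1) = 0 := by linear_combination (1 / 2) * e24.2.1 + v3 + (1 / 2) *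
    e27.2.1 - a55 - e23.2.1 + 3 * a53
  have a2v : A₁ (.inl 2) (.inr 1) = 0 := by linear_combination e25.1 - e21.1 - a21 + a43
  have a3v : A₁ (.inl 3) (.inr 1) = 0 := by linear_combination -e26.1 + e21.1 - u2 - e24.2.1 - v2 -
    v3 + a1v + a44 + a2v + a21 - a31 - a42 - a43
  have a4v : A₁ (.inl 4) (.inr 1) = 0 := by linear_combination e22.1 - a41
  have a5v : A₁ (.inl 0) (.inr 1) = 0 := by linear_combination e23.2.1 - a51
  have uv : A₁ (.inr 0) (.inr 1) = 0 := by linear_combination e21.1 - u1 + a2v + a21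
  have vv : A₁ (.inr 1) (.inr 1) = 2 * A₁ (.inl 1) (.inl 1) - A₁ (.inl 3) (.inl 3) := by
    linear_combination -e24.2.1 - v1 - v3 + 2 * a1v - a3v - a31
  have a1w : A₁ (.inl 1) (.inr 2) = 0 := by linear_combination e28.2.1 + v3
  have a2w : A₁ (.inl 2) (.inr 2) = 0 := by linear_combination e29.2.2 + u3
  have a3w : A₁ (.inl 3) (.inr 2) = 0 := by linear_combination (1 / 2) * e31.2.1 - v1 - a31 - (1 /
    2) * e32.2.1 + 2 * a53
  have a4w : A₁ (.inl 4) (.inr 2) = 0 := by linear_combination e30.2.2 + u3 - a2w - a45 + a43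
  have a5w : A₁ (.inl 0) (.inr 2) = 0 := by linear_combination e31.2.1 - v1 + v3 - a1w - a55 - a3w -
    a31 - a51 + 2 * a53
  exact ⟨fun k β => by fin_cases k <;> fin_cases β <;> assumption, a21, a31, a32, a41, a42, a43,
    a51, a52, a53, a54, a34, a44, a45, a55, u1, u2, u3, uu, uv, v1, v2, by simpa only [zero_mul,
    sub_zero, add_zero] using v3, vu, vv⟩

/-- The linear relations between the first derivatives `A` of the components of a symmetry of the system `alttriple`.
The value of `w` is `t`, and that of the `w`-component is `W`. -/
structure AltTripleRelations {R : Type*} [CommRing R] (t W : R) (A : Coord 5 3 → Coord 5 3 → R) : Prop where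
  base : ∀ k β, A (.inl k) (.inr β) = 0
  a13 : A (.inl 1) (.inl 3) = 0
  a14 : A (.inl 1) (.inl 4) = 0
  a15 : A (.inl 1) (.inl 0) = 0
  a23 : A (.inl 2) (.inl 3) = 0
  a24 : A (.inl 2) (.inl 4) = 0
  a25 : A (.inl 2) (.inl 0) = 0
  a31 : A (.inl 3) (.inl 1) = 0
  a32 : A (.inl 3) (.inl 2) = 0
  a34 : A (.inl 3) (.inl 4) = 0
  a41 : A (.inl 4) (.inl 1) = 0
  a42 : A (.inl 4) (.inl 2) = 0
  a51 : A (.inl 0) (.inl 1) = 0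
  a52 : A (.inl 0) (.inl 2) = 0
  a53 : A (.inl 0) (.inl 3) = 0
  a54 : A (.inl 0) (.inl 4) = 0
  u1 : A (.inr 0) (.inl 1) = 0
  u2 : A (.inr 0) (.inl 2) = 0
  u4 : A (.inr 0) (.inl 4) = A (.inl 3) (.inl 0)
  uu : A (.inr 0) (.inr 0) = A (.inl 3) (.inl 3) + A (.inl 4) (.inl 4) - A (.inl 0) (.inl 0)
  uv : A (.inr 0) (.inr 1) = 0
  uw : A (.inr 0) (.inr 2) = 0
  v1 : A (.inr 1) (.inl 1) = 0
  v2 : A (.inr 1) (.inl 2) = 0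
  v4 : A (.inr 1) (.inl 4) = -W + A (.inl 4) (.inl 0) + t * (A (.inl 4) (.inl 4) - A (.inl 0) (.inl
    0))
  vu : A (.inr 1) (.inr 0) = A (.inl 4) (.inl 3)
  vv : A (.inr 1) (.inr 1) = 2 * A (.inl 4) (.inl 4) - A (.inl 0) (.inl 0)
  vw : A (.inr 1) (.inr 2) = 0

set_option maxHeartbeats 4000000 in
-- At the zero 1-jet the symbols degenerate to 0, −ξ₁ξ₅ and −ξ₂ξ₅, so `R₁` contributes through the
-- linearised coefficients alone. The 1-jets with u₁ = 1 or v₁ = 1 bring its symbol into play. The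
-- slope w₁ = 1 is compatible with zero second derivatives here, and makes the derivatives in w of
-- the u- and v-components visible already at first order.
theorem alttriple_relations {x A₀ : Coord 5 3 → 𝕜} {A₁ A₂} (hx : x (.inr 2) = 0) (h : IsJetSymmetry
    (alttriple 𝕜 5) x A₀ A₁ A₂) : AltTripleRelations 0 (A₀ (.inr 2)) A₁ := by
  have hF0 : ∀ F ∈ alttriple 𝕜 5, F (jet x (0) 0) = 0 := by
    simp [alttriple, R₁, R₂, R₃, jet_d2, u_jet, v_jet, w_jet, w₀_jet, hx, ofNat_self]
  have N0 := fun ξ₁ ξ₂ ξ₃ ξ₄ ξ₅ => alttriple_null h (fun _ _ _ => rfl) hF0 ![ξ₅, ξ₁, ξ₂, ξ₃, ξ₄]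
  have hF1 : ∀ F ∈ alttriple 𝕜 5, F (jet x (unit 0 1) 0) = 0 := by
    simp [alttriple, R₁, R₂, R₃, jet_d2, u_jet, v_jet, w_jet, w₀_jet, hx, unit, ofNat_self]
  have N1 := fun ξ₁ ξ₂ ξ₃ ξ₄ ξ₅ => alttriple_null h (fun _ _ _ => rfl) hF1 ![ξ₅, ξ₁, ξ₂, ξ₃, ξ₄]
  have hF2 : ∀ F ∈ alttriple 𝕜 5, F (jet x (unit 0 0) 0) = 0 := by
    simp [alttriple, R₁, R₂, R₃, jet_d2, u_jet, v_jet, w_jet, w₀_jet, hx, unit, ofNat_self]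
  have N2 := fun ξ₁ ξ₂ ξ₃ ξ₄ ξ₅ => alttriple_null h (fun _ _ _ => rfl) hF2 ![ξ₅, ξ₁, ξ₂, ξ₃, ξ₄]
  have hF3 : ∀ F ∈ alttriple 𝕜 5, F (jet x (unit 1 1) 0) = 0 := by
    simp [alttriple, R₁, R₂, R₃, jet_d2, u_jet, v_jet, w_jet, w₀_jet, hx, unit, ofNat_self]
  have N3 := fun ξ₁ ξ₂ ξ₃ ξ₄ ξ₅ => alttriple_null h (fun _ _ _ => rfl) hF3 ![ξ₅, ξ₁, ξ₂, ξ₃, ξ₄]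
  have hF4 : ∀ F ∈ alttriple 𝕜 5, F (jet x (unit 1 4) 0) = 0 := by
    simp [alttriple, R₁, R₂, R₃, jet_d2, u_jet, v_jet, w_jet, w₀_jet, hx, unit, ofNat_self]
  have N4 := fun ξ₁ ξ₂ ξ₃ ξ₄ ξ₅ => alttriple_null h (fun _ _ _ => rfl) hF4 ![ξ₅, ξ₁, ξ₂, ξ₃, ξ₄]
  have hF5 : ∀ F ∈ alttriple 𝕜 5, F (jet x (unit 2 1) 0) = 0 := by
    simp [alttriple, R₁, R₂, R₃, jet_d2, u_jet, v_jet, w_jet, w₀_jet, hx, unit, ofNat_self]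
  have N5 := fun ξ₁ ξ₂ ξ₃ ξ₄ ξ₅ => alttriple_null h (fun _ _ _ => rfl) hF5 ![ξ₅, ξ₁, ξ₂, ξ₃, ξ₄]
  have hF6 : ∀ F ∈ alttriple 𝕜 5, F (jet x (unit 2 0) 0) = 0 := by
    simp [alttriple, R₁, R₂, R₃, jet_d2, u_jet, v_jet, w_jet, w₀_jet, hx, unit, ofNat_self]
  have N6 := fun ξ₁ ξ₂ ξ₃ ξ₄ ξ₅ => alttriple_null h (fun _ _ _ => rfl) hF6 ![ξ₅, ξ₁, ξ₂, ξ₃, ξ₄]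
  simp only [R₁, R₂, R₃, dR₁, dR₂, dR₃, u, v, w₀, sqJet, sqJetVar, jet_d1, jet_d2, jet_val,
    contract, hx, Fin.sum_univ_five, Matrix.cons_val, total_zero, prolong₁_zero, Fin.reduceEq,
    Fin.isValue, if_true, if_false, and_self, Pi.zero_apply, zero_mul, mul_zero, add_zero, zero_add,
    sub_zero, zero_sub, neg_zero, mul_one, one_mul, sub_self, ofNat_self] at N0
  simp only [R₁, R₂, R₃, dR₁, dR₂, dR₃, u, v, w₀, sqJet, sqJetVar, jet_d1, jet_d2, jet_val,
    contract, hx, Fin.sum_univ_five, Matrix.cons_val, total_unit, prolong₁_unit, unit, Fin.reduceEq,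
    Fin.isValue, if_true, if_false, and_self, Pi.zero_apply, zero_mul, mul_zero, add_zero, zero_add,
    sub_zero, zero_sub, neg_zero, mul_one, one_mul, sub_self, ofNat_self] at N1 N2 N3 N4 N5 N6
  have e1 := N0 1 0 0 0 0 (by norm_num)
  have e2 := N0 0 1 0 0 0 (by norm_num)
  have e3 := N0 0 0 0 1 0 (by norm_num)
  have e4 := N0 0 0 0 0 1 (by norm_num)
  have e5 := N0 1 0 1 0 0 (by norm_num)
  have e6 := N0 1 0 0 1 0 (by norm_num)
  have e7 := N0 0 1 1 0 0 (by norm_num)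
  have e8 := N0 0 0 1 0 1 (by norm_num)
  have e9 := N0 0 0 0 1 1 (by norm_num)
  have e10 := N1 0 1 0 0 0 (by norm_num)
  have e11 := N1 0 0 1 0 0 (by norm_num)
  have e12 := N1 0 0 0 1 0 (by norm_num)
  have e13 := N1 0 0 0 0 1 (by norm_num)
  have e14 := N1 1 1 0 0 0 (by norm_num)
  have e15 := N1 0 0 1 0 1 (by norm_num)
  have e16 := N1 0 0 0 1 1 (by norm_num)
  have e17 := N1 1 0 1 1 1 (by norm_num)
  have e18 := N2 1 0 0 0 0 (by norm_num)
  have e19 := N2 0 1 0 0 0 (by norm_num)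
  have e20 := N2 1 0 1 0 0 (by norm_num)
  have e21 := N2 1 0 0 1 0 (by norm_num)
  have e22 := N3 0 1 0 0 0 (by norm_num)
  have e23 := N3 0 0 0 0 1 (by norm_num)
  have e24 := N3 1 1 0 0 0 (by norm_num)
  have e25 := N3 0 1 1 0 0 (by norm_num)
  have e26 := N3 0 0 1 0 1 (by norm_num)
  have e27 := N3 1 0 0 1 1 (by norm_num)
  have e28 := N3 1 0 0 (-1) 1 (by norm_num)
  have e29 := N4 1 0 0 0 0 (by norm_num)
  have e30 := N4 0 1 0 0 0 (by norm_num)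
  have e31 := N5 0 0 0 1 0 (by norm_num)
  have e32 := N5 0 0 0 0 1 (by norm_num)
  have e33 := N5 0 1 1 0 0 (by norm_num)
  have e34 := N5 0 0 1 0 1 (by norm_num)
  have e35 := N5 0 0 0 1 1 (by norm_num)
  have e36 := N6 1 0 0 0 0 (by norm_num)
  have e37 := N6 0 1 0 0 0 (by norm_num)
  have a15 : A₁ (.inl 1) (.inl 0) = 0 := by linear_combination e1.2.1
  have a25 : A₁ (.inl 2) (.inl 0) = 0 := by linear_combination e2.2.2
  have a31 : A₁ (.inl 3) (.inl 1) = 0 := by linear_combination e8.2.1 - e4.2.1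
  have a32 : A₁ (.inl 3) (.inl 2) = 0 := by linear_combination e8.2.2 - e4.2.2
  have a41 : A₁ (.inl 4) (.inl 1) = 0 := by linear_combination e9.2.1 - e3.2.1 - e4.2.1
  have a42 : A₁ (.inl 4) (.inl 2) = 0 := by linear_combination e9.2.2 - e3.2.2 - e4.2.2
  have a51 : A₁ (.inl 0) (.inl 1) = 0 := by linear_combination e4.2.1
  have a52 : A₁ (.inl 0) (.inl 2) = 0 := by linear_combination e4.2.2
  have u1 : A₁ (.inr 0) (.inl 1) = 0 := by linear_combination e7.1
  have u2 : A₁ (.inr 0) (.inl 2) = 0 := by linear_combination -e5.1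
  have u4 : A₁ (.inr 0) (.inl 4) = A₁ (.inl 3) (.inl 0) := by linear_combination -e5.2.1 + a15
  have v1 : A₁ (.inr 1) (.inl 1) = 0 := by linear_combination e3.2.1
  have v2 : A₁ (.inr 1) (.inl 2) = 0 := by linear_combination e3.2.2
  have v4 : A₁ (.inr 1) (.inl 4) = -A₀ (.inr 2) + A₁ (.inl 4) (.inl 0) := by
    linear_combination -e6.2.1 + v1 + a15
  have a5u : A₁ (.inl 0) (.inr 0) = 0 := by linear_combination e13.2.1 - a51
  have a13 : A₁ (.inl 1) (.inl 3) = 0 := by linear_combination -e14.1 + e10.1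
  have a23 : A₁ (.inl 2) (.inl 3) = 0 := by linear_combination -e10.1
  have a34 : A₁ (.inl 3) (.inl 4) = 0 := by linear_combination -e11.2.1
  have uu : A₁ (.inr 0) (.inr 0) = A₁ (.inl 3) (.inl 3) + A₁ (.inl 4) (.inl 4) - A₁ (.inl 0) (.inl
    0) := by linear_combination e17.2.1 - u1 + u4 + v4 + a13 - a15 - e15.2.1 - e16.2.1 + a5u + a51
  have vu : A₁ (.inr 1) (.inr 0) = A₁ (.inl 4) (.inl 3) := by linear_combination e12.2.1 - v1
  have a1u : A₁ (.inl 1) (.inr 0) = 0 := by linear_combination e18.2.1 - a15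
  have a2u : A₁ (.inl 2) (.inr 0) = 0 := by linear_combination e19.2.2 - a25
  have a3u : A₁ (.inl 3) (.inr 0) = 0 := by linear_combination (1 / 2) * e15.2.1 - (1 / 2) * a31 +
    (1 / 2) * a34 - (1 / 2) * a5u - (1 / 2) * a51 + (1 / 2) * e20.2.1 + (1 / 2) * u4 - (1 / 2) * a1u
    - (1 / 2) * a15
  have a4u : A₁ (.inl 4) (.inr 0) = 0 := by linear_combination -v1 + e21.2.1 + v4 - a1u - a15
  have a53 : A₁ (.inl 0) (.inl 3) = 0 := by linear_combination -e16.2.1 + vu + v1 + a4u + a41 + a5u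
    + a51
  have a54 : A₁ (.inl 0) (.inl 4) = 0 := by linear_combination -e15.2.1 + a3u + a31 - a34 + a5u +
    a51
  have a3v : A₁ (.inl 3) (.inr 1) = 0 := by linear_combination e26.2.1 - a31 - e23.2.1
  have a4v : A₁ (.inl 4) (.inr 1) = 0 := by linear_combination -(1 / 2) * e28.2.1 + (1 / 2) *
    e27.2.1 + v4 - e24.1 + e22.1 - a41 + 2 * a54
  have a5v : A₁ (.inl 0) (.inr 1) = 0 := by linear_combination e23.2.1 - a51
  have a14 : A₁ (.inl 1) (.inl 4) = 0 := by linear_combination -e24.1 + e22.1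
  have a24 : A₁ (.inl 2) (.inl 4) = 0 := by linear_combination -e22.1
  have uv : A₁ (.inr 0) (.inr 1) = 0 := by linear_combination e25.1 - u1 + a24 + a34
  have vv : A₁ (.inr 1) (.inr 1) = 2 * A₁ (.inl 4) (.inl 4) - A₁ (.inl 0) (.inl 0) := by
    linear_combination e27.2.1 - v1 + v4 + a14 - a15 - a4v - a41 - a5v - a51 + 2 * a54
  have a1v : A₁ (.inl 1) (.inr 1) = 0 := by linear_combination e29.2.1 - a14 - a15
  have a2v : A₁ (.inl 2) (.inr 1) = 0 := by linear_combination e30.2.2 - a24 - a25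
  have a3w : A₁ (.inl 3) (.inr 2) = 0 := by linear_combination e34.2.1 - a31 - e32.2.1
  have a4w : A₁ (.inl 4) (.inr 2) = 0 := by linear_combination e35.2.1 - e31.2.1 - a41 - e32.2.1
  have a5w : A₁ (.inl 0) (.inr 2) = 0 := by linear_combination e32.2.1 - a51
  have uw : A₁ (.inr 0) (.inr 2) = 0 := by linear_combination e33.1 - u1
  have vw : A₁ (.inr 1) (.inr 2) = 0 := by linear_combination e31.2.1 - v1
  have a1w : A₁ (.inl 1) (.inr 2) = 0 := by linear_combination e36.2.1 - a15
  have a2w : A₁ (.inl 2) (.inr 2) = 0 := by linear_combination e37.2.2 - a25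
  exact ⟨fun k β => by fin_cases k <;> fin_cases β <;> assumption, a13, a14, a15, a23, a24, a25,
    a31, a32, a34, a41, a42, a51, a52, a53, a54, u1, u2, u4, uu, uv, uw, v1, v2, by simpa only
    [zero_mul, sub_zero, add_zero] using v4, vu, vv, vw⟩

/-- The linear relations between the first derivatives `A` of the components of a symmetry of the system `triple ++ triple1`.
The value of `w` is `t`, and that of the `w`-component is `W`. -/
structure FullRelations {R : Type*} [CommRing R] (t W : R) (A : Coord 6 3 → Coord 6 3 → R) : Prop where
  base : ∀ k β, A (.inl k) (.inr β) = 0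
  a31 : A (.inl 3) (.inl 1) = 0
  a32 : A (.inl 3) (.inl 2) = 0
  a41 : A (.inl 4) (.inl 1) = 0
  a42 : A (.inl 4) (.inl 2) = 0
  a34 : A (.inl 3) (.inl 4) = A (.inl 1) (.inl 2)
  a36 : A (.inl 3) (.inl 0) = A (.inl 1) (.inl 4)
  a43 : A (.inl 4) (.inl 3) = A (.inl 2) (.inl 1)
  a44 : A (.inl 4) (.inl 4) = -A (.inl 1) (.inl 1) + A (.inl 2) (.inl 2) + A (.inl 3) (.inl 3)
  a45 : A (.inl 4) (.inl 5) = A (.inl 2) (.inl 3)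
  a46 : A (.inl 4) (.inl 0) = -A (.inl 1) (.inl 3) + A (.inl 2) (.inl 4) + A (.inl 3) (.inl 5)
  a51 : A (.inl 5) (.inl 1) = 0
  a52 : A (.inl 5) (.inl 2) = 0
  a53 : A (.inl 5) (.inl 3) = 0
  a54 : A (.inl 5) (.inl 4) = 0
  a61 : A (.inl 0) (.inl 1) = 0
  a62 : A (.inl 0) (.inl 2) = 0
  a63 : A (.inl 0) (.inl 3) = 0
  a64 : A (.inl 0) (.inl 4) = 0
  a55 : A (.inl 5) (.inl 5) = 2 * A (.inl 3) (.inl 3) - A (.inl 1) (.inl 1)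
  a56 : A (.inl 5) (.inl 0) = A (.inl 1) (.inl 2)
  a65 : A (.inl 0) (.inl 5) = A (.inl 2) (.inl 1)
  a66 : A (.inl 0) (.inl 0) = -2 * A (.inl 1) (.inl 1) + A (.inl 2) (.inl 2) + 2 * A (.inl 3) (.inl
    3)
  u1 : A (.inr 0) (.inl 1) = A (.inl 2) (.inl 3)
  u2 : A (.inr 0) (.inl 2) = A (.inl 1) (.inl 3) + A (.inl 2) (.inl 4) - A (.inl 3) (.inl 5)
  u3 : A (.inr 0) (.inl 3) = A (.inl 2) (.inl 5)
  u4 : A (.inr 0) (.inl 4) = W + A (.inl 2) (.inl 0) - t * (2 * A (.inl 1) (.inl 1) - 2 * A (.inl 3)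
    (.inl 3))
  uu : A (.inr 0) (.inr 0) = A (.inl 1) (.inl 1) + A (.inl 2) (.inl 2) - A (.inl 3) (.inl 3)
  uv : A (.inr 0) (.inr 1) = A (.inl 2) (.inl 1)
  v1 : A (.inr 1) (.inl 1) = 2 * A (.inl 1) (.inl 3) - A (.inl 3) (.inl 5)
  v2 : A (.inr 1) (.inl 2) = A (.inl 1) (.inl 4)
  v3 : A (.inr 1) (.inl 3) = W + A (.inl 1) (.inl 5) - t * (2 * A (.inl 1) (.inl 1) - 2 * A (.inl 3)
    (.inl 3))
  v4 : A (.inr 1) (.inl 4) = A (.inl 1) (.inl 0)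
  vu : A (.inr 1) (.inr 0) = A (.inl 1) (.inl 2)
  vv : A (.inr 1) (.inr 1) = 2 * A (.inl 1) (.inl 1) - A (.inl 3) (.inl 3)

set_option maxHeartbeats 4000000 in
-- The null covectors at the zero 1-jet are now (a, b, aλ, bλ, aλ², bλ²) and their limits: the six
-- symbols are the 2 × 2 minors of the matrix with rows (ξ₁, ξ₃, ξ₂, ξ₄) and (ξ₃, ξ₅, ξ₄, ξ₆). The
-- additional equations also determine derivatives such as ∂₄ of the u-component that (triple)
-- leaves free.
theorem full_relations {x A₀ : Coord 6 3 → 𝕜} {A₁ A₂} (hx : x (.inr 2) = 0) (h : IsJetSymmetry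
    (triple 𝕜 6 ++ triple1 𝕜 6) x A₀ A₁ A₂) : FullRelations 0 (A₀ (.inr 2)) A₁ := by
  have hF0 : ∀ F ∈ triple 𝕜 6 ++ triple1 𝕜 6, F (jet x (0) 0) = 0 := by
    simp [triple, triple1, Q₁, Q₂, Q₃, Q₄, Q₅, Q₆, jet_d2, u_jet, v_jet, w_jet, w₀_jet, hx, ofNat_self]
  have N0 := fun ξ₁ ξ₂ ξ₃ ξ₄ ξ₅ ξ₆ => full_null h (fun _ _ _ => rfl) hF0 ![ξ₆, ξ₁, ξ₂, ξ₃, ξ₄, ξ₅]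
  have hF1 : ∀ F ∈ triple 𝕜 6 ++ triple1 𝕜 6, F (jet x (unit 0 1) 0) = 0 := by
    simp [triple, triple1, Q₁, Q₂, Q₃, Q₄, Q₅, Q₆, jet_d2, u_jet, v_jet, w_jet, w₀_jet, hx, unit, ofNat_self]
  have N1 := fun ξ₁ ξ₂ ξ₃ ξ₄ ξ₅ ξ₆ => full_null h (fun _ _ _ => rfl) hF1 ![ξ₆, ξ₁, ξ₂, ξ₃, ξ₄, ξ₅]
  have hF2 : ∀ F ∈ triple 𝕜 6 ++ triple1 𝕜 6, F (jet x (unit 0 2) 0) = 0 := by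
    simp [triple, triple1, Q₁, Q₂, Q₃, Q₄, Q₅, Q₆, jet_d2, u_jet, v_jet, w_jet, w₀_jet, hx, unit, ofNat_self]
  have N2 := fun ξ₁ ξ₂ ξ₃ ξ₄ ξ₅ ξ₆ => full_null h (fun _ _ _ => rfl) hF2 ![ξ₆, ξ₁, ξ₂, ξ₃, ξ₄, ξ₅]
  have hF3 : ∀ F ∈ triple 𝕜 6 ++ triple1 𝕜 6, F (jet x (unit 1 1) 0) = 0 := by
    simp [triple, triple1, Q₁, Q₂, Q₃, Q₄, Q₅, Q₆, jet_d2, u_jet, v_jet, w_jet, w₀_jet, hx, unit, ofNat_self]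
  have N3 := fun ξ₁ ξ₂ ξ₃ ξ₄ ξ₅ ξ₆ => full_null h (fun _ _ _ => rfl) hF3 ![ξ₆, ξ₁, ξ₂, ξ₃, ξ₄, ξ₅]
  -- With w₅ = 1 the equation `Q₆ J 0 = w J 5 + …` requires u₄₅ − u₃₆ = 1, which is achieved by u₃₆
  -- = −1.
  have hF4 : ∀ F ∈ triple 𝕜 6 ++ triple1 𝕜 6, F (jet x (unit 2 5) (unit₂ 0 3 0 (-1))) = 0 := by
    simp [triple, triple1, Q₁, Q₂, Q₃, Q₄, Q₅, Q₆, jet_d2, u_jet, v_jet, w_jet, w₀_jet, hx, unit, unit₂, ofNat_self]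
  have N4 := fun ξ₁ ξ₂ ξ₃ ξ₄ ξ₅ ξ₆ => full_null h (unit₂_symm (by decide) _) hF4 ![ξ₆, ξ₁, ξ₂, ξ₃,
    ξ₄, ξ₅]
  simp only [Q₁, Q₂, Q₃, Q₄, Q₅, Q₆, dQ₁, dQ₂, dQ₃, dQ₄, dQ₅, dQ₆, u, v, w₀, sqJet, sqJetVar,
    jet_d1, jet_d2, jet_val, contract, hx, Fin.sum_univ_six, Matrix.cons_val, total_zero,
    prolong₁_zero, Fin.reduceEq, Fin.isValue, if_true, if_false, and_self, Pi.zero_apply, zero_mul,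
    mul_zero, add_zero, zero_add, sub_zero, zero_sub, neg_zero, mul_one, one_mul, sub_self,
    ofNat_self] at N0
  simp only [Q₁, Q₂, Q₃, Q₄, Q₅, Q₆, dQ₁, dQ₂, dQ₃, dQ₄, dQ₅, dQ₆, u, v, w₀, sqJet, sqJetVar,
    jet_d1, jet_d2, jet_val, contract, hx, Fin.sum_univ_six, Matrix.cons_val, total_unit,
    prolong₁_unit, unit, Fin.reduceEq, Fin.isValue, if_true, if_false, and_self, Pi.zero_apply,
    zero_mul, mul_zero, add_zero, zero_add, sub_zero, zero_sub, neg_zero, mul_one, one_mul,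
    sub_self, ofNat_self] at N1 N2 N3 N4
  have e1 := N0 1 0 0 0 0 0 (by norm_num)
  have e2 := N0 0 1 0 0 0 0 (by norm_num)
  have e3 := N0 0 0 0 0 1 0 (by norm_num)
  have e4 := N0 0 0 0 0 0 1 (by norm_num)
  have e5 := N0 1 1 0 0 0 0 (by norm_num)
  have e6 := N0 0 0 0 0 1 1 (by norm_num)
  have e7 := N0 1 0 1 0 1 0 (by norm_num)
  have e8 := N0 1 0 (-1) 0 1 0 (by norm_num)
  have e9 := N0 0 1 0 1 0 1 (by norm_num)
  have e10 := N0 0 1 0 (-1) 0 1 (by norm_num)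
  have e11 := N0 1 1 1 1 1 1 (by norm_num)
  have e12 := N0 1 1 (-1) (-1) 1 1 (by norm_num)
  have e13 := N1 0 0 0 0 1 0 (by norm_num)
  have e14 := N1 0 0 0 0 0 1 (by norm_num)
  have e15 := N1 0 1 (-1) 0 0 0 (by norm_num)
  have e16 := N1 1 1 (-1) 0 0 0 (by norm_num)
  have e17 := N1 1 0 1 0 1 0 (by norm_num)
  have e18 := N1 1 0 (-1) 0 1 0 (by norm_num)
  have e19 := N1 1 1 0 1 0 1 (by norm_num)
  have e20 := N1 1 (-1) 0 1 0 (-1) (by norm_num)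
  have e21 := N2 0 1 0 (-1) 0 0 (by norm_num)
  have e22 := N3 0 1 0 0 0 0 (by norm_num)
  have e23 := N3 0 0 0 0 1 0 (by norm_num)
  have e24 := N3 0 0 0 0 0 1 (by norm_num)
  have e25 := N3 1 0 (-1) 0 0 0 (by norm_num)
  have e26 := N3 0 1 0 1 0 1 (by norm_num)
  have e27 := N3 0 1 0 (-1) 0 1 (by norm_num)
  have e28 := N3 1 0 1 0 2 0 (by norm_num)
  have e29 := N3 1 1 0 1 0 1 (by norm_num)
  have e30 := N4 1 0 0 0 0 0 (by norm_num)
  have e31 := N4 0 1 0 0 0 0 (by norm_num)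
  have e32 := N4 1 0 1 0 1 0 (by norm_num)
  have e33 := N4 1 0 (-1) 0 1 0 (by norm_num)
  have e34 := N4 0 1 0 1 0 1 (by norm_num)
  have e35 := N4 0 1 0 (-1) 0 1 (by norm_num)
  have a32 : A₁ (.inl 3) (.inl 2) = 0 := by linear_combination -(1 / 2) * e8.1 + e1.1 - (1 / 2) *
    e7.1 - e3.2.2.2.2.2
  have a41 : A₁ (.inl 4) (.inl 1) = 0 := by linear_combination (1 / 2) * e10.1 - e2.1 + (1 / 2) *
    e9.1 + e4.2.2.2.2.2
  have a34 : A₁ (.inl 3) (.inl 4) = A₁ (.inl 1) (.inl 2) := by linear_combination e7.1 - e1.1 + a32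
    + e3.2.2.1 + e3.2.2.2.2.2
  have a36 : A₁ (.inl 3) (.inl 0) = A₁ (.inl 1) (.inl 4) := by linear_combination (1 / 2) *
    e7.2.2.2.1 - (1 / 2) * e8.2.2.2.1 - e3.2.2.2.2.2
  have a43 : A₁ (.inl 4) (.inl 3) = A₁ (.inl 2) (.inl 1) := by linear_combination -e9.1 + e2.1 + a41
    + e4.2.2.2.1 - e4.2.2.2.2.2
  have a44 : A₁ (.inl 4) (.inl 4) = -A₁ (.inl 1) (.inl 1) + A₁ (.inl 2) (.inl 2) + A₁ (.inl 3) (.inl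
    3) := by linear_combination -(1 / 2) * e12.1 - a34 + a43 + (1 / 2) * e11.1 - e3.2.1 + e3.2.2.1 -
    e4.2.2.2.1 + e4.2.2.2.2.1
  have a45 : A₁ (.inl 4) (.inl 5) = A₁ (.inl 2) (.inl 3) := by linear_combination (1 / 2) * e9.2.2.1
    - (1 / 2) * e10.2.2.1 + e4.2.2.2.2.2
  have a46 : A₁ (.inl 4) (.inl 0) = -A₁ (.inl 1) (.inl 3) + A₁ (.inl 2) (.inl 4) + A₁ (.inl 3) (.inl
    5) := by linear_combination (1 / 2) * e9.2.2.2.2.1 - e2.1 - (1 / 2) * e7.2.1 - e1.1 + e11.1 -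
    a34 + a43 + a32 - (1 / 2) * e10.2.2.2.2.1 + (1 / 2) * e8.2.1 - a44 - a41 - e3.2.1 + e3.2.2.1 -
    e6.2.2.2.2.2 + 2 * e3.2.2.2.2.2 - e4.2.2.2.1 + e4.2.2.2.2.1 + 2 * e4.2.2.2.2.2
  have a51 : A₁ (.inl 5) (.inl 1) = 0 := by linear_combination e3.2.1
  have a52 : A₁ (.inl 5) (.inl 2) = 0 := by linear_combination e3.2.2.1
  have a54 : A₁ (.inl 5) (.inl 4) = 0 := by linear_combination -e3.2.2.2.2.2
  have a61 : A₁ (.inl 0) (.inl 1) = 0 := by linear_combination e4.2.2.2.1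
  have a62 : A₁ (.inl 0) (.inl 2) = 0 := by linear_combination e4.2.2.2.2.1
  have a63 : A₁ (.inl 0) (.inl 3) = 0 := by linear_combination e4.2.2.2.2.2
  have a55 : A₁ (.inl 5) (.inl 5) = 2 * A₁ (.inl 3) (.inl 3) - A₁ (.inl 1) (.inl 1) := by
    linear_combination (1 / 2) * e8.2.1 + (1 / 2) * e7.2.1 - e1.2.1 - a51
  have a56 : A₁ (.inl 5) (.inl 0) = A₁ (.inl 1) (.inl 2) := by linear_combination a34 + e7.2.2.2.1 -
    e1.2.2.2.1 - a36 + a54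
  have a65 : A₁ (.inl 0) (.inl 5) = A₁ (.inl 2) (.inl 1) := by linear_combination a43 + e9.2.2.1 -
    e2.2.2.1 - a45 + a63
  have a66 : A₁ (.inl 0) (.inl 0) = -2 * A₁ (.inl 1) (.inl 1) + A₁ (.inl 2) (.inl 2) + 2 * A₁ (.inl
    3) (.inl 3) := by linear_combination 2 * a44 + (1 / 2) * e10.2.2.2.2.1 - e2.2.2.2.2.1 + (1 / 2)
    * e9.2.2.2.2.1 - a62
  have u1 : A₁ (.inr 0) (.inl 1) = A₁ (.inl 2) (.inl 3) := by linear_combination e2.1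
  have u3 : A₁ (.inr 0) (.inl 3) = A₁ (.inl 2) (.inl 5) := by linear_combination -e2.2.2.1
  have u4 : A₁ (.inr 0) (.inl 4) = A₀ (.inr 2) + A₁ (.inl 2) (.inl 0) := by
    linear_combination -e2.2.2.2.2.1
  have v2 : A₁ (.inr 1) (.inl 2) = A₁ (.inl 1) (.inl 4) := by linear_combination -e1.1
  have v3 : A₁ (.inr 1) (.inl 3) = A₀ (.inr 2) + A₁ (.inl 1) (.inl 5) := by
    linear_combination -e1.2.1
  have v4 : A₁ (.inr 1) (.inl 4) = A₁ (.inl 1) (.inl 0) := by linear_combination -e1.2.2.2.1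
  have a1u : A₁ (.inl 1) (.inr 0) = 0 := by linear_combination (1 / 2) * e17.2.1 + (1 / 2) * e18.2.1
    + v3 - a55 + a32 - e13.2.1
  have a3u : A₁ (.inl 3) (.inr 0) = 0 := by linear_combination e17.2.1 - e16.1 + e15.1 + e5.1 - u1 -
    e7.2.1 - a1u - a34 + a32 - e13.2.1 + a51 + a52
  have a4u : A₁ (.inl 4) (.inr 0) = 0 := by linear_combination (1 / 2) * e20.1 - e15.1 + v2 - a1u -
    a44 + (1 / 2) * e19.1 + a32 - a41 + 2 * a62 + a63
  have a5u : A₁ (.inl 5) (.inr 0) = 0 := by linear_combination e13.2.1 - a51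
  have a6u : A₁ (.inl 0) (.inr 0) = 0 := by linear_combination e14.2.2.2.1 - a61
  have u2 : A₁ (.inr 0) (.inl 2) = A₁ (.inl 1) (.inl 3) + A₁ (.inl 2) (.inl 4) - A₁ (.inl 3) (.inl
    5) := by linear_combination -e15.2.2.1 - u3 - a34
  have uu : A₁ (.inr 0) (.inr 0) = A₁ (.inl 1) (.inl 1) + A₁ (.inl 2) (.inl 2) - A₁ (.inl 3) (.inl
    3) := by linear_combination e15.1 - u1 + a1u - a32
  have v1 : A₁ (.inr 1) (.inl 1) = 2 * A₁ (.inl 1) (.inl 3) - A₁ (.inl 3) (.inl 5) := by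
    linear_combination e5.1 - u1 + u2 + v2
  have vu : A₁ (.inr 1) (.inr 0) = A₁ (.inl 1) (.inl 2) := by linear_combination e16.1 - uu - u1 +
    u2 - v1 + v2 + a1u + a34 - a32
  have a2u : A₁ (.inl 2) (.inr 0) = 0 := by linear_combination -(1 / 2) * e19.1 + (5 / 4) * uu + (1
    / 2) * u1 + (1 / 2) * u2 + (1 / 2) * vu + (1 / 2) * v1 - (1 / 2) * v2 + (3 / 4) * a44 - (1 / 2)
    * a43 + (5 / 4) * a4u + (1 / 2) * a41 - (1 / 4) * e9.2.2.2.2.1 + (1 / 2) * u4 + a46 + (1 / 4) *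
    a66 + (1 / 2) * a6u + (1 / 2) * a61 - (1 / 2) * a63 + (3 / 4) * e21.2.2.2.2.1 - (3 / 4) * a62
  have a31 : A₁ (.inl 3) (.inl 1) = 0 := by linear_combination e7.2.1 - (1 / 3) * v1 + v3 - a55 -
    a51 + 2 * e6.2.2.2.2.2 + 2 * a54 - (8 / 3) * a63 - (2 / 3) * e19.1 + (2 / 3) * uu + (2 / 3) * u1
    + (2 / 3) * u2 + (2 / 3) * vu - (2 / 3) * v2 - 2 * a44 + (2 / 3) * a2u - (2 / 3) * a43 + (2 / 3)
    * a4u + (2 / 3) * a41 - (4 / 3) * e9.2.2.2.2.1 - (4 / 3) * u4 + (4 / 3) * a46 + (4 / 3) * a66 +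
    (2 / 3) * a6u + (2 / 3) * a61
  have a42 : A₁ (.inl 4) (.inl 2) = 0 := by linear_combination e9.2.2.2.2.1 - u2 + u4 - a46 + 2 *
    a44 - a66 - a62 - e7.2.1 + v1 - v3 + a55 + a31 + a51 - 2 * e6.2.2.2.2.2 - 2 * a54 + 2 * a63
  have a53 : A₁ (.inl 5) (.inl 3) = 0 := by linear_combination -(1 / 2) * e7.2.1 + (1 / 2) * v1 - (1
    / 2) * v3 + (1 / 2) * a55 + (1 / 2) * a31 + (1 / 2) * a51
  have a64 : A₁ (.inl 0) (.inl 4) = 0 := by linear_combination -e6.2.2.2.2.2 + a53 - a54 + a63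
  have a1v : A₁ (.inl 1) (.inr 1) = 0 := by linear_combination (1 / 2) * e28.2.1 + (1 / 2) * e25.2.1
    + v3 - a55 - e23.2.1 + 3 * a53
  have a2v : A₁ (.inl 2) (.inr 1) = 0 := by linear_combination e26.1 - e22.1 + a43 + a63
  have a3v : A₁ (.inl 3) (.inr 1) = 0 := by linear_combination -e29.1 + e22.1 - u2 - e25.2.1 - v2 -
    v3 + a1v + a44 + a2v - a43 - a31 - a42 - a62 - a63 + a64
  have a4v : A₁ (.inl 4) (.inr 1) = 0 := by linear_combination (1 / 2) * e27.1 - (1 / 2) * e22.1 +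
    (1 / 2) * a2v - (1 / 2) * a43 - a41 + e24.2.2.2.1 + (1 / 2) * a63
  have a5v : A₁ (.inl 5) (.inr 1) = 0 := by linear_combination e23.2.1 - a51
  have a6v : A₁ (.inl 0) (.inr 1) = 0 := by linear_combination e24.2.2.2.1 - a61
  have uv : A₁ (.inr 0) (.inr 1) = A₁ (.inl 2) (.inl 1) := by linear_combination e22.1 - u1 + a2v
  have vv : A₁ (.inr 1) (.inr 1) = 2 * A₁ (.inl 1) (.inl 1) - A₁ (.inl 3) (.inl 3) := by
    linear_combination -e25.2.1 - v1 - v3 + 2 * a1v - a3v - a31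
  have a1w : A₁ (.inl 1) (.inr 2) = 0 := by linear_combination e30.2.1 + v3
  have a2w : A₁ (.inl 2) (.inr 2) = 0 := by linear_combination e31.2.2.1 + u3
  have a3w : A₁ (.inl 3) (.inr 2) = 0 := by linear_combination (1 / 2) * e32.2.1 - v1 - a31 - (1 /
    2) * e33.2.1 + 2 * a53
  have a4w : A₁ (.inl 4) (.inr 2) = 0 := by linear_combination (1 / 2) * e34.2.2.1 - a45 - (1 / 2) *
    e35.2.2.1 + a63
  have a5w : A₁ (.inl 5) (.inr 2) = 0 := by linear_combination e32.2.1 - v1 + v3 - a1w - a55 - a3w -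
    a31 - a51 + 2 * a53
  have a6w : A₁ (.inl 0) (.inr 2) = 0 := by linear_combination e34.2.2.1 + u3 - a2w - a45 - a4w -
    a65 + a43 + a63
  exact ⟨fun k β => by fin_cases k <;> fin_cases β <;> assumption, a31, a32, a41, a42, a34, a36,
    a43, a44, a45, a46, a51, a52, a53, a54, a61, a62, a63, a64, a55, a56, a65, a66, u1, u2, u3, by
    simpa only [zero_mul, sub_zero, add_zero] using u4, uu, uv, v1, v2, by simpa only [zero_mul,
    sub_zero, add_zero] using v3, v4, vu, vv⟩

/-- The linear relations between the first derivatives `A` of the components of a symmetry of the system `alttriple ++ triple2`.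
The value of `w` is `t`, and that of the `w`-component is `W`. -/
structure AltFullRelations {R : Type*} [CommRing R] (t W : R) (A : Coord 6 3 → Coord 6 3 → R) : Prop where
  base : ∀ k β, A (.inl k) (.inr β) = 0
  a13 : A (.inl 1) (.inl 3) = 0
  a14 : A (.inl 1) (.inl 4) = 0
  a15 : A (.inl 1) (.inl 5) = 0
  a16 : A (.inl 1) (.inl 0) = 0
  a23 : A (.inl 2) (.inl 3) = 0
  a24 : A (.inl 2) (.inl 4) = 0
  a25 : A (.inl 2) (.inl 5) = 0
  a26 : A (.inl 2) (.inl 0) = 0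
  a31 : A (.inl 3) (.inl 1) = 0
  a32 : A (.inl 3) (.inl 2) = 0
  a41 : A (.inl 4) (.inl 1) = 0
  a42 : A (.inl 4) (.inl 2) = 0
  a51 : A (.inl 5) (.inl 1) = 0
  a52 : A (.inl 5) (.inl 2) = 0
  a53 : A (.inl 5) (.inl 3) = 0
  a54 : A (.inl 5) (.inl 4) = 0
  a61 : A (.inl 0) (.inl 1) = 0
  a62 : A (.inl 0) (.inl 2) = 0
  a63 : A (.inl 0) (.inl 3) = 0
  a64 : A (.inl 0) (.inl 4) = 0
  a56 : A (.inl 5) (.inl 0) = A (.inl 4) (.inl 3)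
  a65 : A (.inl 0) (.inl 5) = A (.inl 3) (.inl 4)
  a66 : A (.inl 0) (.inl 0) = A (.inl 3) (.inl 3) - A (.inl 4) (.inl 4) + A (.inl 5) (.inl 5)
  u1 : A (.inr 0) (.inl 1) = 0
  u2 : A (.inr 0) (.inl 2) = 0
  u3 : A (.inr 0) (.inl 3) = -W + A (.inl 3) (.inl 0) + t * (A (.inl 4) (.inl 4) - A (.inl 5) (.inl
    5))
  u4 : A (.inr 0) (.inl 4) = A (.inl 3) (.inl 5)
  uu : A (.inr 0) (.inr 0) = A (.inl 3) (.inl 3) + A (.inl 4) (.inl 4) - A (.inl 5) (.inl 5)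
  uv : A (.inr 0) (.inr 1) = A (.inl 3) (.inl 4)
  uw : A (.inr 0) (.inr 2) = 0
  v1 : A (.inr 1) (.inl 1) = 0
  v2 : A (.inr 1) (.inl 2) = 0
  v3 : A (.inr 1) (.inl 3) = A (.inl 4) (.inl 0)
  v4 : A (.inr 1) (.inl 4) = -W + A (.inl 4) (.inl 5) + t * (A (.inl 4) (.inl 4) - A (.inl 5) (.inl
    5))
  vu : A (.inr 1) (.inr 0) = A (.inl 4) (.inl 3)
  vv : A (.inr 1) (.inr 1) = 2 * A (.inl 4) (.inl 4) - A (.inl 5) (.inl 5)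
  vw : A (.inr 1) (.inr 2) = 0

set_option maxHeartbeats 4000000 in
-- Besides the products ξ₁ξ₅, ξ₂ξ₅, ξ₁ξ₆, ξ₂ξ₆, the symbols at the zero 1-jet now include ξ₃ξ₅ −
-- ξ₄ξ₆. This quadric ties the derivatives of the components a⁵, a⁶ along x⁵, x⁶ to those of a³, a⁴
-- along x³, x⁴.
theorem altfull_relations {x A₀ : Coord 6 3 → 𝕜} {A₁ A₂} (hx : x (.inr 2) = 0) (h : IsJetSymmetry
    (alttriple 𝕜 6 ++ triple2 𝕜 6) x A₀ A₁ A₂) : AltFullRelations 0 (A₀ (.inr 2)) A₁ := by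
  have hF0 : ∀ F ∈ alttriple 𝕜 6 ++ triple2 𝕜 6, F (jet x (0) 0) = 0 := by
    simp [alttriple, triple2, R₁, R₂, R₃, R₄, R₅, R₆, jet_d2, u_jet, v_jet, w_jet, w₀_jet, hx, ofNat_self]
  have N0 := fun ξ₁ ξ₂ ξ₃ ξ₄ ξ₅ ξ₆ => altfull_null h (fun _ _ _ => rfl) hF0 ![ξ₆, ξ₁, ξ₂, ξ₃, ξ₄,
    ξ₅]
  have hF1 : ∀ F ∈ alttriple 𝕜 6 ++ triple2 𝕜 6, F (jet x (unit 0 1) 0) = 0 := by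
    simp [alttriple, triple2, R₁, R₂, R₃, R₄, R₅, R₆, jet_d2, u_jet, v_jet, w_jet, w₀_jet, hx, unit, ofNat_self]
  have N1 := fun ξ₁ ξ₂ ξ₃ ξ₄ ξ₅ ξ₆ => altfull_null h (fun _ _ _ => rfl) hF1 ![ξ₆, ξ₁, ξ₂, ξ₃, ξ₄,
    ξ₅]
  have hF2 : ∀ F ∈ alttriple 𝕜 6 ++ triple2 𝕜 6, F (jet x (unit 0 3) 0) = 0 := by
    simp [alttriple, triple2, R₁, R₂, R₃, R₄, R₅, R₆, jet_d2, u_jet, v_jet, w_jet, w₀_jet, hx, unit, ofNat_self]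
  have N2 := fun ξ₁ ξ₂ ξ₃ ξ₄ ξ₅ ξ₆ => altfull_null h (fun _ _ _ => rfl) hF2 ![ξ₆, ξ₁, ξ₂, ξ₃, ξ₄,
    ξ₅]
  have hF3 : ∀ F ∈ alttriple 𝕜 6 ++ triple2 𝕜 6, F (jet x (unit 1 1) 0) = 0 := by
    simp [alttriple, triple2, R₁, R₂, R₃, R₄, R₅, R₆, jet_d2, u_jet, v_jet, w_jet, w₀_jet, hx, unit, ofNat_self]
  have N3 := fun ξ₁ ξ₂ ξ₃ ξ₄ ξ₅ ξ₆ => altfull_null h (fun _ _ _ => rfl) hF3 ![ξ₆, ξ₁, ξ₂, ξ₃, ξ₄,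
    ξ₅]
  have hF4 : ∀ F ∈ alttriple 𝕜 6 ++ triple2 𝕜 6, F (jet x (unit 1 4) 0) = 0 := by
    simp [alttriple, triple2, R₁, R₂, R₃, R₄, R₅, R₆, jet_d2, u_jet, v_jet, w_jet, w₀_jet, hx, unit, ofNat_self]
  have N4 := fun ξ₁ ξ₂ ξ₃ ξ₄ ξ₅ ξ₆ => altfull_null h (fun _ _ _ => rfl) hF4 ![ξ₆, ξ₁, ξ₂, ξ₃, ξ₄,
    ξ₅]
  have hF5 : ∀ F ∈ alttriple 𝕜 6 ++ triple2 𝕜 6, F (jet x (unit 2 1) 0) = 0 := by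
    simp [alttriple, triple2, R₁, R₂, R₃, R₄, R₅, R₆, jet_d2, u_jet, v_jet, w_jet, w₀_jet, hx, unit, ofNat_self]
  have N5 := fun ξ₁ ξ₂ ξ₃ ξ₄ ξ₅ ξ₆ => altfull_null h (fun _ _ _ => rfl) hF5 ![ξ₆, ξ₁, ξ₂, ξ₃, ξ₄,
    ξ₅]
  -- With w₅ = 1 the equation for `R₆ J 0` requires u₃₅ − u₄₆ = −1, which is achieved by u₄₆ = 1.
  have hF6 : ∀ F ∈ alttriple 𝕜 6 ++ triple2 𝕜 6, F (jet x (unit 2 5) (unit₂ 0 4 0 1)) = 0 := by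
    simp [alttriple, triple2, R₁, R₂, R₃, R₄, R₅, R₆, jet_d2, u_jet, v_jet, w_jet, w₀_jet, hx, unit, unit₂, ofNat_self]
  have N6 := fun ξ₁ ξ₂ ξ₃ ξ₄ ξ₅ ξ₆ => altfull_null h (unit₂_symm (by decide) _) hF6 ![ξ₆, ξ₁, ξ₂,
    ξ₃, ξ₄, ξ₅]
  simp only [R₁, R₂, R₃, R₄, R₅, R₆, dR₁, dR₂, dR₃, dR₄, dR₅, dR₆, u, v, w₀, sqJet, sqJetVar,
    jet_d1, jet_d2, jet_val, contract, hx, Fin.sum_univ_six, Matrix.cons_val, total_zero,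
    prolong₁_zero, Fin.reduceEq, Fin.isValue, if_true, if_false, and_self, Pi.zero_apply, zero_mul,
    mul_zero, add_zero, zero_add, sub_zero, zero_sub, neg_zero, mul_one, one_mul, sub_self,
    ofNat_self] at N0
  simp only [R₁, R₂, R₃, R₄, R₅, R₆, dR₁, dR₂, dR₃, dR₄, dR₅, dR₆, u, v, w₀, sqJet, sqJetVar,
    jet_d1, jet_d2, jet_val, contract, hx, Fin.sum_univ_six, Matrix.cons_val, total_unit,
    prolong₁_unit, unit, Fin.reduceEq, Fin.isValue, if_true, if_false, and_self, Pi.zero_apply,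
    zero_mul, mul_zero, add_zero, zero_add, sub_zero, zero_sub, neg_zero, mul_one, one_mul,
    sub_self, ofNat_self] at N1 N2 N3 N4 N5 N6
  have e1 := N0 1 0 0 0 0 0 (by norm_num)
  have e2 := N0 0 1 0 0 0 0 (by norm_num)
  have e3 := N0 0 0 1 0 0 0 (by norm_num)
  have e4 := N0 0 0 0 1 0 0 (by norm_num)
  have e5 := N0 0 0 0 0 1 0 (by norm_num)
  have e6 := N0 0 0 0 0 0 1 (by norm_num)
  have e7 := N0 1 0 1 0 0 0 (by norm_num)
  have e8 := N0 1 0 0 1 0 0 (by norm_num)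
  have e9 := N0 0 0 1 0 0 1 (by norm_num)
  have e10 := N0 0 0 0 1 1 0 (by norm_num)
  have e11 := N0 0 0 0 0 1 1 (by norm_num)
  have e12 := N0 0 0 1 1 1 1 (by norm_num)
  have e13 := N1 0 1 0 0 0 0 (by norm_num)
  have e14 := N1 0 0 0 1 0 0 (by norm_num)
  have e15 := N1 0 0 0 0 1 0 (by norm_num)
  have e16 := N1 0 0 0 0 0 1 (by norm_num)
  have e17 := N1 1 1 0 0 0 0 (by norm_num)
  have e18 := N1 0 0 0 1 1 0 (by norm_num)
  have e19 := N1 1 0 1 0 0 1 (by norm_num)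
  have e20 := N1 1 0 (-1) 0 0 1 (by norm_num)
  have e21 := N2 1 0 0 0 0 0 (by norm_num)
  have e22 := N2 0 1 0 0 0 0 (by norm_num)
  have e23 := N2 1 0 1 0 0 (-1) (by norm_num)
  have e24 := N3 0 1 0 0 0 0 (by norm_num)
  have e25 := N3 0 0 1 0 0 0 (by norm_num)
  have e26 := N3 0 0 0 0 1 0 (by norm_num)
  have e27 := N3 0 0 0 0 0 1 (by norm_num)
  have e28 := N3 1 1 0 0 0 0 (by norm_num)
  have e29 := N3 0 0 1 0 0 1 (by norm_num)
  have e30 := N3 1 0 0 1 1 0 (by norm_num)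
  have e31 := N3 1 0 0 (-1) 1 0 (by norm_num)
  have e32 := N4 1 0 0 0 0 0 (by norm_num)
  have e33 := N4 0 1 0 0 0 0 (by norm_num)
  have e34 := N5 0 0 1 0 0 0 (by norm_num)
  have e35 := N5 0 0 0 1 0 0 (by norm_num)
  have e36 := N5 0 0 0 0 1 0 (by norm_num)
  have e37 := N5 0 0 0 0 0 1 (by norm_num)
  have e38 := N5 0 0 1 0 0 1 (by norm_num)
  have e39 := N5 0 0 0 1 1 0 (by norm_num)
  have e40 := N6 1 0 0 0 0 0 (by norm_num)
  have e41 := N6 0 1 0 0 0 0 (by norm_num)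
  have a15 : A₁ (.inl 1) (.inl 5) = 0 := by linear_combination e1.2.1
  have a16 : A₁ (.inl 1) (.inl 0) = 0 := by linear_combination e1.2.2.2.1
  have a25 : A₁ (.inl 2) (.inl 5) = 0 := by linear_combination e2.2.2.1
  have a26 : A₁ (.inl 2) (.inl 0) = 0 := by linear_combination e2.2.2.2.2.1
  have a31 : A₁ (.inl 3) (.inl 1) = 0 := by linear_combination e9.2.2.2.1 - e3.2.2.2.1 - e6.2.2.2.1
  have a32 : A₁ (.inl 3) (.inl 2) = 0 := by linear_combination e9.2.2.2.2.1 - e3.2.2.2.2.1 -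
    e6.2.2.2.2.1
  have a41 : A₁ (.inl 4) (.inl 1) = 0 := by linear_combination e10.2.1 - e4.2.1 - e5.2.1
  have a42 : A₁ (.inl 4) (.inl 2) = 0 := by linear_combination e10.2.2.1 - e4.2.2.1 - e5.2.2.1
  have a51 : A₁ (.inl 5) (.inl 1) = 0 := by linear_combination e5.2.1
  have a52 : A₁ (.inl 5) (.inl 2) = 0 := by linear_combination e5.2.2.1
  have a53 : A₁ (.inl 5) (.inl 3) = 0 := by linear_combination -e5.2.2.2.2.2
  have a61 : A₁ (.inl 0) (.inl 1) = 0 := by linear_combination e6.2.2.2.1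
  have a62 : A₁ (.inl 0) (.inl 2) = 0 := by linear_combination e6.2.2.2.2.1
  have a64 : A₁ (.inl 0) (.inl 4) = 0 := by linear_combination e6.2.2.2.2.2
  have a56 : A₁ (.inl 5) (.inl 0) = A₁ (.inl 4) (.inl 3) := by linear_combination e10.2.2.2.2.2 -
    e4.2.2.2.2.2 + a53
  have a65 : A₁ (.inl 0) (.inl 5) = A₁ (.inl 3) (.inl 4) := by linear_combination -e9.2.2.2.2.2 +
    e3.2.2.2.2.2 + a64
  have a66 : A₁ (.inl 0) (.inl 0) = A₁ (.inl 3) (.inl 3) - A₁ (.inl 4) (.inl 4) + A₁ (.inl 5) (.inl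
    5) := by linear_combination e12.2.2.2.2.2 - e7.2.2.2.1 + e3.2.2.2.1 - e3.2.2.2.2.2 -
    e4.2.2.2.2.2 + e8.2.1 - e4.2.1 - a15 + a16 + a65 - a56 - e11.2.2.2.2.2
  have u1 : A₁ (.inr 0) (.inl 1) = 0 := by linear_combination e3.2.2.2.1
  have u2 : A₁ (.inr 0) (.inl 2) = 0 := by linear_combination e3.2.2.2.2.1
  have u3 : A₁ (.inr 0) (.inl 3) = -A₀ (.inr 2) + A₁ (.inl 3) (.inl 0) := by
    linear_combination -e7.2.2.2.1 + u1 + a16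
  have u4 : A₁ (.inr 0) (.inl 4) = A₁ (.inl 3) (.inl 5) := by linear_combination e3.2.2.2.2.2
  have v1 : A₁ (.inr 1) (.inl 1) = 0 := by linear_combination e4.2.1
  have v2 : A₁ (.inr 1) (.inl 2) = 0 := by linear_combination e4.2.2.1
  have v3 : A₁ (.inr 1) (.inl 3) = A₁ (.inl 4) (.inl 0) := by linear_combination -e4.2.2.2.2.2
  have v4 : A₁ (.inr 1) (.inl 4) = -A₀ (.inr 2) + A₁ (.inl 4) (.inl 5) := by
    linear_combination -e8.2.1 + v1 + a15
  have a4u : A₁ (.inl 4) (.inr 0) = 0 := by linear_combination e18.2.1 - e14.2.1 - a41 - e15.2.1 +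
    a53
  have a5u : A₁ (.inl 5) (.inr 0) = 0 := by linear_combination e15.2.1 - a51
  have a6u : A₁ (.inl 0) (.inr 0) = 0 := by linear_combination e16.2.2.2.1 - a61
  have a13 : A₁ (.inl 1) (.inl 3) = 0 := by linear_combination -e17.1 + e13.1
  have a23 : A₁ (.inl 2) (.inl 3) = 0 := by linear_combination -e13.1
  have uu : A₁ (.inr 0) (.inr 0) = A₁ (.inl 3) (.inl 3) + A₁ (.inl 4) (.inl 4) - A₁ (.inl 5) (.inl
    5) := by linear_combination (1 / 2) * e19.2.2.2.1 - u1 - a16 + (1 / 2) * e20.2.2.2.1 - a66 - a6u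
    - a61
  have vu : A₁ (.inr 1) (.inr 0) = A₁ (.inl 4) (.inl 3) := by linear_combination e14.2.1 - v1
  have a1u : A₁ (.inl 1) (.inr 0) = 0 := by linear_combination e21.2.2.2.1 - a13 - a16
  have a2u : A₁ (.inl 2) (.inr 0) = 0 := by linear_combination e22.2.2.2.2.1 - a23 - a26
  have a3u : A₁ (.inl 3) (.inr 0) = 0 := by linear_combination -(1 / 3) * e19.2.2.2.1 + uu - (1 / 3)
    * u1 + (1 / 3) * u3 - a13 - (1 / 3) * a16 + a31 + a66 + a6u + (1 / 3) * a61 + (2 / 3) *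
    e23.2.2.2.1 - (2 / 3) * a1u
  have a54 : A₁ (.inl 5) (.inl 4) = 0 := by linear_combination e11.2.2.2.2.2 + a53 - (1 / 2) *
    e19.2.2.2.1 + (1 / 2) * uu + (1 / 2) * u1 - (1 / 2) * u3 - (1 / 2) * a13 + (1 / 2) * a16 + (1 /
    2) * a3u + (1 / 2) * a31 + (1 / 2) * a66 + (1 / 2) * a6u + (1 / 2) * a61 - a64
  have a63 : A₁ (.inl 0) (.inl 3) = 0 := by linear_combination -e11.2.2.2.2.2 - a53 + a54 + a64
  have a3v : A₁ (.inl 3) (.inr 1) = 0 := by linear_combination e29.2.2.2.1 - e25.2.2.2.1 - a31 -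
    e27.2.2.2.1 + a64
  have a4v : A₁ (.inl 4) (.inr 1) = 0 := by linear_combination -(1 / 2) * e31.2.1 + (1 / 2) *
    e30.2.1 + v4 - e28.1 + e24.1 - a41 + 2 * a54
  have a5v : A₁ (.inl 5) (.inr 1) = 0 := by linear_combination e26.2.1 - a51
  have a6v : A₁ (.inl 0) (.inr 1) = 0 := by linear_combination e27.2.2.2.1 - a61
  have a14 : A₁ (.inl 1) (.inl 4) = 0 := by linear_combination -e28.1 + e24.1
  have a24 : A₁ (.inl 2) (.inl 4) = 0 := by linear_combination -e24.1
  have uv : A₁ (.inr 0) (.inr 1) = A₁ (.inl 3) (.inl 4) := by linear_combination e25.2.2.2.1 - u1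
  have vv : A₁ (.inr 1) (.inr 1) = 2 * A₁ (.inl 4) (.inl 4) - A₁ (.inl 5) (.inl 5) := by
    linear_combination e30.2.1 - v1 + v4 + a14 - a15 - a4v - a41 - a5v - a51 + 2 * a54
  have a1v : A₁ (.inl 1) (.inr 1) = 0 := by linear_combination e32.2.1 - a14 - a15
  have a2v : A₁ (.inl 2) (.inr 1) = 0 := by linear_combination e33.2.2.1 - a24 - a25
  have a3w : A₁ (.inl 3) (.inr 2) = 0 := by linear_combination e38.2.2.2.1 - e34.2.2.2.1 - a31 -
    e37.2.2.2.1
  have a4w : A₁ (.inl 4) (.inr 2) = 0 := by linear_combination e39.2.1 - e35.2.1 - a41 - e36.2.1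
  have a5w : A₁ (.inl 5) (.inr 2) = 0 := by linear_combination e36.2.1 - a51
  have a6w : A₁ (.inl 0) (.inr 2) = 0 := by linear_combination e37.2.2.2.1 - a61
  have uw : A₁ (.inr 0) (.inr 2) = 0 := by linear_combination e34.2.2.2.1 - u1
  have vw : A₁ (.inr 1) (.inr 2) = 0 := by linear_combination e35.2.1 - v1
  have a1w : A₁ (.inl 1) (.inr 2) = 0 := by linear_combination e40.2.1 - a15
  have a2w : A₁ (.inl 2) (.inr 2) = 0 := by linear_combination e41.2.2.1 - a25
  exact ⟨fun k β => by fin_cases k <;> fin_cases β <;> assumption, a13, a14, a15, a16, a23, a24,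
    a25, a26, a31, a32, a41, a42, a51, a52, a53, a54, a61, a62, a63, a64, a56, a65, a66, u1, u2, by
    simpa only [zero_mul, sub_zero, add_zero] using u3, u4, uu, uv, uw, v1, v2, v3, by simpa only
    [zero_mul, sub_zero, add_zero] using v4, vu, vv, vw⟩

end FirstOrder

end ScrollSym

namespace ScrollSym

set_option linter.unusedSectionVars false

set_option linter.unusedSimpArgs false

/-! ### Further relations from the complete symmetry condition. -/

section SecondOrder

variable {𝕜 : Type*} [RCLike 𝕜] {d : ℕ} [NeZero d]

/-- The 1-jet whose only nonzero entries are `w_1 = r`, `w_2 = s`. -/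
def rankTwo (r s : 𝕜) (β : Fin 3) (j : Fin d) : 𝕜 :=
  if β = 2 then if j = 1 then r else if j = 2 then s else 0 else 0

/-- From here on the field is projectable to the space of independent variables, and the terms of
the prolongation that are of higher degree in the slopes because of the x-components disappear. -/
theorem total_of_base {A₁ : Coord d 3 → Coord d 3 → 𝕜} (h : ∀ k β, A₁ (.inl k) (.inr β) = 0)
    (p : Fin 3 → Fin d → 𝕜) (i k : Fin d) : total A₁ p i (.inl k) = A₁ (.inl k) (.inl i) := by
  simp [total, h]

theorem total₂_of_base {A₁ : Coord d 3 → Coord d 3 → 𝕜} {A₂} (h : ∀ k β, A₁ (.inl k) (.inr β) = 0)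
    (h' : ∀ k β c, A₂ (.inl k) (.inr β) c = 0 ∧ A₂ (.inl k) c (.inr β) = 0)
    (p : Fin 3 → Fin d → 𝕜) (q) (i j k : Fin d) :
    total₂ A₁ A₂ p q i j (.inl k) = A₂ (.inl k) (.inl i) (.inl j) := by
  simp [total₂, h, (h' _ _ _).1, (h' _ _ _).2]

theorem prolong₁_of_base {A₁ : Coord d 3 → Coord d 3 → 𝕜} (h : ∀ k β, A₁ (.inl k) (.inr β) = 0)
    (p : Fin 3 → Fin d → 𝕜) (α : Fin 3) (i : Fin d) :
    prolong₁ A₁ p α i = A₁ (.inr α) (.inl i) + (p 0 i * A₁ (.inr α) (.inr 0)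
      + p 1 i * A₁ (.inr α) (.inr 1) + p 2 i * A₁ (.inr α) (.inr 2))
      - ∑ k, A₁ (.inl k) (.inl i) * p α k := by
  simp only [prolong₁, total_of_base h]
  simp only [total, Fin.sum_univ_three]

theorem prolong₂_of_base {A₀ : Coord d 3 → 𝕜} {A₁ : Coord d 3 → Coord d 3 → 𝕜} {A₂}
    (h : ∀ k β, A₁ (.inl k) (.inr β) = 0)
    (h' : ∀ k β c, A₂ (.inl k) (.inr β) c = 0 ∧ A₂ (.inl k) c (.inr β) = 0)
    (p : Fin 3 → Fin d → 𝕜) (q) (α : Fin 3) (i j : Fin d) :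
    (prolong₂ A₀ A₁ A₂ p q).d2 α i j = total₂ A₁ A₂ p q i j (.inr α)
      - ∑ k, (A₂ (.inl k) (.inl i) (.inl j) * p α k + A₁ (.inl k) (.inl i) * q α j k
        + A₁ (.inl k) (.inl j) * q α i k) := by
  simp only [← total₂_of_base h h' p q, ← total_of_base h p]
  rfl

/-- Second derivatives compatible with the 1-jet `rankTwo r s`. -/
def rankTwo₂ (r s : 𝕜) : Fin 3 → Fin d → Fin d → 𝕜 :=
  unit₂ 0 2 3 r + unit₂ 1 2 3 (-s) + unit₂ 2 1 5 (r ^ 2) + unit₂ 2 3 4 (-(r * s))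

theorem add_symm {q q' : Fin 3 → Fin d → Fin d → 𝕜} (h : ∀ α i j, q α i j = q α j i)
    (h' : ∀ α i j, q' α i j = q' α j i) (α i j) : (q + q') α i j = (q + q') α j i := by
  simp only [Pi.add_apply, h α i j, h' α i j]

theorem rankTwo₂_symm (r s : 𝕜) (h23 : (2 : Fin d) ≠ 3) (h15 : (1 : Fin d) ≠ 5) (h34 : (3 : Fin d) ≠ 4) :
    ∀ α i j, (rankTwo₂ r s : Fin 3 → Fin d → Fin d → 𝕜) α i j = rankTwo₂ r s α j i :=
  add_symm (add_symm (add_symm (unit₂_symm h23 _) (unit₂_symm h23 _)) (unit₂_symm h15 _))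
    (unit₂_symm h34 _)

/-- The linearised equation for `Q₂` applied to v is a polynomial in the slopes r = w₁ and s = w₂.
Its coefficient of rs is −2 ∂_w of the u-component, and that of r² is −∂_w of the v-component;
finite differences extract both. The last relation is the linearised equation for `Q₃` applied to u,
at the zero jet. It supplies ∂₃ of the w-component, which first-order relations alone do not give in
five variables. -/
theorem triple_relations₂ {x A₀ : Coord 5 3 → 𝕜} {A₁ A₂} (hx : x (.inr 2) = 0)
    (h : IsJetSymmetry (triple 𝕜 5) x A₀ A₁ A₂) (hA : ∀ k β, A₁ (.inl k) (.inr β) = 0)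
    (hA' : ∀ k β c, A₂ (.inl k) (.inr β) c = 0 ∧ A₂ (.inl k) c (.inr β) = 0) :
    A₁ (.inr 0) (.inr 2) = 0 ∧ A₁ (.inr 1) (.inr 2) = 0 ∧
      A₁ (.inr 2) (.inl 3) = A₂ (.inr 0) (.inl 2) (.inl 0) - A₂ (.inr 0) (.inl 3) (.inl 4) := by
  have key : ∀ r s : 𝕜, _ := fun r s => triple_lineDeriv_iff.1 (h (rankTwo r s) (rankTwo₂ r s)
    (rankTwo₂_symm r s (by decide) (by decide) (by decide))
    (by simp [triple, Q₁, Q₂, Q₃, jet_d2, u_jet, v_jet, w_jet, w₀_jet, hx, rankTwo, rankTwo₂, unit₂,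
      ofNat_self]))
  have key5 : ∀ r s : 𝕜, _ := fun r s => (key r s).2.2.2.2.1
  have key7 := (key 0 0).2.2.2.2.2.2.1
  simp only [dQ₂, dQ₃, prolong₂_of_base hA hA', prolong₁_of_base hA, u, v, w, w₀, jet_d1, jet_d2,
    jet_val, prolong₂_d1, prolong₂_val, hx, total₂, Fin.sum_univ_five, Fin.sum_univ_three, rankTwo,
    rankTwo₂, unit₂, Pi.add_apply, Fin.reduceEq, Fin.isValue, if_true, if_false, ofNat_self, mul_zero,
    zero_mul, add_zero, zero_add, sub_zero] at key5 key7
  -- Mixed second difference in r and s.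
  exact ⟨by linear_combination -(1 / 2) * key5 1 1 + (1 / 2) * key5 1 0 + (1 / 2) * key5 0 1
      - (1 / 2) * key5 0 0,
    -- Second difference in r at s = 0.
    by linear_combination -(1 / 2) * key5 1 0 - (1 / 2) * key5 (-1) 0 + key5 0 0,
    by linear_combination key7⟩

theorem full_relations₂ {x A₀ : Coord 6 3 → 𝕜} {A₁ A₂} (hx : x (.inr 2) = 0)
    (h : IsJetSymmetry (triple 𝕜 6 ++ triple1 𝕜 6) x A₀ A₁ A₂)
    (hA : ∀ k β, A₁ (.inl k) (.inr β) = 0)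
    (hA' : ∀ k β c, A₂ (.inl k) (.inr β) c = 0 ∧ A₂ (.inl k) c (.inr β) = 0) :
    A₁ (.inr 0) (.inr 2) = 0 ∧ A₁ (.inr 1) (.inr 2) = 0 := by
  have key : ∀ r s : 𝕜, _ := fun r s => triple_lineDeriv_iff.1 (List.forall_mem_append.1
    (h (rankTwo r s) (rankTwo₂ r s + unit₂ 2 2 6 (s ^ 2))
    (add_symm (rankTwo₂_symm r s (by decide) (by decide) (by decide)) (unit₂_symm (by decide) _))
    (by simp [triple, triple1, Q₁, Q₂, Q₃, Q₄, Q₅, Q₆, jet_d2, u_jet, v_jet, w_jet, w₀_jet, hx, rankTwo,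
      rankTwo₂, unit₂, ofNat_self]))).1
  have key5 : ∀ r s : 𝕜, _ := fun r s => (key r s).2.2.2.2.1
  simp only [dQ₂, prolong₂_of_base hA hA', prolong₁_of_base hA, u, v, w, w₀, jet_d1, jet_d2,
    jet_val, prolong₂_d1, prolong₂_val, hx, total₂, Fin.sum_univ_six, Fin.sum_univ_three, rankTwo,
    rankTwo₂, unit₂, Pi.add_apply, Fin.reduceEq, Fin.isValue, if_true, if_false, ofNat_self, mul_zero,
    zero_mul, add_zero, zero_add, sub_zero] at key5
  exact ⟨by linear_combination -(1 / 2) * key5 1 1 + (1 / 2) * key5 1 0 + (1 / 2) * key5 0 1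
      - (1 / 2) * key5 0 0,
    by linear_combination -(1 / 2) * key5 1 0 - (1 / 2) * key5 (-1) 0 + key5 0 0⟩

/-- Comparison of the linearised equation for `R₂` applied to w at w₁ = 1 and at w₁ = 0. The
hypotheses on a¹ remove the contributions of the x-components, so that ∂₄ of the w-component is
balanced by its mixed derivative in w and x⁵ alone. -/
theorem alttriple_relations₂ {x A₀ : Coord 5 3 → 𝕜} {A₁ A₂} (hx : x (.inr 2) = 0)
    (h : IsJetSymmetry (alttriple 𝕜 5) x A₀ A₁ A₂) (hA : ∀ k β, A₁ (.inl k) (.inr β) = 0)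
    (hA' : ∀ k β c, A₂ (.inl k) (.inr β) c = 0 ∧ A₂ (.inl k) c (.inr β) = 0)
    (hA1 : A₁ (.inl 1) (.inl 4) = 0) (hA15 : A₂ (.inl 1) (.inl 1) (.inl 0) = 0) :
    A₁ (.inr 2) (.inl 4) = - A₂ (.inr 2) (.inr 2) (.inl 0) := by
  have key := (alttriple_lineDeriv_iff.1 (h (unit 2 1) 0 (fun _ _ _ => rfl)
    (by simp [alttriple, R₁, R₂, R₃, jet_d2, u_jet, v_jet, w_jet, w₀_jet, hx, unit,
      ofNat_self]))).2.2.2.2.2.1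
  have key0 := (alttriple_lineDeriv_iff.1 (h 0 0 (fun _ _ _ => rfl)
    (by simp [alttriple, R₁, R₂, R₃, jet_d2, u_jet, v_jet, w_jet, w₀_jet, hx,
      ofNat_self]))).2.2.2.2.2.1
  simp only [dR₂, prolong₂_of_base hA hA', prolong₁_of_base hA, u, v, w, w₀, jet_d1, jet_d2,
    jet_val, prolong₂_d1, prolong₂_val, hx, total₂, Fin.sum_univ_five, Fin.sum_univ_three, unit,
    Pi.zero_apply, Fin.reduceEq, Fin.isValue, if_true, if_false, ofNat_self, mul_zero, zero_mul,
    add_zero, zero_add, sub_zero, hA15, hA1] at key key0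
  linear_combination key0 - key

end SecondOrder

end ScrollSym

namespace ScrollSym

set_option linter.unusedSectionVars false

set_option linter.unusedSimpArgs false

/-! ### From relations at points with w = 0 to identities between functions on `U`. -/

section AlgebraicRelations

open TopologicalSpace SmoothAlg

variable {𝕜 : Type*} [RCLike 𝕜]

/-- As the x-components do not depend on the dependent variables, undoing the shift only adds
multiples of t to derivatives of the u- and v-components. This accounts for the terms with factor t
in the relations. -/
theorem TripleRelations.of_shift {t W : 𝕜} {A : Coord 5 3 → Coord 5 3 → 𝕜}
    (h : TripleRelations 0 W (shift₁ (slope t) A)) : TripleRelations t W A := by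
  obtain ⟨base, a21, a31, a32, a41, a42, a43, a51, a52, a53, a54, a34, a44, a45, a55, u1, u2, u3,
    uu, uv, v1, v2, v3, vu, vv⟩ := h
  have base : ∀ k β, A (.inl k) (.inr β) = 0 := base
  simp only [shift₁, vert, horiz, slope, base, Fin.sum_univ_five, Fin.sum_univ_three, Fin.reduceEq,
    Fin.isValue, and_true, and_false, true_and, false_and, or_true, or_false, true_or, false_or,
    if_true, if_false, zero_mul, mul_zero, add_zero, zero_add, sub_zero, ofNat_self]
    at a21 a31 a32 a41 a42 a43 a51 a52 a53 a54 a34 a44 a45 a55 u1 u2 u3 uu uv v1 v2 v3 vu vv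
  exact ⟨base, a21, a31, a32, a41, a42, a43, a51, a52, a53, a54, a34, a44, a45, a55, by
    linear_combination u1 + t * a41, by linear_combination u2 + t * a42, by linear_combination u3 +
    t * a43 - t * uv, uu, uv, by linear_combination v1 + t * a31, by linear_combination v2 + t *
    a32, by linear_combination v3 - t * vv, vu, vv⟩

/-- Equality in the ring of smooth functions is pointwise; this is why the relations are formulated
over an arbitrary commutative ring. -/
theorem TripleRelations.of_evalAt {U : Opens (Coord 5 3 → 𝕜)} {t W : SmoothAlg U}
    {A : Coord 5 3 → Coord 5 3 → SmoothAlg U}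
    (h : ∀ z, TripleRelations (evalAt z t) (evalAt z W) fun c i => evalAt z (A c i)) :
    TripleRelations t W A := by
  constructor
  · exact fun k β => ext' fun z => by simpa only [map_zero] using (h z).base k β
  all_goals refine ext' fun z => ?_
  all_goals try simp only [map_add, map_sub, map_mul, map_neg, map_ofNat, map_zero]
  exacts [(h z).a21, (h z).a31, (h z).a32, (h z).a41, (h z).a42, (h z).a43, (h z).a51, (h z).a52, (h
    z).a53, (h z).a54, (h z).a34, (h z).a44, (h z).a45, (h z).a55, (h z).u1, (h z).u2, (h z).u3, (h
    z).uu, (h z).uv, (h z).v1, (h z).v2, (h z).v3, (h z).vu, (h z).vv]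

theorem AltTripleRelations.of_shift {t W : 𝕜} {A : Coord 5 3 → Coord 5 3 → 𝕜}
    (h : AltTripleRelations 0 W (shift₁ (altSlope t) A)) : AltTripleRelations t W A := by
  obtain ⟨base, a13, a14, a15, a23, a24, a25, a31, a32, a34, a41, a42, a51, a52, a53, a54, u1, u2,
    u4, uu, uv, uw, v1, v2, v4, vu, vv, vw⟩ := h
  have base : ∀ k β, A (.inl k) (.inr β) = 0 := base
  simp only [shift₁, vert, horiz, altSlope, base, Fin.sum_univ_five, Fin.sum_univ_three,
    Fin.reduceEq, Fin.isValue, and_true, and_false, true_and, false_and, or_true, or_false, true_or,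
    false_or, if_true, if_false, zero_mul, mul_zero, add_zero, zero_add, sub_zero, ofNat_self]
    at a13 a14 a15 a23 a24 a25 a31 a32 a34 a41 a42 a51 a52 a53 a54 u1 u2 u4 uu uv uw v1 v2 v4 vu vv
        vw
  exact ⟨base, a13, a14, a15, a23, a24, a25, a31, a32, a34, a41, a42, a51, a52, a53, a54, by
    linear_combination u1 - t * a31, by linear_combination u2 - t * a32, by linear_combination u4 -
    t * a34 + t * uv, uu, uv, uw, by linear_combination v1 - t * a41, by linear_combination v2 - t *
    a42, by linear_combination v4 + t * vv, vu, vv, vw⟩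

theorem AltTripleRelations.of_evalAt {U : Opens (Coord 5 3 → 𝕜)} {t W : SmoothAlg U}
    {A : Coord 5 3 → Coord 5 3 → SmoothAlg U}
    (h : ∀ z, AltTripleRelations (evalAt z t) (evalAt z W) fun c i => evalAt z (A c i)) :
    AltTripleRelations t W A := by
  constructor
  · exact fun k β => ext' fun z => by simpa only [map_zero] using (h z).base k β
  all_goals refine ext' fun z => ?_
  all_goals try simp only [map_add, map_sub, map_mul, map_neg, map_ofNat, map_zero]
  exacts [(h z).a13, (h z).a14, (h z).a15, (h z).a23, (h z).a24, (h z).a25, (h z).a31, (h z).a32, (h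
    z).a34, (h z).a41, (h z).a42, (h z).a51, (h z).a52, (h z).a53, (h z).a54, (h z).u1, (h z).u2, (h
    z).u4, (h z).uu, (h z).uv, (h z).uw, (h z).v1, (h z).v2, (h z).v4, (h z).vu, (h z).vv, (h z).vw]

theorem FullRelations.of_shift {t W : 𝕜} {A : Coord 6 3 → Coord 6 3 → 𝕜}
    (h : FullRelations 0 W (shift₁ (slope t) A)) : FullRelations t W A := by
  obtain ⟨base, a31, a32, a41, a42, a34, a36, a43, a44, a45, a46, a51, a52, a53, a54, a61, a62, a63,
    a64, a55, a56, a65, a66, u1, u2, u3, u4, uu, uv, v1, v2, v3, v4, vu, vv⟩ := h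
  have base : ∀ k β, A (.inl k) (.inr β) = 0 := base
  simp only [shift₁, vert, horiz, slope, base, Fin.sum_univ_six, Fin.sum_univ_three, Fin.reduceEq,
    Fin.isValue, and_true, and_false, true_and, false_and, or_true, or_false, true_or, false_or,
    if_true, if_false, zero_mul, mul_zero, add_zero, zero_add, sub_zero, ofNat_self]
    at a31 a32 a41 a42 a34 a36 a43 a44 a45 a46 a51 a52 a53 a54 a61 a62 a63 a64 a55 a56 a65 a66 u1 u2
        u3 u4 uu uv v1 v2 v3 v4 vu vv
  exact ⟨base, a31, a32, a41, a42, a34, a36, a43, a44, a45, a46, a51, a52, a53, a54, a61, a62, a63,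
    a64, a55, a56, a65, a66, by linear_combination u1 + t * a41, by linear_combination u2 + t * a42,
    by linear_combination u3 + t * a43 - t * uv, by linear_combination u4 + t * a44 - t * uu, uu,
    uv, by linear_combination v1 + t * a31, by linear_combination v2 + t * a32, by
    linear_combination v3 - t * vv, by linear_combination v4 + t * a34 - t * vu, vu, vv⟩

theorem FullRelations.of_evalAt {U : Opens (Coord 6 3 → 𝕜)} {t W : SmoothAlg U}
    {A : Coord 6 3 → Coord 6 3 → SmoothAlg U}
    (h : ∀ z, FullRelations (evalAt z t) (evalAt z W) fun c i => evalAt z (A c i)) :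
    FullRelations t W A := by
  constructor
  · exact fun k β => ext' fun z => by simpa only [map_zero] using (h z).base k β
  all_goals refine ext' fun z => ?_
  all_goals try simp only [map_add, map_sub, map_mul, map_neg, map_ofNat, map_zero]
  exacts [(h z).a31, (h z).a32, (h z).a41, (h z).a42, (h z).a34, (h z).a36, (h z).a43, (h z).a44, (h
    z).a45, (h z).a46, (h z).a51, (h z).a52, (h z).a53, (h z).a54, (h z).a61, (h z).a62, (h z).a63,
    (h z).a64, (h z).a55, (h z).a56, (h z).a65, (h z).a66, (h z).u1, (h z).u2, (h z).u3, (h z).u4,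
    (h z).uu, (h z).uv, (h z).v1, (h z).v2, (h z).v3, (h z).v4, (h z).vu, (h z).vv]

theorem AltFullRelations.of_shift {t W : 𝕜} {A : Coord 6 3 → Coord 6 3 → 𝕜}
    (h : AltFullRelations 0 W (shift₁ (altSlope t) A)) : AltFullRelations t W A := by
  obtain ⟨base, a13, a14, a15, a16, a23, a24, a25, a26, a31, a32, a41, a42, a51, a52, a53, a54, a61,
    a62, a63, a64, a56, a65, a66, u1, u2, u3, u4, uu, uv, uw, v1, v2, v3, v4, vu, vv, vw⟩ := h
  have base : ∀ k β, A (.inl k) (.inr β) = 0 := base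
  simp only [shift₁, vert, horiz, altSlope, base, Fin.sum_univ_six, Fin.sum_univ_three,
    Fin.reduceEq, Fin.isValue, and_true, and_false, true_and, false_and, or_true, or_false, true_or,
    false_or, if_true, if_false, zero_mul, mul_zero, add_zero, zero_add, sub_zero, ofNat_self]
    at a13 a14 a15 a16 a23 a24 a25 a26 a31 a32 a41 a42 a51 a52 a53 a54 a61 a62 a63 a64 a56 a65 a66
        u1 u2 u3 u4 uu uv uw v1 v2 v3 v4 vu vv vw
  exact ⟨base, a13, a14, a15, a16, a23, a24, a25, a26, a31, a32, a41, a42, a51, a52, a53, a54, a61,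
    a62, a63, a64, a56, a65, a66, by linear_combination u1 - t * a31, by linear_combination u2 - t *
    a32, by linear_combination u3 + t * uu, by linear_combination u4 + t * uv, uu, uv, uw, by
    linear_combination v1 - t * a41, by linear_combination v2 - t * a42, by linear_combination v3 +
    t * vu, by linear_combination v4 + t * vv, vu, vv, vw⟩

theorem AltFullRelations.of_evalAt {U : Opens (Coord 6 3 → 𝕜)} {t W : SmoothAlg U}
    {A : Coord 6 3 → Coord 6 3 → SmoothAlg U}
    (h : ∀ z, AltFullRelations (evalAt z t) (evalAt z W) fun c i => evalAt z (A c i)) :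
    AltFullRelations t W A := by
  constructor
  · exact fun k β => ext' fun z => by simpa only [map_zero] using (h z).base k β
  all_goals refine ext' fun z => ?_
  all_goals try simp only [map_add, map_sub, map_mul, map_neg, map_ofNat, map_zero]
  exacts [(h z).a13, (h z).a14, (h z).a15, (h z).a16, (h z).a23, (h z).a24, (h z).a25, (h z).a26, (h
    z).a31, (h z).a32, (h z).a41, (h z).a42, (h z).a51, (h z).a52, (h z).a53, (h z).a54, (h z).a61,
    (h z).a62, (h z).a63, (h z).a64, (h z).a56, (h z).a65, (h z).a66, (h z).u1, (h z).u2, (h z).u3,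
    (h z).u4, (h z).uu, (h z).uv, (h z).uw, (h z).v1, (h z).v2, (h z).v3, (h z).v4, (h z).vu, (h
    z).vv, (h z).vw]

variable {d : ℕ} {U : Opens (Coord d 3 → 𝕜)}

theorem shift₁_inr_inr (p₀ : Fin 3 → Fin d → 𝕜) {A : Coord d 3 → Coord d 3 → 𝕜}
    (h : ∀ k β, A (.inl k) (.inr β) = 0) (α β : Fin 3) :
    shift₁ p₀ A (.inr α) (.inr β) = A (.inr α) (.inr β) := by
  simp [shift₁, vert, horiz, h]

/-- If the `x`-components of a vector field depend on `x` alone, the same holds for their second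
derivatives after a shift. -/
theorem shift₂_of_base {V : Coord d 3 → SmoothAlg U} (h : ∀ k β, D (.inr β) (V (.inl k)) = 0) (z : U)
    (p₀ : Fin 3 → Fin d → 𝕜) (k : Fin d) (β : Fin 3) (c : Coord d 3) :
    shift₂ p₀ (fun c i j => evalAt z (D i (D j (V c)))) (.inl k) (.inr β) c = 0 ∧
      shift₂ p₀ (fun c i j => evalAt z (D i (D j (V c)))) (.inl k) c (.inr β) = 0 := by
  have h' : ∀ k β c, D (.inr β) (D c (V (.inl k))) = 0 := fun k β c => by rw [D_comm, h, D_zero]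
  constructor <;> cases c <;> simp [shift₂, vert, horiz, h, h', D_zero]

theorem sub_offset (x : Coord d 3 → 𝕜) : (x - offset (x (.inr 2)) : Coord d 3 → 𝕜) (.inr 2) = 0 := by
  simp [offset]

/-- At each point z the shift by t = w(z) moves the base point to w = 0, where the jet computations
apply. In the final identity the powers of the coordinate w are the traces of this shift. -/
theorem triple_algRelations {U : Opens (Coord 5 3 → 𝕜)} {V : Coord 5 3 → SmoothAlg U}
    (hV : V ∈ algSymmetries (triple 𝕜 5) U) :
    TripleRelations (X (.inr 2)) (V (.inr 2)) (fun c i => D i (V c)) ∧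
      D (.inr 2) (V (.inr 0)) = 0 ∧ D (.inr 2) (V (.inr 1)) = 0 ∧
      D (.inl 3) (V (.inr 2)) + X (.inr 2) * D (.inr 1) (V (.inr 2))
        = D (.inl 2) (D (.inl 0) (V (.inr 0))) - D (.inl 3) (D (.inl 4) (V (.inr 0)))
          - X (.inr 2) * D (.inl 2) (D (.inl 0) (V (.inl 4)))
          - X (.inr 2) * D (.inl 3) (D (.inr 0) (V (.inr 0)))
          - X (.inr 2) * D (.inr 1) (D (.inl 4) (V (.inr 0)))
          - X (.inr 2) ^ 2 * D (.inr 1) (D (.inr 0) (V (.inr 0)))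
          + X (.inr 2) * D (.inl 3) (D (.inl 4) (V (.inl 4))) := by
  have hz := fun z : U => (hV z).shift (slope_invariant (z.1 (.inr 2)))
  have R := fun z => (triple_relations (sub_offset _) (hz z)).of_shift
  have base : ∀ k β, D (.inr β) (V (.inl k)) = 0 := fun k β => ext' fun z => by
    rw [(R z).base, map_zero]
  have R2 := fun z => triple_relations₂ (sub_offset _) (hz z)
    (triple_relations (sub_offset _) (hz z)).base (shift₂_of_base base z _)
  have ev : ∀ (z : U) (k : Fin 5) (β : Fin 3), evalAt z (D (.inr β) (V (.inl k))) = 0 :=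
    fun z k β => (R z).base k β
  refine ⟨.of_evalAt R, ext' fun z => ?_, ext' fun z => ?_, ext' fun z => ?_⟩
  · rw [map_zero, ← (R2 z).1, shift₁_inr_inr _ (ev z)]
  · rw [map_zero, ← (R2 z).2.1, shift₁_inr_inr _ (ev z)]
  · have := (R2 z).2.2
    have base' : ∀ k β c, D (.inr β) (D c (V (.inl k))) = 0 := fun k β c => by
      rw [D_comm, base, D_zero]
    simp only [shift₁, shift₂, vert, horiz, slope, base, base', D_zero, map_zero, Fin.sum_univ_five,
      Fin.sum_univ_three, Fin.reduceEq, Fin.isValue, and_true, and_false, true_and, false_and, or_true,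
      or_false, true_or, false_or, if_true, if_false, zero_mul, mul_zero, add_zero, zero_add,
      sub_zero, ofNat_self] at this
    simp only [map_add, map_sub, map_mul, map_pow, evalAt_X]
    linear_combination this

theorem full_algRelations {U : Opens (Coord 6 3 → 𝕜)} {V : Coord 6 3 → SmoothAlg U}
    (hV : V ∈ algSymmetries (triple 𝕜 6 ++ triple1 𝕜 6) U) :
    FullRelations (X (.inr 2)) (V (.inr 2)) (fun c i => D i (V c)) ∧
      D (.inr 2) (V (.inr 0)) = 0 ∧ D (.inr 2) (V (.inr 1)) = 0 := by
  have hz := fun z : U => (hV z).shift (slope_invariant' (z.1 (.inr 2)))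
  have R := fun z => (full_relations (sub_offset _) (hz z)).of_shift
  have base : ∀ k β, D (.inr β) (V (.inl k)) = 0 := fun k β => ext' fun z => by
    rw [(R z).base, map_zero]
  have R2 := fun z => full_relations₂ (sub_offset _) (hz z)
    (full_relations (sub_offset _) (hz z)).base (shift₂_of_base base z _)
  have ev : ∀ (z : U) (k : Fin 6) (β : Fin 3), evalAt z (D (.inr β) (V (.inl k))) = 0 :=
    fun z k β => (R z).base k β
  refine ⟨.of_evalAt R, ext' fun z => ?_, ext' fun z => ?_⟩
  · rw [map_zero, ← (R2 z).1, shift₁_inr_inr _ (ev z)]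
  · rw [map_zero, ← (R2 z).2, shift₁_inr_inr _ (ev z)]

theorem alttriple_algRelations {U : Opens (Coord 5 3 → 𝕜)} {V : Coord 5 3 → SmoothAlg U}
    (hV : V ∈ algSymmetries (alttriple 𝕜 5) U) :
    AltTripleRelations (X (.inr 2)) (V (.inr 2)) (fun c i => D i (V c)) ∧
      D (.inl 4) (V (.inr 2)) - X (.inr 2) * D (.inr 1) (V (.inr 2))
        = - D (.inr 2) (D (.inl 0) (V (.inr 2))) := by
  have hz := fun z : U => (hV z).shift (altSlope_invariant (z.1 (.inr 2)))
  have R := fun z => (alttriple_relations (sub_offset _) (hz z)).of_shift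
  have base : ∀ k β, D (.inr β) (V (.inl k)) = 0 := fun k β => ext' fun z => by
    rw [(R z).base, map_zero]
  have a15 : D (.inl 0) (V (.inl 1)) = 0 := ext' fun z => by rw [(R z).a15, map_zero]
  have base' : ∀ k β c, D (.inr β) (D c (V (.inl k))) = 0 := fun k β c => by
    rw [D_comm, base, D_zero]
  refine ⟨.of_evalAt R, ext' fun z => ?_⟩
  have := alttriple_relations₂ (sub_offset _) (hz z)
    (alttriple_relations (sub_offset _) (hz z)).base (shift₂_of_base base z _)
    (alttriple_relations (sub_offset _) (hz z)).a14
    (by simp [shift₂, vert, horiz, base, base', a15, D_zero])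
  simp only [shift₁, shift₂, vert, horiz, altSlope, base, base', D_zero, map_zero, Fin.sum_univ_five,
    Fin.sum_univ_three, Fin.reduceEq, Fin.isValue, and_true, and_false, true_and, false_and, or_true,
    or_false, true_or, false_or, if_true, if_false, zero_mul, mul_zero, add_zero, zero_add,
    sub_zero, ofNat_self] at this
  simp only [map_sub, map_neg, map_mul, evalAt_X]
  linear_combination this

theorem altfull_algRelations {U : Opens (Coord 6 3 → 𝕜)} {V : Coord 6 3 → SmoothAlg U}
    (hV : V ∈ algSymmetries (alttriple 𝕜 6 ++ triple2 𝕜 6) U) :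
    AltFullRelations (X (.inr 2)) (V (.inr 2)) (fun c i => D i (V c)) :=
  .of_evalAt fun z =>
    (altfull_relations (sub_offset _) ((hV z).shift (altSlope_invariant' (z.1 (.inr 2))))).of_shift

end AlgebraicRelations

end ScrollSym

namespace ScrollSym

set_option linter.unusedSectionVars false

set_option linter.unusedSimpArgs false

/-! ## Solution operators -/

section Independence

open TopologicalSpace SmoothAlg

variable {𝕜 : Type*} [RCLike 𝕜] {d : ℕ} {U : Opens (Coord d 3 → 𝕜)}

/-- The function `f` does not depend on the coordinate `c`. -/
class Indep (c : Coord d 3) (f : SmoothAlg U) : Prop where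
  D_eq_zero : D c f = 0

/-- Independence passes to derivatives, so instance search lets `simp` discard nested derivatives of
the parameters too. -/
instance (c c' : Coord d 3) (f : SmoothAlg U) [Indep c f] : Indep c (D c' f) :=
  ⟨by rw [D_comm, Indep.D_eq_zero (c := c) (f := f), D_zero]⟩

/-- The basic integration step: if `T` has the prescribed derivative of `V` in the direction `c`,
the constant of integration `V - T` does not depend on `c`. -/
theorem Indep.of_eq {c : Coord d 3} {V T f : SmoothAlg U} (h : V = T + f) (h' : D c V = D c T) :
    Indep c f :=
  ⟨by rw [h, D_add] at h'; exact left_eq_add.1 h'.symm⟩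

theorem D_two (c : Coord d 3) : D c (2 : SmoothAlg U) = 0 := D_ofNat c 2

theorem D_three (c : Coord d 3) : D c (3 : SmoothAlg U) = 0 := D_ofNat c 3

/-- The constant function `1 / 6`. -/
noncomputable def sixth : SmoothAlg U := algebraMap 𝕜 _ (1 / 6)

theorem D_sixth (c : Coord d 3) : D c (sixth : SmoothAlg U) = 0 := D_algebraMap _ _

theorem evalAt_sixth (z : U) : evalAt z sixth = (1 / 6 : 𝕜) := AlgHom.commutes _ _

end Independence

attribute [simp] D_add D_sub D_mul D_neg D_zero D_two D_three D_half D_sixth D_X Indep.D_eq_zero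

/-! ### Parametrisation of the symmetries of `triple`. -/

section Triple

open TopologicalSpace SmoothAlg

variable {𝕜 : Type*} [RCLike 𝕜] {U : Opens (Coord 5 3 → 𝕜)}

local notation "𝐱" i:max => X (U := U) (Sum.inl i)
local notation "𝐲" α:max => X (U := U) (Sum.inr α)
local notation "𝐝" i:max f:max => D (U := U) (Sum.inl i) f

/-- The part of the component `a²` of a symmetry of `triple` that is determined by the
preceding parameters; similarly below. -/
noncomputable def tripleA₂ (e p g : SmoothAlg U) : SmoothAlg U :=
  𝐱 2 * (𝐝 4 p + g - 𝐝 0 e) + 𝐱 3 * 𝐝 0 p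

/-- Not part of a component but of the derivative ∂₃a¹; the remainder of that derivative is the
parameter m. -/
noncomputable def tripleM (e g : SmoothAlg U) : SmoothAlg U :=
  𝐱 2 * 𝐝 4 g + 𝐱 3 * (2 * 𝐝 0 g - 𝐝 0 (𝐝 0 e))

noncomputable def tripleA₁ (e g h m : SmoothAlg U) : SmoothAlg U :=
  𝐱 1 * (2 * g - 𝐝 0 e) + 𝐱 2 * (𝐱 3 * 𝐝 4 g + 𝐝 4 h) + 𝐱 3 * (𝐱 3 * (𝐝 0 g - half * 𝐝 0 (𝐝 0 e))
    + m)

noncomputable def tripleU (e p g h k m : SmoothAlg U) : SmoothAlg U :=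
  𝐲 0 * (𝐝 4 p + 2 * g - 2 * 𝐝 0 e) + 𝐱 1 * 𝐝 0 p + 𝐱 2 * (𝐱 2 * (half * 𝐝 4 (𝐝 4 p) + 𝐝 4 g)
    + 𝐱 3 * (𝐝 4 (𝐝 0 p) + 𝐝 0 g - 𝐝 0 (𝐝 0 e)) + m + 𝐝 4 k - 𝐝 0 h)
    + 𝐱 3 * (𝐱 3 * (half * 𝐝 0 (𝐝 0 p)) + 𝐝 0 k)

noncomputable def tripleW (e g h m : SmoothAlg U) : SmoothAlg U :=
  𝐲 2 * (2 * g - 2 * 𝐝 0 e) + 𝐲 0 * 𝐝 4 g + 𝐱 1 * (𝐝 0 g - 𝐝 0 (𝐝 0 e))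
    + 𝐱 2 * (𝐱 2 * (half * 𝐝 4 (𝐝 4 g)) + 𝐱 3 * 𝐝 4 (𝐝 0 g) + 𝐝 4 m - 𝐝 4 (𝐝 0 h))
    + 𝐱 3 * (𝐱 3 * (half * 𝐝 0 (𝐝 0 g) - half * 𝐝 0 (𝐝 0 (𝐝 0 e))) + 𝐝 0 m - 𝐝 0 (𝐝 0 h))

noncomputable def tripleV (e g h m n s : SmoothAlg U) : SmoothAlg U :=
  𝐲 1 * (3 * g - 2 * 𝐝 0 e) + 𝐲 0 * (𝐱 3 * 𝐝 4 g + 𝐝 4 h) + 𝐱 1 * (𝐱 2 * (2 * 𝐝 4 g)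
    + 𝐱 3 * (3 * 𝐝 0 g - 2 * 𝐝 0 (𝐝 0 e)) + 2 * m - 𝐝 0 h)
    + 𝐱 2 * (𝐱 2 * (𝐱 3 * (half * 𝐝 4 (𝐝 4 g)) + half * 𝐝 4 (𝐝 4 h)) + 𝐱 3 * (𝐱 3 * 𝐝 4 (𝐝 0 g)
    + 𝐝 4 m) + 𝐝 4 n) + 𝐱 3 * (𝐱 3 * (𝐱 3 * (half * 𝐝 0 (𝐝 0 g) - 2 * sixth * 𝐝 0 (𝐝 0 (𝐝 0 e)))
    + 𝐝 0 m - half * 𝐝 0 (𝐝 0 h)) + s + 𝐝 0 n)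

/-- The symmetries of `triple`, in terms of nine functions of `x⁴, x⁵` and a function of `x⁵`. -/
noncomputable def tripleP (f : Fin 9 ⊕ Fin 1 → SmoothAlg U) : Coord 5 3 → SmoothAlg U :=
  let p := f (.inl 0); let g := f (.inl 1); let h := f (.inl 2); let k := f (.inl 3)
  let m := f (.inl 4); let n := f (.inl 5); let s := f (.inl 6); let e := f (.inr 0)
  Sum.elim ![e, tripleA₁ e g h m + n, tripleA₂ e p g + k, 𝐱 3 * g + h, p]
    ![tripleU e p g h k m + f (.inl 7), tripleV e g h m n s + f (.inl 8), tripleW e g h m + s]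

/-- The inverse of `tripleP`. -/
noncomputable def tripleQ (V : Coord 5 3 → SmoothAlg U) : Fin 9 ⊕ Fin 1 → SmoothAlg U :=
  let e := V (.inl 0); let p := V (.inl 4); let g := 𝐝 3 (V (.inl 3))
  let h := V (.inl 3) - 𝐱 3 * g; let k := V (.inl 2) - tripleA₂ e p g
  let m := 𝐝 3 (V (.inl 1)) - tripleM e g; let n := V (.inl 1) - tripleA₁ e g h m
  let s := V (.inr 2) - tripleW e g h m
  Sum.elim ![p, g, h, k, m, n, s,
    V (.inr 0) - tripleU e p g h k m, V (.inr 1) - tripleV e g h m n s]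
    ![e]

section

variable {κ : Type*} {e p g h m k n s : (κ → SmoothAlg U) → SmoothAlg U}

theorem isAlgOp_tripleA₂ (he : IsAlgOp e) (hp : IsAlgOp p) (hg : IsAlgOp g) :
    IsAlgOp fun f => tripleA₂ (e f) (p f) (g f) := by
  unfold tripleA₂
  repeat' apply_rules [IsAlgOp.add, IsAlgOp.mul, IsAlgOp.sub, IsAlgOp.deriv]

theorem isAlgOp_tripleM (he : IsAlgOp e) (hg : IsAlgOp g) :
    IsAlgOp fun f => tripleM (e f) (g f) := by
  unfold tripleM
  repeat' apply_rules [IsAlgOp.add, IsAlgOp.mul, IsAlgOp.sub, IsAlgOp.deriv]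

theorem isAlgOp_tripleA₁ (he : IsAlgOp e) (hg : IsAlgOp g) (hh : IsAlgOp h) (hm : IsAlgOp m) :
    IsAlgOp fun f => tripleA₁ (e f) (g f) (h f) (m f) := by
  unfold tripleA₁
  repeat' apply_rules [IsAlgOp.add, IsAlgOp.mul, IsAlgOp.sub, IsAlgOp.deriv]

theorem isAlgOp_tripleU (he : IsAlgOp e) (hp : IsAlgOp p) (hg : IsAlgOp g) (hh : IsAlgOp h) (hk : IsAlgOp k) (hm : IsAlgOp m) :
    IsAlgOp fun f => tripleU (e f) (p f) (g f) (h f) (k f) (m f) := by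
  unfold tripleU
  repeat' apply_rules [IsAlgOp.add, IsAlgOp.mul, IsAlgOp.sub, IsAlgOp.deriv]

theorem isAlgOp_tripleW (he : IsAlgOp e) (hg : IsAlgOp g) (hh : IsAlgOp h) (hm : IsAlgOp m) :
    IsAlgOp fun f => tripleW (e f) (g f) (h f) (m f) := by
  unfold tripleW
  repeat' apply_rules [IsAlgOp.add, IsAlgOp.mul, IsAlgOp.sub, IsAlgOp.deriv]

theorem isAlgOp_tripleV (he : IsAlgOp e) (hg : IsAlgOp g) (hh : IsAlgOp h) (hm : IsAlgOp m) (hn : IsAlgOp n) (hs : IsAlgOp s) :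
    IsAlgOp fun f => tripleV (e f) (g f) (h f) (m f) (n f) (s f) := by
  unfold tripleV
  repeat' apply_rules [IsAlgOp.add, IsAlgOp.mul, IsAlgOp.sub, IsAlgOp.deriv]

end

theorem isAlgOp_tripleP (c : Coord 5 3) :
    IsAlgOp fun f : Fin 9 ⊕ Fin 1 → SmoothAlg U => tripleP f c := by
  have hp : IsAlgOp fun f : Fin 9 ⊕ Fin 1 → SmoothAlg U => f (.inl 0) := .comp _
  have hg : IsAlgOp fun f : Fin 9 ⊕ Fin 1 → SmoothAlg U => f (.inl 1) := .comp _
  have hh : IsAlgOp fun f : Fin 9 ⊕ Fin 1 → SmoothAlg U => f (.inl 2) := .comp _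
  have hk : IsAlgOp fun f : Fin 9 ⊕ Fin 1 → SmoothAlg U => f (.inl 3) := .comp _
  have hm : IsAlgOp fun f : Fin 9 ⊕ Fin 1 → SmoothAlg U => f (.inl 4) := .comp _
  have hn : IsAlgOp fun f : Fin 9 ⊕ Fin 1 → SmoothAlg U => f (.inl 5) := .comp _
  have hs : IsAlgOp fun f : Fin 9 ⊕ Fin 1 → SmoothAlg U => f (.inl 6) := .comp _
  have he : IsAlgOp fun f : Fin 9 ⊕ Fin 1 → SmoothAlg U => f (.inr 0) := .comp _
  rcases c with c | c <;> fin_cases c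
  exacts [he, ((isAlgOp_tripleA₁ he hg hh hm).add _ _ hn),
    ((isAlgOp_tripleA₂ he hp hg).add _ _ hk), (hg.mul _).add _ _ hh, hp,
    ((isAlgOp_tripleU he hp hg hh hk hm).add _ _ (.comp _)),
    ((isAlgOp_tripleV he hg hh hm hn hs).add _ _ (.comp _)),
    ((isAlgOp_tripleW he hg hh hm).add _ _ hs)]

theorem isAlgOp_tripleQ (k : Fin 9 ⊕ Fin 1) :
    IsAlgOp fun V : Coord 5 3 → SmoothAlg U => tripleQ V k := by
  have hV (c) : IsAlgOp fun V : Coord 5 3 → SmoothAlg U => V c := .comp _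
  have he := hV (.inl 0)
  have hp := hV (.inl 4)
  have hg := (hV (.inl 3)).deriv (.inl 3) _
  have hh := (hV (.inl 3)).sub (hg.mul (𝐱 3))
  have hk := (hV (.inl 2)).sub (isAlgOp_tripleA₂ he hp hg)
  have hm := ((hV (.inl 1)).deriv (.inl 3) _).sub (isAlgOp_tripleM he hg)
  have hn := (hV (.inl 1)).sub (isAlgOp_tripleA₁ he hg hh hm)
  have hs := (hV (.inr 2)).sub (isAlgOp_tripleW he hg hh hm)
  rcases k with k | k <;> fin_cases k
  exacts [hp, hg, hh, hk, hm, hn, hs, (hV _).sub (isAlgOp_tripleU he hp hg hh hk hm),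
    (hV _).sub (isAlgOp_tripleV he hg hh hm hn hs), he]

/-- True for arbitrary `V`: every component of `tripleP` ends in a parameter of its own, which
`tripleQ` defines as the component minus the part determined by earlier parameters. The parameters g
and m, read off from derivatives, enter determined parts only and cancel. -/
theorem tripleP_tripleQ (V : Coord 5 3 → SmoothAlg U) (c : Coord 5 3) :
    tripleP (tripleQ V) c = V c := by
  rcases c with c | c <;> fin_cases c
  exacts [rfl, add_sub_cancel _ _, add_sub_cancel _ _, add_sub_cancel _ _, rfl,
    add_sub_cancel _ _, add_sub_cancel _ _, add_sub_cancel _ _]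

end Triple

/-! ### Parametrisation of the symmetries of `triple ++ triple1`. -/

section Full

open TopologicalSpace SmoothAlg

variable {𝕜 : Type*} [RCLike 𝕜] {U : Opens (Coord 6 3 → 𝕜)}

local notation "𝐱" i:max => X (U := U) (Sum.inl i)
local notation "𝐲" α:max => X (U := U) (Sum.inr α)
local notation "𝐝" i:max f:max => D (U := U) (Sum.inl i) f

/-- The part of the component `a³` of a symmetry of `triple ++ triple1` that is determined by the
preceding parameters; similarly below. -/
noncomputable def fullA₃ (e g : SmoothAlg U) : SmoothAlg U :=
  𝐱 3 * g + 𝐱 4 * 𝐝 0 e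

noncomputable def fullA₄ (e p g : SmoothAlg U) : SmoothAlg U :=
  𝐱 3 * 𝐝 5 p + 𝐱 4 * (g + 𝐝 0 p - 𝐝 5 e)

/-- As in five variables, this belongs to ∂₃a¹, and what remains of that derivative is the parameter
m. -/
noncomputable def fullM (e g : SmoothAlg U) : SmoothAlg U :=
  𝐱 3 * (2 * 𝐝 5 g - 𝐝 5 (𝐝 5 e)) + 𝐱 4 * 𝐝 0 g

noncomputable def fullA₁ (e g h m : SmoothAlg U) : SmoothAlg U :=
  𝐱 1 * (2 * g - 𝐝 5 e) + 𝐱 2 * 𝐝 0 e + 𝐱 3 * (𝐱 3 * (𝐝 5 g - half * 𝐝 5 (𝐝 5 e)) + 𝐱 4 * 𝐝 0 g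
    + m) + 𝐱 4 * (𝐱 4 * (half * 𝐝 0 (𝐝 0 e)) + 𝐝 0 h)

noncomputable def fullA₂ (e p g h k m : SmoothAlg U) : SmoothAlg U :=
  𝐱 1 * 𝐝 5 p + 𝐱 2 * (𝐝 0 p + 2 * g - 2 * 𝐝 5 e) + 𝐱 3 * (𝐱 3 * (half * 𝐝 5 (𝐝 5 p))
    + 𝐱 4 * (𝐝 5 g + 𝐝 5 (𝐝 0 p) - 𝐝 5 (𝐝 5 e)) + 𝐝 5 k) + 𝐱 4 * (𝐱 4 * (𝐝 0 g
    + half * 𝐝 0 (𝐝 0 p) - 𝐝 5 (𝐝 0 e)) + 𝐝 0 k + m - 𝐝 5 h)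

noncomputable def fullW (e g h m : SmoothAlg U) : SmoothAlg U :=
  𝐲 2 * (2 * g - 2 * 𝐝 5 e) + 𝐱 1 * (𝐝 5 g - 𝐝 5 (𝐝 5 e)) + 𝐱 2 * (𝐝 0 g - 𝐝 5 (𝐝 0 e))
    + 𝐱 3 * (𝐱 3 * (half * 𝐝 5 (𝐝 5 g) - half * 𝐝 5 (𝐝 5 (𝐝 5 e))) + 𝐱 4 * (𝐝 5 (𝐝 0 g)
    - 𝐝 5 (𝐝 5 (𝐝 0 e))) + 𝐝 5 m - 𝐝 5 (𝐝 5 h)) + 𝐱 4 * (𝐱 4 * (half * 𝐝 0 (𝐝 0 g)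
    - half * 𝐝 5 (𝐝 0 (𝐝 0 e))) + 𝐝 0 m - 𝐝 5 (𝐝 0 h))

noncomputable def fullU (e p g h k m l s : SmoothAlg U) : SmoothAlg U :=
  𝐲 0 * (3 * g + 𝐝 0 p - 3 * 𝐝 5 e) + 𝐲 1 * 𝐝 5 p + 𝐱 1 * (𝐱 3 * 𝐝 5 (𝐝 5 p) + 𝐱 4 * (𝐝 5 g
    + 𝐝 5 (𝐝 0 p) - 𝐝 5 (𝐝 5 e)) + 𝐝 5 k) + 𝐱 2 * (𝐱 3 * (2 * 𝐝 5 g + 𝐝 5 (𝐝 0 p)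
    - 2 * 𝐝 5 (𝐝 5 e)) + 𝐱 4 * (3 * 𝐝 0 g + 𝐝 0 (𝐝 0 p) - 3 * 𝐝 5 (𝐝 0 e)) + 2 * m + 𝐝 0 k
    - 2 * 𝐝 5 h) + 𝐱 3 * (𝐱 3 * (𝐱 3 * (sixth * 𝐝 5 (𝐝 5 (𝐝 5 p))) + 𝐱 4 * (half * (𝐝 5 (𝐝 5 g)
    + 𝐝 5 (𝐝 5 (𝐝 0 p)) - 𝐝 5 (𝐝 5 (𝐝 5 e)))) + half * 𝐝 5 (𝐝 5 k)) + 𝐱 4 * (𝐱 4 * (𝐝 5 (𝐝 0 g)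
    + half * 𝐝 5 (𝐝 0 (𝐝 0 p)) - 𝐝 5 (𝐝 5 (𝐝 0 e))) + 𝐝 5 (𝐝 0 k) + 𝐝 5 m - 𝐝 5 (𝐝 5 h)) + 𝐝 5 l)
    + 𝐱 4 * (𝐱 4 * (𝐱 4 * (half * 𝐝 0 (𝐝 0 g) + sixth * 𝐝 0 (𝐝 0 (𝐝 0 p))
    - half * 𝐝 5 (𝐝 0 (𝐝 0 e))) + half * 𝐝 0 (𝐝 0 k) + 𝐝 0 m - 𝐝 5 (𝐝 0 h)) + s + 𝐝 0 l)

noncomputable def fullV (e g h m n s : SmoothAlg U) : SmoothAlg U :=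
  𝐲 1 * (3 * g - 2 * 𝐝 5 e) + 𝐲 0 * 𝐝 0 e + 𝐱 1 * (𝐱 3 * (3 * 𝐝 5 g - 2 * 𝐝 5 (𝐝 5 e))
    + 𝐱 4 * (2 * 𝐝 0 g - 𝐝 5 (𝐝 0 e)) + 2 * m - 𝐝 5 h) + 𝐱 2 * (𝐱 3 * 𝐝 0 g + 𝐱 4 * 𝐝 0 (𝐝 0 e)
    + 𝐝 0 h) + 𝐱 3 * (𝐱 3 * (𝐱 3 * (half * 𝐝 5 (𝐝 5 g) - 2 * sixth * 𝐝 5 (𝐝 5 (𝐝 5 e)))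
    + 𝐱 4 * (𝐝 5 (𝐝 0 g) - half * 𝐝 5 (𝐝 5 (𝐝 0 e))) + 𝐝 5 m - half * 𝐝 5 (𝐝 5 h))
    + 𝐱 4 * (𝐱 4 * (half * 𝐝 0 (𝐝 0 g)) + 𝐝 0 m) + s + 𝐝 5 n)
    + 𝐱 4 * (𝐱 4 * (𝐱 4 * (sixth * 𝐝 0 (𝐝 0 (𝐝 0 e))) + half * 𝐝 0 (𝐝 0 h)) + 𝐝 0 n)

/-- The symmetries of `triple ++ triple1`, in terms of eleven functions of `x⁵, x⁶`. -/
noncomputable def fullP (f : Fin 11 → SmoothAlg U) : Coord 6 3 → SmoothAlg U :=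
  let e := f 0; let p := f 1; let g := f 2; let h := f 3; let k := f 4; let m := f 5
  let n := f 6; let l := f 7; let s := f 8
  Sum.elim ![p, fullA₁ e g h m + n, fullA₂ e p g h k m + l, fullA₃ e g + h, fullA₄ e p g + k, e]
    ![fullU e p g h k m l s + f 9, fullV e g h m n s + f 10, fullW e g h m + s]

/-- The inverse of `fullP`. -/
noncomputable def fullQ (V : Coord 6 3 → SmoothAlg U) : Fin 11 → SmoothAlg U :=
  let e := V (.inl 5); let p := V (.inl 0); let g := 𝐝 3 (V (.inl 3))
  let h := V (.inl 3) - fullA₃ e g; let k := V (.inl 4) - fullA₄ e p g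
  let m := 𝐝 3 (V (.inl 1)) - fullM e g; let n := V (.inl 1) - fullA₁ e g h m
  let l := V (.inl 2) - fullA₂ e p g h k m; let s := V (.inr 2) - fullW e g h m
  ![e, p, g, h, k, m, n, l, s, V (.inr 0) - fullU e p g h k m l s, V (.inr 1) - fullV e g h m n s]

section

variable {κ : Type*} {e g p h m k l s n : (κ → SmoothAlg U) → SmoothAlg U}

theorem isAlgOp_fullA₃ (he : IsAlgOp e) (hg : IsAlgOp g) :
    IsAlgOp fun f => fullA₃ (e f) (g f) := by
  unfold fullA₃
  repeat' apply_rules [IsAlgOp.add, IsAlgOp.mul, IsAlgOp.sub, IsAlgOp.deriv]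

theorem isAlgOp_fullA₄ (he : IsAlgOp e) (hp : IsAlgOp p) (hg : IsAlgOp g) :
    IsAlgOp fun f => fullA₄ (e f) (p f) (g f) := by
  unfold fullA₄
  repeat' apply_rules [IsAlgOp.add, IsAlgOp.mul, IsAlgOp.sub, IsAlgOp.deriv]

theorem isAlgOp_fullM (he : IsAlgOp e) (hg : IsAlgOp g) :
    IsAlgOp fun f => fullM (e f) (g f) := by
  unfold fullM
  repeat' apply_rules [IsAlgOp.add, IsAlgOp.mul, IsAlgOp.sub, IsAlgOp.deriv]

theorem isAlgOp_fullA₁ (he : IsAlgOp e) (hg : IsAlgOp g) (hh : IsAlgOp h) (hm : IsAlgOp m) :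
    IsAlgOp fun f => fullA₁ (e f) (g f) (h f) (m f) := by
  unfold fullA₁
  repeat' apply_rules [IsAlgOp.add, IsAlgOp.mul, IsAlgOp.sub, IsAlgOp.deriv]

theorem isAlgOp_fullA₂ (he : IsAlgOp e) (hp : IsAlgOp p) (hg : IsAlgOp g) (hh : IsAlgOp h) (hk : IsAlgOp k) (hm : IsAlgOp m) :
    IsAlgOp fun f => fullA₂ (e f) (p f) (g f) (h f) (k f) (m f) := by
  unfold fullA₂
  repeat' apply_rules [IsAlgOp.add, IsAlgOp.mul, IsAlgOp.sub, IsAlgOp.deriv]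

theorem isAlgOp_fullW (he : IsAlgOp e) (hg : IsAlgOp g) (hh : IsAlgOp h) (hm : IsAlgOp m) :
    IsAlgOp fun f => fullW (e f) (g f) (h f) (m f) := by
  unfold fullW
  repeat' apply_rules [IsAlgOp.add, IsAlgOp.mul, IsAlgOp.sub, IsAlgOp.deriv]

theorem isAlgOp_fullU (he : IsAlgOp e) (hp : IsAlgOp p) (hg : IsAlgOp g) (hh : IsAlgOp h) (hk : IsAlgOp k) (hm : IsAlgOp m) (hl : IsAlgOp l) (hs : IsAlgOp s) :
    IsAlgOp fun f => fullU (e f) (p f) (g f) (h f) (k f) (m f) (l f) (s f) := by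
  unfold fullU
  repeat' apply_rules [IsAlgOp.add, IsAlgOp.mul, IsAlgOp.sub, IsAlgOp.deriv]

theorem isAlgOp_fullV (he : IsAlgOp e) (hg : IsAlgOp g) (hh : IsAlgOp h) (hm : IsAlgOp m) (hn : IsAlgOp n) (hs : IsAlgOp s) :
    IsAlgOp fun f => fullV (e f) (g f) (h f) (m f) (n f) (s f) := by
  unfold fullV
  repeat' apply_rules [IsAlgOp.add, IsAlgOp.mul, IsAlgOp.sub, IsAlgOp.deriv]

end

theorem isAlgOp_fullP (c : Coord 6 3) :
    IsAlgOp fun f : Fin 11 → SmoothAlg U => fullP f c := by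
  have he : IsAlgOp fun f : Fin 11 → SmoothAlg U => f 0 := .comp _
  have hp : IsAlgOp fun f : Fin 11 → SmoothAlg U => f 1 := .comp _
  have hg : IsAlgOp fun f : Fin 11 → SmoothAlg U => f 2 := .comp _
  have hh : IsAlgOp fun f : Fin 11 → SmoothAlg U => f 3 := .comp _
  have hk : IsAlgOp fun f : Fin 11 → SmoothAlg U => f 4 := .comp _
  have hm : IsAlgOp fun f : Fin 11 → SmoothAlg U => f 5 := .comp _
  have hn : IsAlgOp fun f : Fin 11 → SmoothAlg U => f 6 := .comp _
  have hl : IsAlgOp fun f : Fin 11 → SmoothAlg U => f 7 := .comp _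
  have hs : IsAlgOp fun f : Fin 11 → SmoothAlg U => f 8 := .comp _
  rcases c with c | c <;> fin_cases c
  exacts [hp, ((isAlgOp_fullA₁ he hg hh hm).add _ _ hn),
    ((isAlgOp_fullA₂ he hp hg hh hk hm).add _ _ hl), ((isAlgOp_fullA₃ he hg).add _ _ hh),
    ((isAlgOp_fullA₄ he hp hg).add _ _ hk), he,
    ((isAlgOp_fullU he hp hg hh hk hm hl hs).add _ _ (.comp _)),
    ((isAlgOp_fullV he hg hh hm hn hs).add _ _ (.comp _)),
    ((isAlgOp_fullW he hg hh hm).add _ _ hs)]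

theorem isAlgOp_fullQ (k : Fin 11) :
    IsAlgOp fun V : Coord 6 3 → SmoothAlg U => fullQ V k := by
  have hV (c) : IsAlgOp fun V : Coord 6 3 → SmoothAlg U => V c := .comp _
  have he := hV (.inl 5)
  have hp := hV (.inl 0)
  have hg := (hV (.inl 3)).deriv (.inl 3) _
  have hh := (hV (.inl 3)).sub (isAlgOp_fullA₃ he hg)
  have hk := (hV (.inl 4)).sub (isAlgOp_fullA₄ he hp hg)
  have hm := ((hV (.inl 1)).deriv (.inl 3) _).sub (isAlgOp_fullM he hg)
  have hn := (hV (.inl 1)).sub (isAlgOp_fullA₁ he hg hh hm)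
  have hl := (hV (.inl 2)).sub (isAlgOp_fullA₂ he hp hg hh hk hm)
  have hs := (hV (.inr 2)).sub (isAlgOp_fullW he hg hh hm)
  fin_cases k
  exacts [he, hp, hg, hh, hk, hm, hn, hl, hs, (hV _).sub (isAlgOp_fullU he hp hg hh hk hm hl hs),
    (hV _).sub (isAlgOp_fullV he hg hh hm hn hs)]

theorem fullP_fullQ (V : Coord 6 3 → SmoothAlg U) (c : Coord 6 3) :
    fullP (fullQ V) c = V c := by
  rcases c with c | c <;> fin_cases c
  exacts [rfl, add_sub_cancel _ _, add_sub_cancel _ _, add_sub_cancel _ _, add_sub_cancel _ _,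
    rfl, add_sub_cancel _ _, add_sub_cancel _ _, add_sub_cancel _ _]

end Full

/-! ### Parametrisation of the symmetries of `alttriple`. -/

section Alttriple

open TopologicalSpace SmoothAlg

variable {𝕜 : Type*} [RCLike 𝕜] {U : Opens (Coord 5 3 → 𝕜)}

local notation "𝐱" i:max => X (U := U) (Sum.inl i)
local notation "𝐲" α:max => X (U := U) (Sum.inr α)
local notation "𝐝" i:max f:max => D (U := U) (Sum.inl i) f

/-- The part of the `w`-component of a symmetry of `alttriple` that is determined by the
preceding parameters; similarly below. -/
noncomputable def alttripleW (e g : SmoothAlg U) : SmoothAlg U :=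
  𝐲 2 * (g - 𝐝 0 e) - 𝐲 0 * 𝐝 3 g + 𝐱 4 * (𝐝 0 (𝐝 0 e) - 𝐝 0 g)

noncomputable def alttripleU (e p g : SmoothAlg U) : SmoothAlg U :=
  𝐲 0 * (𝐝 3 p + g - 𝐝 0 e) + 𝐱 4 * 𝐝 0 p

noncomputable def alttripleV (e g h s : SmoothAlg U) : SmoothAlg U :=
  𝐲 1 * (2 * g - 𝐝 0 e) + 𝐲 0 * (𝐱 4 * 𝐝 3 g + 𝐝 3 h) + 𝐱 4 * (𝐱 4 * (𝐝 0 g - half * 𝐝 0 (𝐝 0 e))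
    + 𝐝 0 h - s)

/-- The symmetries of `alttriple`, in terms of two functions of `x¹, x²`, six functions of `x³, x⁵` and a function of `x⁵`. -/
noncomputable def alttripleP (f : (Fin 2 ⊕ Fin 6) ⊕ Fin 1 → SmoothAlg U) : Coord 5 3 → SmoothAlg U :=
  let a := f (.inl (.inl 0)); let b := f (.inl (.inl 1)); let p := f (.inl (.inr 0))
  let g := f (.inl (.inr 1)); let h := f (.inl (.inr 2)); let s := f (.inl (.inr 3))
  let e := f (.inr 0)
  Sum.elim ![e, a, b, p, 𝐱 4 * g + h]
    ![alttripleU e p g + f (.inl (.inr 4)), alttripleV e g h s + f (.inl (.inr 5)), alttripleW e g + s]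

/-- The inverse of `alttripleP`. -/
noncomputable def alttripleQ (V : Coord 5 3 → SmoothAlg U) : (Fin 2 ⊕ Fin 6) ⊕ Fin 1 → SmoothAlg U :=
  let e := V (.inl 0); let g := 𝐝 4 (V (.inl 4)); let h := V (.inl 4) - 𝐱 4 * g
  let p := V (.inl 3); let s := V (.inr 2) - alttripleW e g
  Sum.elim (Sum.elim ![V (.inl 1), V (.inl 2)] ![p, g, h, s,
    V (.inr 0) - alttripleU e p g, V (.inr 1) - alttripleV e g h s])
    ![e]

section

variable {κ : Type*} {e g p h s : (κ → SmoothAlg U) → SmoothAlg U}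

theorem isAlgOp_alttripleW (he : IsAlgOp e) (hg : IsAlgOp g) :
    IsAlgOp fun f => alttripleW (e f) (g f) := by
  unfold alttripleW
  repeat' apply_rules [IsAlgOp.add, IsAlgOp.mul, IsAlgOp.sub, IsAlgOp.deriv]

theorem isAlgOp_alttripleU (he : IsAlgOp e) (hp : IsAlgOp p) (hg : IsAlgOp g) :
    IsAlgOp fun f => alttripleU (e f) (p f) (g f) := by
  unfold alttripleU
  repeat' apply_rules [IsAlgOp.add, IsAlgOp.mul, IsAlgOp.sub, IsAlgOp.deriv]

theorem isAlgOp_alttripleV (he : IsAlgOp e) (hg : IsAlgOp g) (hh : IsAlgOp h) (hs : IsAlgOp s) :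
    IsAlgOp fun f => alttripleV (e f) (g f) (h f) (s f) := by
  unfold alttripleV
  repeat' apply_rules [IsAlgOp.add, IsAlgOp.mul, IsAlgOp.sub, IsAlgOp.deriv]

end

theorem isAlgOp_alttripleP (c : Coord 5 3) :
    IsAlgOp fun f : (Fin 2 ⊕ Fin 6) ⊕ Fin 1 → SmoothAlg U => alttripleP f c := by
  have ha : IsAlgOp fun f : (Fin 2 ⊕ Fin 6) ⊕ Fin 1 → SmoothAlg U => f (.inl (.inl 0)) := .comp _
  have hb : IsAlgOp fun f : (Fin 2 ⊕ Fin 6) ⊕ Fin 1 → SmoothAlg U => f (.inl (.inl 1)) := .comp _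
  have hp : IsAlgOp fun f : (Fin 2 ⊕ Fin 6) ⊕ Fin 1 → SmoothAlg U => f (.inl (.inr 0)) := .comp _
  have hg : IsAlgOp fun f : (Fin 2 ⊕ Fin 6) ⊕ Fin 1 → SmoothAlg U => f (.inl (.inr 1)) := .comp _
  have hh : IsAlgOp fun f : (Fin 2 ⊕ Fin 6) ⊕ Fin 1 → SmoothAlg U => f (.inl (.inr 2)) := .comp _
  have hs : IsAlgOp fun f : (Fin 2 ⊕ Fin 6) ⊕ Fin 1 → SmoothAlg U => f (.inl (.inr 3)) := .comp _
  have he : IsAlgOp fun f : (Fin 2 ⊕ Fin 6) ⊕ Fin 1 → SmoothAlg U => f (.inr 0) := .comp _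
  rcases c with c | c <;> fin_cases c
  exacts [he, ha, hb, hp, (hg.mul _).add _ _ hh,
    ((isAlgOp_alttripleU he hp hg).add _ _ (.comp _)),
    ((isAlgOp_alttripleV he hg hh hs).add _ _ (.comp _)),
    ((isAlgOp_alttripleW he hg).add _ _ hs)]

theorem isAlgOp_alttripleQ (k : (Fin 2 ⊕ Fin 6) ⊕ Fin 1) :
    IsAlgOp fun V : Coord 5 3 → SmoothAlg U => alttripleQ V k := by
  have hV (c) : IsAlgOp fun V : Coord 5 3 → SmoothAlg U => V c := .comp _
  have he := hV (.inl 0)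
  have hg := (hV (.inl 4)).deriv (.inl 4) _
  have hh := (hV (.inl 4)).sub (hg.mul (𝐱 4))
  have hp := hV (.inl 3)
  have hs := (hV (.inr 2)).sub (isAlgOp_alttripleW he hg)
  rcases k with (k | k) | k <;> fin_cases k
  exacts [hV _, hV _, hp, hg, hh, hs, (hV _).sub (isAlgOp_alttripleU he hp hg),
    (hV _).sub (isAlgOp_alttripleV he hg hh hs), he]

theorem alttripleP_alttripleQ (V : Coord 5 3 → SmoothAlg U) (c : Coord 5 3) :
    alttripleP (alttripleQ V) c = V c := by
  rcases c with c | c <;> fin_cases c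
  exacts [rfl, rfl, rfl, rfl, add_sub_cancel _ _, add_sub_cancel _ _, add_sub_cancel _ _,
    add_sub_cancel _ _]

end Alttriple

/-! ### Parametrisation of the symmetries of `alttriple ++ triple2`. -/

section Altfull

open TopologicalSpace SmoothAlg

variable {𝕜 : Type*} [RCLike 𝕜] {U : Opens (Coord 6 3 → 𝕜)}

local notation "𝐱" i:max => X (U := U) (Sum.inl i)
local notation "𝐲" α:max => X (U := U) (Sum.inr α)
local notation "𝐝" i:max f:max => D (U := U) (Sum.inl i) f

/-- The part of the component `a³` of a symmetry of `alttriple ++ triple2` that is determined by the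
preceding parameters; similarly below. -/
noncomputable def altfullA₃ (e p g : SmoothAlg U) : SmoothAlg U :=
  𝐱 3 * (g + 𝐝 0 p - 𝐝 5 e) + 𝐱 4 * 𝐝 5 p

noncomputable def altfullA₄ (e g : SmoothAlg U) : SmoothAlg U :=
  𝐱 3 * 𝐝 0 e + 𝐱 4 * g

noncomputable def altfullW (e g : SmoothAlg U) : SmoothAlg U :=
  𝐲 2 * (g - 𝐝 5 e) + 𝐱 3 * (𝐝 5 (𝐝 0 e) - 𝐝 0 g) + 𝐱 4 * (𝐝 5 (𝐝 5 e) - 𝐝 5 g)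

noncomputable def altfullU (e p g h s : SmoothAlg U) : SmoothAlg U :=
  𝐲 0 * (2 * g + 𝐝 0 p - 2 * 𝐝 5 e) + 𝐲 1 * 𝐝 5 p + 𝐱 3 * (𝐱 3 * (𝐝 0 g + half * 𝐝 0 (𝐝 0 p)
    - 𝐝 5 (𝐝 0 e)) + 𝐱 4 * (𝐝 5 g + 𝐝 5 (𝐝 0 p) - 𝐝 5 (𝐝 5 e)) + 𝐝 0 h - s)
    + 𝐱 4 * (𝐱 4 * (half * 𝐝 5 (𝐝 5 p)) + 𝐝 5 h)

noncomputable def altfullV (e g k s : SmoothAlg U) : SmoothAlg U :=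
  𝐲 1 * (2 * g - 𝐝 5 e) + 𝐲 0 * 𝐝 0 e + 𝐱 3 * (𝐱 3 * (half * 𝐝 0 (𝐝 0 e)) + 𝐱 4 * 𝐝 0 g + 𝐝 0 k)
    + 𝐱 4 * (𝐱 4 * (𝐝 5 g - half * 𝐝 5 (𝐝 5 e)) + 𝐝 5 k - s)

/-- The symmetries of `alttriple ++ triple2`, in terms of two functions of `x¹, x²` and eight functions of `x⁵, x⁶`. -/
noncomputable def altfullP (f : Fin 2 ⊕ Fin 8 → SmoothAlg U) : Coord 6 3 → SmoothAlg U :=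
  let a := f (.inl 0); let b := f (.inl 1); let e := f (.inr 0); let p := f (.inr 1)
  let g := f (.inr 2); let h := f (.inr 3); let k := f (.inr 4); let s := f (.inr 5)
  Sum.elim ![p, a, b, altfullA₃ e p g + h, altfullA₄ e g + k, e]
    ![altfullU e p g h s + f (.inr 6), altfullV e g k s + f (.inr 7), altfullW e g + s]

/-- The inverse of `altfullP`. -/
noncomputable def altfullQ (V : Coord 6 3 → SmoothAlg U) : Fin 2 ⊕ Fin 8 → SmoothAlg U :=
  let e := V (.inl 5); let p := V (.inl 0); let g := 𝐝 4 (V (.inl 4))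
  let h := V (.inl 3) - altfullA₃ e p g; let k := V (.inl 4) - altfullA₄ e g
  let s := V (.inr 2) - altfullW e g
  Sum.elim ![V (.inl 1), V (.inl 2)] ![e, p, g, h, k, s,
    V (.inr 0) - altfullU e p g h s, V (.inr 1) - altfullV e g k s]

section

variable {κ : Type*} {e p g h s k : (κ → SmoothAlg U) → SmoothAlg U}

theorem isAlgOp_altfullA₃ (he : IsAlgOp e) (hp : IsAlgOp p) (hg : IsAlgOp g) :
    IsAlgOp fun f => altfullA₃ (e f) (p f) (g f) := by
  unfold altfullA₃
  repeat' apply_rules [IsAlgOp.add, IsAlgOp.mul, IsAlgOp.sub, IsAlgOp.deriv]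

theorem isAlgOp_altfullA₄ (he : IsAlgOp e) (hg : IsAlgOp g) :
    IsAlgOp fun f => altfullA₄ (e f) (g f) := by
  unfold altfullA₄
  repeat' apply_rules [IsAlgOp.add, IsAlgOp.mul, IsAlgOp.sub, IsAlgOp.deriv]

theorem isAlgOp_altfullW (he : IsAlgOp e) (hg : IsAlgOp g) :
    IsAlgOp fun f => altfullW (e f) (g f) := by
  unfold altfullW
  repeat' apply_rules [IsAlgOp.add, IsAlgOp.mul, IsAlgOp.sub, IsAlgOp.deriv]

theorem isAlgOp_altfullU (he : IsAlgOp e) (hp : IsAlgOp p) (hg : IsAlgOp g) (hh : IsAlgOp h) (hs : IsAlgOp s) :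
    IsAlgOp fun f => altfullU (e f) (p f) (g f) (h f) (s f) := by
  unfold altfullU
  repeat' apply_rules [IsAlgOp.add, IsAlgOp.mul, IsAlgOp.sub, IsAlgOp.deriv]

theorem isAlgOp_altfullV (he : IsAlgOp e) (hg : IsAlgOp g) (hk : IsAlgOp k) (hs : IsAlgOp s) :
    IsAlgOp fun f => altfullV (e f) (g f) (k f) (s f) := by
  unfold altfullV
  repeat' apply_rules [IsAlgOp.add, IsAlgOp.mul, IsAlgOp.sub, IsAlgOp.deriv]

end

theorem isAlgOp_altfullP (c : Coord 6 3) :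
    IsAlgOp fun f : Fin 2 ⊕ Fin 8 → SmoothAlg U => altfullP f c := by
  have ha : IsAlgOp fun f : Fin 2 ⊕ Fin 8 → SmoothAlg U => f (.inl 0) := .comp _
  have hb : IsAlgOp fun f : Fin 2 ⊕ Fin 8 → SmoothAlg U => f (.inl 1) := .comp _
  have he : IsAlgOp fun f : Fin 2 ⊕ Fin 8 → SmoothAlg U => f (.inr 0) := .comp _
  have hp : IsAlgOp fun f : Fin 2 ⊕ Fin 8 → SmoothAlg U => f (.inr 1) := .comp _
  have hg : IsAlgOp fun f : Fin 2 ⊕ Fin 8 → SmoothAlg U => f (.inr 2) := .comp _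
  have hh : IsAlgOp fun f : Fin 2 ⊕ Fin 8 → SmoothAlg U => f (.inr 3) := .comp _
  have hk : IsAlgOp fun f : Fin 2 ⊕ Fin 8 → SmoothAlg U => f (.inr 4) := .comp _
  have hs : IsAlgOp fun f : Fin 2 ⊕ Fin 8 → SmoothAlg U => f (.inr 5) := .comp _
  rcases c with c | c <;> fin_cases c
  exacts [hp, ha, hb, ((isAlgOp_altfullA₃ he hp hg).add _ _ hh),
    ((isAlgOp_altfullA₄ he hg).add _ _ hk), he,
    ((isAlgOp_altfullU he hp hg hh hs).add _ _ (.comp _)),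
    ((isAlgOp_altfullV he hg hk hs).add _ _ (.comp _)), ((isAlgOp_altfullW he hg).add _ _ hs)]

theorem isAlgOp_altfullQ (k : Fin 2 ⊕ Fin 8) :
    IsAlgOp fun V : Coord 6 3 → SmoothAlg U => altfullQ V k := by
  have hV (c) : IsAlgOp fun V : Coord 6 3 → SmoothAlg U => V c := .comp _
  have he := hV (.inl 5)
  have hp := hV (.inl 0)
  have hg := (hV (.inl 4)).deriv (.inl 4) _
  have hh := (hV (.inl 3)).sub (isAlgOp_altfullA₃ he hp hg)
  have hk := (hV (.inl 4)).sub (isAlgOp_altfullA₄ he hg)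
  have hs := (hV (.inr 2)).sub (isAlgOp_altfullW he hg)
  rcases k with k | k <;> fin_cases k
  exacts [hV _, hV _, he, hp, hg, hh, hk, hs, (hV _).sub (isAlgOp_altfullU he hp hg hh hs),
    (hV _).sub (isAlgOp_altfullV he hg hk hs)]

theorem altfullP_altfullQ (V : Coord 6 3 → SmoothAlg U) (c : Coord 6 3) :
    altfullP (altfullQ V) c = V c := by
  rcases c with c | c <;> fin_cases c
  exacts [rfl, rfl, rfl, add_sub_cancel _ _, add_sub_cancel _ _, rfl, add_sub_cancel _ _,
    add_sub_cancel _ _, add_sub_cancel _ _]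

end Altfull

end ScrollSym

namespace ScrollSym

set_option linter.unusedSectionVars false

set_option linter.unusedSimpArgs false

open TopologicalSpace SmoothAlg

/-! ### Sufficiency -/

section

variable {𝕜 : Type*} [RCLike 𝕜] {U : Opens (Coord 5 3 → 𝕜)}

set_option maxHeartbeats 8000000 in
-- A direct verification. The field is projectable, so its prolongation is explicit; once the system
-- has been solved for the principal second derivatives, the remaining jet coordinates are
-- independent and the linearised equations hold as polynomial identities in them and in the
-- derivatives of the parameters.
theorem tripleP_mem (f : Fin 9 ⊕ Fin 1 → SmoothAlg U)
    (h : ∀ k, DependsOnly ((Sum.elim (fun _ : Fin 9 => {4, 5}) (fun _ : Fin 1 => {5}) : Fin 9 ⊕ Fin 1 → Finset (Fin 5)) k) (f k)) :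
    tripleP f ∈ algSymmetries (triple 𝕜 5) U ∧ ∀ k, tripleQ (tripleP f) k = f k := by
  have i1 (k β) : Indep (.inr β) (f k) := ⟨(h k).1 β⟩
  have i2 (k) : Indep (.inl 1) (f k) := ⟨(h k).2 1 (by rcases k with k | k <;> simp)⟩
  have i3 (k) : Indep (.inl 2) (f k) := ⟨(h k).2 2 (by rcases k with k | k <;> simp)⟩
  have i4 (k) : Indep (.inl 3) (f k) := ⟨(h k).2 3 (by rcases k with k | k <;> simp)⟩
  have i5 (k) : Indep (.inl 4) (f (.inr k)) := ⟨(h (.inr k)).2 4 (by simp)⟩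
  -- Fixes the order of mixed derivatives, so that equal ones become identical atoms for `ring`.
  have hc := fun f : SmoothAlg U => D_comm (.inl 4) (.inl 0) f
  -- Only g and m are recovered by differentiation; given these two, the other parameters follow by
  -- subtraction.
  have hg : D (.inl 3) (tripleP f (.inl 3)) = f (.inl 1) := by
    simp [tripleP, tripleA₂, tripleM, tripleA₁, tripleU, tripleW, tripleV]
  have hm : D (.inl 3) (tripleP f (.inl 1))
      = tripleM (f (.inr 0)) (f (.inl 1)) + f (.inl 4) := by
    simp only [tripleP, tripleM, tripleA₁, Sum.elim_inl, Sum.elim_inr, Matrix.cons_val, D_add,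
      D_sub, D_mul, D_neg, D_zero,
      D_two, D_three, D_half, D_sixth, D_X, Indep.D_eq_zero, hc, Sum.inl.injEq, Sum.inr.injEq,
      Fin.reduceEq, reduceCtorEq, if_true, if_false, mul_zero, zero_mul, add_zero, zero_add, sub_zero,
      mul_one, one_mul, zero_sub, neg_zero]
    linear_combination -X (.inl 3) * D (.inl 0) (D (.inl 0) (f (.inr 0))) * two_mul_half (U := U)
  refine ⟨?_, fun k => ?_⟩
  swap
  · rcases k with k | k <;> fin_cases k <;> simp only [tripleQ, hg, hm] <;> simp [tripleP]
  intro z p q hq hF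
  have hA : ∀ (k : Fin 5) β, D (.inr β) (tripleP f (.inl k)) = 0 := by
    intro k β
    fin_cases k <;> simp [tripleP, tripleA₂, tripleA₁]
  have hA₁ : ∀ (k : Fin 5) β, evalAt z (D (.inr β) (tripleP f (.inl k))) = 0 := fun k β => by
    rw [hA, map_zero]
  have hA₂ : ∀ (k : Fin 5) β c, evalAt z (D (.inr β) (D c (tripleP f (.inl k)))) = 0 ∧
      evalAt z (D c (D (.inr β) (tripleP f (.inl k)))) = 0 := fun k β c => by
    rw [D_comm, hA, D_zero, map_zero]; exact ⟨rfl, rfl⟩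
  have hd1 := prolong₁_of_base (A₁ := fun c i => evalAt z (D i (tripleP f c))) hA₁
  have hd2 := prolong₂_of_base (A₀ := fun c => evalAt z (tripleP f c))
    (A₁ := fun c i => evalAt z (D i (tripleP f c)))
    (A₂ := fun c i j => evalAt z (D i (D j (tripleP f c)))) hA₁ hA₂
  have s10 := fun α => hq α 1 0
  have s20 := fun α => hq α 2 0
  have s21 := fun α => hq α 2 1
  have s30 := fun α => hq α 3 0
  have s31 := fun α => hq α 3 1
  have s32 := fun α => hq α 3 2
  have s40 := fun α => hq α 4 0
  have s41 := fun α => hq α 4 1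
  have s42 := fun α => hq α 4 2
  have s43 := fun α => hq α 4 3
  simp only [triple, Q₁, Q₂, Q₃, List.forall_mem_cons, u, v, w, w₀, jet_d1, jet_d2, jet_val,
    ofNat_self,
    s10, s20, s21, s30, s31, s32, s40, s41, s42, s43] at hF
  obtain ⟨h1, h2, h3, h4, h5, h6, h7, h8, h9, -⟩ := hF
  -- The derivatives in the directions 14, 15, 25 occur in the three operators with coefficient −1,
  -- so the nine equations can be solved for them.
  have e1 : q 0 1 4 = q 0 2 3 + p 0 1 * q 0 2 2 + (p 1 1 - p 0 2) * q 0 1 2 - p 1 2 * q 0 1 1 - p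
    2 1 := by linear_combination -h1
  have e2 : q 1 1 4 = q 1 2 3 + p 0 1 * q 1 2 2 + (p 1 1 - p 0 2) * q 1 1 2 - p 1 2 * q 1 1 1 + p
    2 2 := by linear_combination -h2
  have e3 : q 2 1 4 = q 2 2 3 + p 0 1 * q 2 2 2 + (p 1 1 - p 0 2) * q 2 1 2 - p 1 2 * q 2 1 1 :=
    by linear_combination -h3
  have e4 : q 0 0 1 = q 0 3 3 + p 0 1 * q 0 2 3 + p 1 1 * q 0 1 3 - p 0 3 * q 0 1 2 + (z.1 (.inr
    2) - p 1 3) * q 0 1 1 + p 0 1 * p 2 1 := by linear_combination -h4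
  have e5 : q 1 0 1 = q 1 3 3 + p 0 1 * q 1 2 3 + p 1 1 * q 1 1 3 - p 0 3 * q 1 1 2 + (z.1 (.inr
    2) - p 1 3) * q 1 1 1 - p 0 1 * p 2 2 := by linear_combination -h5
  have e6 : q 2 0 1 = q 2 3 3 + p 0 1 * q 2 2 3 + p 1 1 * q 2 1 3 - p 0 3 * q 2 1 2 + (z.1 (.inr
    2) - p 1 3) * q 2 1 1 + p 2 1 ^ 2 := by linear_combination -h6
  have e7 : q 0 0 2 = q 0 3 4 + p 0 2 * q 0 2 3 - p 0 3 * q 0 2 2 + p 1 2 * q 0 1 3 + (z.1 (.inr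
    2) - p 1 3) * q 0 1 2 + p 2 3 + p 0 1 * p 2 2 := by linear_combination -h7
  have e8 : q 1 0 2 = q 1 3 4 + p 0 2 * q 1 2 3 - p 0 3 * q 1 2 2 + p 1 2 * q 1 1 3 + (z.1 (.inr
    2) - p 1 3) * q 1 1 2 - (p 2 4 + p 1 2 * p 2 1 - (p 1 1 - p 0 2) * p 2 2) := by
    linear_combination -h8
  have e9 : q 2 0 2 = q 2 3 4 + p 0 2 * q 2 2 3 - p 0 3 * q 2 2 2 + p 1 2 * q 2 1 3 + (z.1 (.inr
    2) - p 1 3) * q 2 1 2 + p 2 1 * p 2 2 := by linear_combination -h9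
  rw [triple_lineDeriv_iff]
  simp only [dQ₁, dQ₂, dQ₃, hd1, hd2, u, v, w, w₀, jet_d1, jet_d2, jet_val, prolong₂_d1,
    prolong₂_val, total₂,
    Fin.sum_univ_five, Fin.sum_univ_three, ofNat_self]
  simp only [tripleP, tripleA₂, tripleM, tripleA₁, tripleU, tripleW, tripleV, Sum.elim_inl,
    Sum.elim_inr, Matrix.cons_val, D_add, D_sub, D_mul, D_neg, D_zero,
    D_two, D_three, D_half, D_sixth, D_X, Indep.D_eq_zero, hc, Sum.inl.injEq, Sum.inr.injEq,
    Fin.reduceEq, reduceCtorEq, if_true, if_false, mul_zero, zero_mul, add_zero, zero_add, sub_zero,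
    mul_one, one_mul, zero_sub, neg_zero,
    map_add, map_sub, map_mul, map_zero, map_neg, map_one, map_ofNat, evalAt_half, evalAt_sixth,
    evalAt_X]
  simp only [e1, e2, e3, e4, e5, e6, e7, e8, e9, s10, s20, s21, s30, s31, s32, s40, s41, s42, s43]
  refine ⟨?_, ?_, ?_, ?_, ?_, ?_, ?_, ?_, ?_⟩
  all_goals ring

end

section

variable {𝕜 : Type*} [RCLike 𝕜] {U : Opens (Coord 6 3 → 𝕜)}

set_option maxHeartbeats 8000000 in
theorem fullP_mem (f : Fin 11 → SmoothAlg U)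
    (h : ∀ k, DependsOnly ((fun _ : Fin 11 => {5, 6} : Fin 11 → Finset (Fin 6)) k) (f k)) :
    fullP f ∈ algSymmetries (triple 𝕜 6 ++ triple1 𝕜 6) U ∧ ∀ k, fullQ (fullP f) k = f k := by
  have i6 (k β) : Indep (.inr β) (f k) := ⟨(h k).1 β⟩
  have i7 (k) : Indep (.inl 1) (f k) := ⟨(h k).2 1 (by simp)⟩
  have i8 (k) : Indep (.inl 2) (f k) := ⟨(h k).2 2 (by simp)⟩
  have i9 (k) : Indep (.inl 3) (f k) := ⟨(h k).2 3 (by simp)⟩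
  have i10 (k) : Indep (.inl 4) (f k) := ⟨(h k).2 4 (by simp)⟩
  have hc := fun f : SmoothAlg U => D_comm (.inl 5) (.inl 0) f
  have hg : D (.inl 3) (fullP f (.inl 3)) = f 2 := by
    simp [fullP, fullA₃, fullA₄, fullM, fullA₁, fullA₂, fullW, fullU, fullV]
  have hm : D (.inl 3) (fullP f (.inl 1))
      = fullM (f 0) (f 2) + f 5 := by
    simp only [fullP, fullM, fullA₁, Sum.elim_inl, Sum.elim_inr, Matrix.cons_val, D_add, D_sub,
      D_mul, D_neg, D_zero,
      D_two, D_three, D_half, D_sixth, D_X, Indep.D_eq_zero, hc, Sum.inl.injEq, Sum.inr.injEq,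
      Fin.reduceEq, reduceCtorEq, if_true, if_false, mul_zero, zero_mul, add_zero, zero_add, sub_zero,
      mul_one, one_mul, zero_sub, neg_zero]
    linear_combination -X (.inl 3) * D (.inl 5) (D (.inl 5) (f 0)) * two_mul_half (U := U)
  refine ⟨?_, fun k => ?_⟩
  swap
  · fin_cases k <;> simp only [fullQ, hg, hm] <;> simp [fullP]
  intro z p q hq hF
  have hA : ∀ (k : Fin 6) β, D (.inr β) (fullP f (.inl k)) = 0 := by
    intro k β
    fin_cases k <;> simp [fullP, fullA₃, fullA₄, fullA₁, fullA₂]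
  have hA₁ : ∀ (k : Fin 6) β, evalAt z (D (.inr β) (fullP f (.inl k))) = 0 := fun k β => by
    rw [hA, map_zero]
  have hA₂ : ∀ (k : Fin 6) β c, evalAt z (D (.inr β) (D c (fullP f (.inl k)))) = 0 ∧
      evalAt z (D c (D (.inr β) (fullP f (.inl k)))) = 0 := fun k β c => by
    rw [D_comm, hA, D_zero, map_zero]; exact ⟨rfl, rfl⟩
  have hd1 := prolong₁_of_base (A₁ := fun c i => evalAt z (D i (fullP f c))) hA₁
  have hd2 := prolong₂_of_base (A₀ := fun c => evalAt z (fullP f c))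
    (A₁ := fun c i => evalAt z (D i (fullP f c)))
    (A₂ := fun c i j => evalAt z (D i (D j (fullP f c)))) hA₁ hA₂
  have s10 := fun α => hq α 1 0
  have s20 := fun α => hq α 2 0
  have s21 := fun α => hq α 2 1
  have s30 := fun α => hq α 3 0
  have s31 := fun α => hq α 3 1
  have s32 := fun α => hq α 3 2
  have s40 := fun α => hq α 4 0
  have s41 := fun α => hq α 4 1
  have s42 := fun α => hq α 4 2
  have s43 := fun α => hq α 4 3
  have s50 := fun α => hq α 5 0
  have s51 := fun α => hq α 5 1
  have s52 := fun α => hq α 5 2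
  have s53 := fun α => hq α 5 3
  have s54 := fun α => hq α 5 4
  simp only [List.forall_mem_append, triple, triple1, Q₁, Q₂, Q₃, Q₄, Q₅, Q₆,
    List.forall_mem_cons, u, v, w, w₀, jet_d1, jet_d2, jet_val, ofNat_self,
    s10, s20, s21, s30, s31, s32, s40, s41, s42, s43, s50, s51, s52, s53, s54] at hF
  obtain ⟨⟨h1, h2, h3, h4, h5, h6, h7, h8, h9, -⟩, h10, h11, h12, h13, h14, h15, h16, h17, h18, -⟩
    := hF
  -- Principal derivatives: 14, 15, 25 from `triple` and 16, 26, 36 from `triple1`.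
  have e1 : q 0 1 4 = q 0 2 3 + p 0 1 * q 0 2 2 + (p 1 1 - p 0 2) * q 0 1 2 - p 1 2 * q 0 1 1 - p
    2 1 := by linear_combination -h1
  have e2 : q 1 1 4 = q 1 2 3 + p 0 1 * q 1 2 2 + (p 1 1 - p 0 2) * q 1 1 2 - p 1 2 * q 1 1 1 + p
    2 2 := by linear_combination -h2
  have e3 : q 2 1 4 = q 2 2 3 + p 0 1 * q 2 2 2 + (p 1 1 - p 0 2) * q 2 1 2 - p 1 2 * q 2 1 1 :=
    by linear_combination -h3
  have e4 : q 0 1 5 = q 0 3 3 + p 0 1 * q 0 2 3 + p 1 1 * q 0 1 3 - p 0 3 * q 0 1 2 + (z.1 (.inr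
    2) - p 1 3) * q 0 1 1 + p 0 1 * p 2 1 := by linear_combination -h4
  have e5 : q 1 1 5 = q 1 3 3 + p 0 1 * q 1 2 3 + p 1 1 * q 1 1 3 - p 0 3 * q 1 1 2 + (z.1 (.inr
    2) - p 1 3) * q 1 1 1 - p 0 1 * p 2 2 := by linear_combination -h5
  have e6 : q 2 1 5 = q 2 3 3 + p 0 1 * q 2 2 3 + p 1 1 * q 2 1 3 - p 0 3 * q 2 1 2 + (z.1 (.inr
    2) - p 1 3) * q 2 1 1 + p 2 1 ^ 2 := by linear_combination -h6
  have e7 : q 0 2 5 = q 0 3 4 + p 0 2 * q 0 2 3 - p 0 3 * q 0 2 2 + p 1 2 * q 0 1 3 + (z.1 (.inr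
    2) - p 1 3) * q 0 1 2 + p 2 3 + p 0 1 * p 2 2 := by linear_combination -h7
  have e8 : q 1 2 5 = q 1 3 4 + p 0 2 * q 1 2 3 - p 0 3 * q 1 2 2 + p 1 2 * q 1 1 3 + (z.1 (.inr
    2) - p 1 3) * q 1 1 2 - (p 2 4 + p 1 2 * p 2 1 - (p 1 1 - p 0 2) * p 2 2) := by
    linear_combination -h8
  have e9 : q 2 2 5 = q 2 3 4 + p 0 2 * q 2 2 3 - p 0 3 * q 2 2 2 + p 1 2 * q 2 1 3 + (z.1 (.inr
    2) - p 1 3) * q 2 1 2 + p 2 1 * p 2 2 := by linear_combination -h9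
  have e10 : q 0 0 1 = q 0 3 4 + p 0 1 * q 0 2 4 + p 1 1 * q 0 1 4 + (z.1 (.inr 2) - p 0 4) * q 0
    1 2 - p 1 4 * q 0 1 1 - (p 2 3 + (p 1 1 - p 0 2) * p 2 1 + p 0 1 * p 2 2) := by
    linear_combination -h10
  have e11 : q 1 0 1 = q 1 3 4 + p 0 1 * q 1 2 4 + p 1 1 * q 1 1 4 + (z.1 (.inr 2) - p 0 4) * q 1
    1 2 - p 1 4 * q 1 1 1 + p 2 4 + p 1 2 * p 2 1 := by linear_combination -h11
  have e12 : q 2 0 1 = q 2 3 4 + p 0 1 * q 2 2 4 + p 1 1 * q 2 1 4 + (z.1 (.inr 2) - p 0 4) * q 2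
    1 2 - p 1 4 * q 2 1 1 + p 2 1 * p 2 2 := by linear_combination -h12
  have e13 : q 0 0 2 = q 0 4 4 + p 0 2 * q 0 2 4 + p 1 2 * q 0 1 4 + (z.1 (.inr 2) - p 0 4) * q 0
    2 2 - p 1 4 * q 0 1 2 - p 1 2 * p 2 1 := by linear_combination -h13
  have e14 : q 1 0 2 = q 1 4 4 + p 0 2 * q 1 2 4 + p 1 2 * q 1 1 4 + (z.1 (.inr 2) - p 0 4) * q 1
    2 2 - p 1 4 * q 1 1 2 + p 1 2 * p 2 2 := by linear_combination -h14
  have e15 : q 2 0 2 = q 2 4 4 + p 0 2 * q 2 2 4 + p 1 2 * q 2 1 4 + (z.1 (.inr 2) - p 0 4) * q 2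
    2 2 - p 1 4 * q 2 1 2 + p 2 2 ^ 2 := by linear_combination -h15
  have e16 : q 0 0 3 = q 0 4 5 + (p 1 3 - z.1 (.inr 2)) * q 0 1 4 + (z.1 (.inr 2) - p 0 4) * q 0 2
    3 + p 0 3 * q 0 2 4 - p 1 4 * q 0 1 3 - (p 2 5 + (p 1 3 - z.1 (.inr 2)) * p 2 1 + p 0 1 * p 2
    4 - p 0 2 * p 2 3 + p 0 3 * p 2 2) := by linear_combination -h16
  have e17 : q 1 0 3 = q 1 4 5 + (p 1 3 - z.1 (.inr 2)) * q 1 1 4 + (z.1 (.inr 2) - p 0 4) * q 1 2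
    3 + p 0 3 * q 1 2 4 - p 1 4 * q 1 1 3 - (-p 2 0 + p 1 1 * p 2 4 - p 1 2 * p 2 3 + (z.1 (.inr
    2) - p 0 4) * p 2 2 - p 1 4 * p 2 1) := by linear_combination -h17
  have e18 : q 2 0 3 = q 2 4 5 + (p 1 3 - z.1 (.inr 2)) * q 2 1 4 + (z.1 (.inr 2) - p 0 4) * q 2 2
    3 + p 0 3 * q 2 2 4 - p 1 4 * q 2 1 3 - (p 2 1 * p 2 4 - p 2 2 * p 2 3) := by
    linear_combination -h18
  rw [List.forall_mem_append, triple_lineDeriv_iff, triple1_lineDeriv_iff]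
  simp only [dQ₁, dQ₂, dQ₃, dQ₄, dQ₅, dQ₆, hd1, hd2, u, v, w, w₀, jet_d1, jet_d2, jet_val,
    prolong₂_d1, prolong₂_val, total₂,
    Fin.sum_univ_six, Fin.sum_univ_three, ofNat_self]
  simp only [fullP, fullA₃, fullA₄, fullM, fullA₁, fullA₂, fullW, fullU, fullV, Sum.elim_inl,
    Sum.elim_inr, Matrix.cons_val, D_add, D_sub, D_mul, D_neg, D_zero,
    D_two, D_three, D_half, D_sixth, D_X, Indep.D_eq_zero, hc, Sum.inl.injEq, Sum.inr.injEq,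
    Fin.reduceEq, reduceCtorEq, if_true, if_false, mul_zero, zero_mul, add_zero, zero_add, sub_zero,
    mul_one, one_mul, zero_sub, neg_zero,
    map_add, map_sub, map_mul, map_zero, map_neg, map_one, map_ofNat, evalAt_half, evalAt_sixth,
    evalAt_X]
  simp only [e1, e2, e3, e4, e5, e6, e7, e8, e9, e10, e11, e12, e13, e14, e15, e16, e17, e18, s10,
    s20, s21, s30, s31, s32, s40, s41, s42, s43, s50, s51, s52, s53, s54]
  refine ⟨⟨?_, ?_, ?_, ?_, ?_, ?_, ?_, ?_, ?_⟩,
    ?_, ?_, ?_, ?_, ?_, ?_, ?_, ?_, ?_⟩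
  all_goals ring

end

section

variable {𝕜 : Type*} [RCLike 𝕜] {U : Opens (Coord 5 3 → 𝕜)}

set_option maxHeartbeats 8000000 in
theorem alttripleP_mem (f : (Fin 2 ⊕ Fin 6) ⊕ Fin 1 → SmoothAlg U)
    (h : ∀ k, DependsOnly ((Sum.elim (Sum.elim (fun _ : Fin 2 => {1, 2}) (fun _ : Fin 6 => {3, 5})) (fun _ : Fin 1 => {5}) : (Fin 2 ⊕ Fin 6) ⊕ Fin 1 → Finset (Fin 5)) k) (f k)) :
    alttripleP f ∈ algSymmetries (alttriple 𝕜 5) U ∧ ∀ k, alttripleQ (alttripleP f) k = f k := by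
  have i11 (k β) : Indep (.inr β) (f k) := ⟨(h k).1 β⟩
  have i12 (k) : Indep (.inl 4) (f k) := ⟨(h k).2 4 (by rcases k with (k | k) | k <;> simp)⟩
  have i13 (k) : Indep (.inl 3) (f (.inl (.inl k))) := ⟨(h _).2 3 (by simp)⟩
  have i14 (k) : Indep (.inl 0) (f (.inl (.inl k))) := ⟨(h _).2 0 (by simp)⟩
  have i15 (k) : Indep (.inl 1) (f (.inl (.inr k))) := ⟨(h _).2 1 (by simp)⟩
  have i16 (k) : Indep (.inl 2) (f (.inl (.inr k))) := ⟨(h _).2 2 (by simp)⟩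
  have i17 (k) : Indep (.inl 1) (f (.inr k)) := ⟨(h _).2 1 (by simp)⟩
  have i18 (k) : Indep (.inl 2) (f (.inr k)) := ⟨(h _).2 2 (by simp)⟩
  have i19 (k) : Indep (.inl 3) (f (.inr k)) := ⟨(h _).2 3 (by simp)⟩
  have hc := fun f : SmoothAlg U => D_comm (.inl 3) (.inl 0) f
  have hg : D (.inl 4) (alttripleP f (.inl 4)) = f (.inl (.inr 1)) := by
    simp [alttripleP, alttripleW, alttripleU, alttripleV]
  refine ⟨?_, fun k => ?_⟩
  swap
  · rcases k with (k | k) | k <;> fin_cases k <;> simp only [alttripleQ, hg] <;> simp [alttripleP]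
  intro z p q hq hF
  have hA : ∀ (k : Fin 5) β, D (.inr β) (alttripleP f (.inl k)) = 0 := by
    intro k β
    fin_cases k <;> simp [alttripleP, alttripleP]
  have hA₁ : ∀ (k : Fin 5) β, evalAt z (D (.inr β) (alttripleP f (.inl k))) = 0 := fun k β => by
    rw [hA, map_zero]
  have hA₂ : ∀ (k : Fin 5) β c, evalAt z (D (.inr β) (D c (alttripleP f (.inl k)))) = 0 ∧
      evalAt z (D c (D (.inr β) (alttripleP f (.inl k)))) = 0 := fun k β c => by
    rw [D_comm, hA, D_zero, map_zero]; exact ⟨rfl, rfl⟩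
  have hd1 := prolong₁_of_base (A₁ := fun c i => evalAt z (D i (alttripleP f c))) hA₁
  have hd2 := prolong₂_of_base (A₀ := fun c => evalAt z (alttripleP f c))
    (A₁ := fun c i => evalAt z (D i (alttripleP f c)))
    (A₂ := fun c i j => evalAt z (D i (D j (alttripleP f c)))) hA₁ hA₂
  have s10 := fun α => hq α 1 0
  have s20 := fun α => hq α 2 0
  have s21 := fun α => hq α 2 1
  have s30 := fun α => hq α 3 0
  have s31 := fun α => hq α 3 1
  have s32 := fun α => hq α 3 2
  have s40 := fun α => hq α 4 0
  have s41 := fun α => hq α 4 1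
  have s42 := fun α => hq α 4 2
  have s43 := fun α => hq α 4 3
  simp only [alttriple, R₁, R₂, R₃, List.forall_mem_cons, u, v, w, w₀, jet_d1, jet_d2, jet_val,
    ofNat_self,
    s10, s20, s21, s30, s31, s32, s40, s41, s42, s43] at hF
  obtain ⟨h1, h2, h3, h4, h5, h6, h7, h8, h9, -⟩ := hF
  -- Only the equations of `R₂` and `R₃` are solved, for the directions 15 and 25. No coefficient in
  -- `R₁` is invertible, so its three equations `h1`, `h2`, `h3` are kept as relations.
  have e4 : q 0 0 1 = p 0 1 * q 0 3 4 + p 1 1 * q 0 4 4 - p 0 4 * q 0 1 3 - (p 1 4 + z.1 (.inr 2))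
    * q 0 1 4 - p 0 1 * p 2 4 := by linear_combination -h4
  have e5 : q 1 0 1 = p 0 1 * q 1 3 4 + p 1 1 * q 1 4 4 - p 0 4 * q 1 1 3 - (p 1 4 + z.1 (.inr 2))
    * q 1 1 4 + p 0 1 * p 2 3 := by linear_combination -h5
  have e6 : q 2 0 1 = p 0 1 * q 2 3 4 + p 1 1 * q 2 4 4 - p 0 4 * q 2 1 3 - (p 1 4 + z.1 (.inr 2))
    * q 2 1 4 - p 2 1 * p 2 4 := by linear_combination -h6
  have e7 : q 0 0 2 = p 0 2 * q 0 3 4 + p 1 2 * q 0 4 4 - p 0 4 * q 0 2 3 - (p 1 4 + z.1 (.inr 2))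
    * q 0 2 4 - p 0 2 * p 2 4 := by linear_combination -h7
  have e8 : q 1 0 2 = p 0 2 * q 1 3 4 + p 1 2 * q 1 4 4 - p 0 4 * q 1 2 3 - (p 1 4 + z.1 (.inr 2))
    * q 1 2 4 + p 0 2 * p 2 3 := by linear_combination -h8
  have e9 : q 2 0 2 = p 0 2 * q 2 3 4 + p 1 2 * q 2 4 4 - p 0 4 * q 2 2 3 - (p 1 4 + z.1 (.inr 2))
    * q 2 2 4 - p 2 2 * p 2 4 := by linear_combination -h9
  rw [alttriple_lineDeriv_iff]
  simp only [dR₁, dR₂, dR₃, hd1, hd2, u, v, w, w₀, jet_d1, jet_d2, jet_val, prolong₂_d1,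
    prolong₂_val, total₂,
    Fin.sum_univ_five, Fin.sum_univ_three, ofNat_self]
  simp only [alttripleP, alttripleW, alttripleU, alttripleV, Sum.elim_inl, Sum.elim_inr,
    Matrix.cons_val, D_add, D_sub, D_mul, D_neg, D_zero,
    D_two, D_three, D_half, D_sixth, D_X, Indep.D_eq_zero, hc, Sum.inl.injEq, Sum.inr.injEq,
    Fin.reduceEq, reduceCtorEq, if_true, if_false, mul_zero, zero_mul, add_zero, zero_add, sub_zero,
    mul_one, one_mul, zero_sub, neg_zero,
    map_add, map_sub, map_mul, map_zero, map_neg, map_one, map_ofNat, evalAt_half, evalAt_sixth,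
    evalAt_X]
  simp only [e4, e5, e6, e7, e8, e9, s10, s20, s21, s30, s31, s32, s40, s41, s42, s43]
  refine ⟨?_, ?_, ?_, ?_, ?_, ?_, ?_, ?_, ?_⟩
  -- A symmetry maps the equations of `R₁` to combinations of themselves; the multipliers are its
  -- weights on them, among them the divergence of the field in the (x¹, x²)-plane.
  · linear_combination (evalAt z (D (.inl 3) (f (.inl (.inr 0)))) + 2 * evalAt z (f (.inl (.inr
    1))) - 2 * evalAt z (D (.inl 0) (f (.inr 0))) - evalAt z (D (.inl 2) (f (.inl (.inl 1)))) -
    evalAt z (D (.inl 1) (f (.inl (.inl 0))))) * h1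
  · linear_combination (z.1 (.inl 4) * evalAt z (D (.inl 3) (f (.inl (.inr 1)))) + evalAt z (D
    (.inl 3) (f (.inl (.inr 2))))) * h1 + (3 * evalAt z (f (.inl (.inr 1))) - 2 * evalAt z (D
    (.inl 0) (f (.inr 0))) - evalAt z (D (.inl 2) (f (.inl (.inl 1)))) - evalAt z (D (.inl 1) (f
    (.inl (.inl 0))))) * h2
  · linear_combination (2 * evalAt z (f (.inl (.inr 1))) - 2 * evalAt z (D (.inl 0) (f (.inr 0)))
    - evalAt z (D (.inl 2) (f (.inl (.inl 1)))) - evalAt z (D (.inl 1) (f (.inl (.inl 0))))) * h3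
    - evalAt z (D (.inl 3) (f (.inl (.inr 1)))) * h1
  all_goals ring

end

section

variable {𝕜 : Type*} [RCLike 𝕜] {U : Opens (Coord 6 3 → 𝕜)}

set_option maxHeartbeats 8000000 in
theorem altfullP_mem (f : Fin 2 ⊕ Fin 8 → SmoothAlg U)
    (h : ∀ k, DependsOnly ((Sum.elim (fun _ : Fin 2 => {1, 2}) (fun _ : Fin 8 => {5,
      6}) : Fin 2 ⊕ Fin 8 → Finset (Fin 6)) k) (f k)) :
    altfullP f ∈ algSymmetries (alttriple 𝕜 6 ++ triple2 𝕜 6) U ∧ ∀ k,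
      altfullQ (altfullP f) k = f k := by
  have i20 (k β) : Indep (.inr β) (f k) := ⟨(h k).1 β⟩
  have i21 (k) : Indep (.inl 3) (f k) := ⟨(h k).2 3 (by rcases k with k | k <;> simp)⟩
  have i22 (k) : Indep (.inl 4) (f k) := ⟨(h k).2 4 (by rcases k with k | k <;> simp)⟩
  have i23 (k) : Indep (.inl 5) (f (.inl k)) := ⟨(h _).2 5 (by simp)⟩
  have i24 (k) : Indep (.inl 0) (f (.inl k)) := ⟨(h _).2 0 (by simp)⟩
  have i25 (k) : Indep (.inl 1) (f (.inr k)) := ⟨(h _).2 1 (by simp)⟩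
  have i26 (k) : Indep (.inl 2) (f (.inr k)) := ⟨(h _).2 2 (by simp)⟩
  have hc := fun f : SmoothAlg U => D_comm (.inl 5) (.inl 0) f
  have hg : D (.inl 4) (altfullP f (.inl 4)) = f (.inr 2) := by
    simp [altfullP, altfullA₃, altfullA₄, altfullW, altfullU, altfullV]
  refine ⟨?_, fun k => ?_⟩
  swap
  · rcases k with k | k <;> fin_cases k <;> simp only [altfullQ, hg] <;> simp [altfullP]
  intro z p q hq hF
  have hA : ∀ (k : Fin 6) β, D (.inr β) (altfullP f (.inl k)) = 0 := by
    intro k β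
    fin_cases k <;> simp [altfullP, altfullA₃, altfullA₄]
  have hA₁ : ∀ (k : Fin 6) β, evalAt z (D (.inr β) (altfullP f (.inl k))) = 0 := fun k β => by
    rw [hA, map_zero]
  have hA₂ : ∀ (k : Fin 6) β c, evalAt z (D (.inr β) (D c (altfullP f (.inl k)))) = 0 ∧
      evalAt z (D c (D (.inr β) (altfullP f (.inl k)))) = 0 := fun k β c => by
    rw [D_comm, hA, D_zero, map_zero]; exact ⟨rfl, rfl⟩
  have hd1 := prolong₁_of_base (A₁ := fun c i => evalAt z (D i (altfullP f c))) hA₁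
  have hd2 := prolong₂_of_base (A₀ := fun c => evalAt z (altfullP f c))
    (A₁ := fun c i => evalAt z (D i (altfullP f c)))
    (A₂ := fun c i j => evalAt z (D i (D j (altfullP f c)))) hA₁ hA₂
  have s10 := fun α => hq α 1 0
  have s20 := fun α => hq α 2 0
  have s21 := fun α => hq α 2 1
  have s30 := fun α => hq α 3 0
  have s31 := fun α => hq α 3 1
  have s32 := fun α => hq α 3 2
  have s40 := fun α => hq α 4 0
  have s41 := fun α => hq α 4 1
  have s42 := fun α => hq α 4 2
  have s43 := fun α => hq α 4 3
  have s50 := fun α => hq α 5 0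
  have s51 := fun α => hq α 5 1
  have s52 := fun α => hq α 5 2
  have s53 := fun α => hq α 5 3
  have s54 := fun α => hq α 5 4
  simp only [List.forall_mem_append, alttriple, triple2, R₁, R₂, R₃, R₄, R₅, R₆,
    List.forall_mem_cons, u, v, w, w₀, jet_d1, jet_d2, jet_val, ofNat_self,
    s10, s20, s21, s30, s31, s32, s40, s41, s42, s43, s50, s51, s52, s53, s54] at hF
  obtain ⟨⟨h1, h2, h3, h4, h5, h6, h7, h8, h9, -⟩, h10, h11, h12, h13, h14, h15, h16, h17, h18, -⟩
    := hF
  -- Principal derivatives: 15, 25, 16, 26, 46. Again the equations of `R₁` are retained as `h1`,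
  -- `h2`, `h3`.
  have e4 : q 0 1 5 = p 0 1 * q 0 3 4 + p 1 1 * q 0 4 4 - p 0 4 * q 0 1 3 - (p 1 4 + z.1 (.inr 2))
    * q 0 1 4 - p 0 1 * p 2 4 := by linear_combination -h4
  have e5 : q 1 1 5 = p 0 1 * q 1 3 4 + p 1 1 * q 1 4 4 - p 0 4 * q 1 1 3 - (p 1 4 + z.1 (.inr 2))
    * q 1 1 4 + p 0 1 * p 2 3 := by linear_combination -h5
  have e6 : q 2 1 5 = p 0 1 * q 2 3 4 + p 1 1 * q 2 4 4 - p 0 4 * q 2 1 3 - (p 1 4 + z.1 (.inr 2))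
    * q 2 1 4 - p 2 1 * p 2 4 := by linear_combination -h6
  have e7 : q 0 2 5 = p 0 2 * q 0 3 4 + p 1 2 * q 0 4 4 - p 0 4 * q 0 2 3 - (p 1 4 + z.1 (.inr 2))
    * q 0 2 4 - p 0 2 * p 2 4 := by linear_combination -h7
  have e8 : q 1 2 5 = p 0 2 * q 1 3 4 + p 1 2 * q 1 4 4 - p 0 4 * q 1 2 3 - (p 1 4 + z.1 (.inr 2))
    * q 1 2 4 + p 0 2 * p 2 3 := by linear_combination -h8
  have e9 : q 2 2 5 = p 0 2 * q 2 3 4 + p 1 2 * q 2 4 4 - p 0 4 * q 2 2 3 - (p 1 4 + z.1 (.inr 2))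
    * q 2 2 4 - p 2 2 * p 2 4 := by linear_combination -h9
  have e10 : q 0 0 1 = p 1 1 * q 0 3 4 + p 0 1 * q 0 3 3 - p 1 3 * q 0 1 4 - (p 0 3 + z.1 (.inr
    2)) * q 0 1 3 + p 1 1 * p 2 4 := by linear_combination -h10
  have e11 : q 1 0 1 = p 1 1 * q 1 3 4 + p 0 1 * q 1 3 3 - p 1 3 * q 1 1 4 - (p 0 3 + z.1 (.inr
    2)) * q 1 1 3 - p 1 1 * p 2 3 := by linear_combination -h11
  have e12 : q 2 0 1 = p 1 1 * q 2 3 4 + p 0 1 * q 2 3 3 - p 1 3 * q 2 1 4 - (p 0 3 + z.1 (.inr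
    2)) * q 2 1 3 - p 2 1 * p 2 3 := by linear_combination -h12
  have e13 : q 0 0 2 = p 1 2 * q 0 3 4 + p 0 2 * q 0 3 3 - p 1 3 * q 0 2 4 - (p 0 3 + z.1 (.inr
    2)) * q 0 2 3 + p 1 2 * p 2 4 := by linear_combination -h13
  have e14 : q 1 0 2 = p 1 2 * q 1 3 4 + p 0 2 * q 1 3 3 - p 1 3 * q 1 2 4 - (p 0 3 + z.1 (.inr
    2)) * q 1 2 3 - p 1 2 * p 2 3 := by linear_combination -h14
  have e15 : q 2 0 2 = p 1 2 * q 2 3 4 + p 0 2 * q 2 3 3 - p 1 3 * q 2 2 4 - (p 0 3 + z.1 (.inr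
    2)) * q 2 2 3 - p 2 2 * p 2 3 := by linear_combination -h15
  have e16 : q 0 0 4 = q 0 3 5 + p 0 4 * q 0 3 3 - p 1 3 * q 0 4 4 + (p 1 4 - p 0 3) * q 0 3 4 + p
    2 5 + (p 1 4 + z.1 (.inr 2)) * p 2 4 + p 0 4 * p 2 3 := by linear_combination -h16
  have e17 : q 1 0 4 = q 1 3 5 + p 0 4 * q 1 3 3 - p 1 3 * q 1 4 4 + (p 1 4 - p 0 3) * q 1 3 4 -
    (p 2 0 + (p 0 3 + z.1 (.inr 2)) * p 2 3 + p 1 3 * p 2 4) := by linear_combination -h17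
  have e18 : q 2 0 4 = q 2 3 5 + p 0 4 * q 2 3 3 - p 1 3 * q 2 4 4 + (p 1 4 - p 0 3) * q 2 3 4 :=
    by linear_combination -h18
  rw [List.forall_mem_append, alttriple_lineDeriv_iff, triple2_lineDeriv_iff]
  simp only [dR₁, dR₂, dR₃, dR₄, dR₅, dR₆, hd1, hd2, u, v, w, w₀, jet_d1, jet_d2, jet_val,
    prolong₂_d1, prolong₂_val, total₂,
    Fin.sum_univ_six, Fin.sum_univ_three, ofNat_self]
  simp only [altfullP, altfullA₃, altfullA₄, altfullW, altfullU, altfullV, Sum.elim_inl,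
    Sum.elim_inr, Matrix.cons_val, D_add, D_sub, D_mul, D_neg, D_zero,
    D_two, D_three, D_half, D_sixth, D_X, Indep.D_eq_zero, hc, Sum.inl.injEq, Sum.inr.injEq,
    Fin.reduceEq, reduceCtorEq, if_true, if_false, mul_zero, zero_mul, add_zero, zero_add, sub_zero,
    mul_one, one_mul, zero_sub, neg_zero,
    map_add, map_sub, map_mul, map_zero, map_neg, map_one, map_ofNat, evalAt_half, evalAt_sixth,
    evalAt_X]
  simp only [e4, e5, e6, e7, e8, e9, e10, e11, e12, e13, e14, e15, e16, e17, e18, s10, s20, s21,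
    s30, s31, s32, s40, s41, s42, s43, s50, s51, s52, s53, s54]
  refine ⟨⟨?_, ?_, ?_, ?_, ?_, ?_, ?_, ?_, ?_⟩,
    ?_, ?_, ?_, ?_, ?_, ?_, ?_, ?_, ?_⟩
  -- As for `alttriple`, the linearised `R₁`-equations are multiples of the equations themselves.
  · linear_combination (3 * evalAt z (f (.inr 2)) + evalAt z (D (.inl 0) (f (.inr 1))) - 3 *
    evalAt z (D (.inl 5) (f (.inr 0))) - evalAt z (D (.inl 2) (f (.inl 1))) - evalAt z (D (.inl 1)
    (f (.inl 0)))) * h1 + evalAt z (D (.inl 5) (f (.inr 1))) * h2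
  · linear_combination evalAt z (D (.inl 0) (f (.inr 0))) * h1 + (3 * evalAt z (f (.inr 2)) - 2 *
    evalAt z (D (.inl 5) (f (.inr 0))) - evalAt z (D (.inl 2) (f (.inl 1))) - evalAt z (D (.inl 1)
    (f (.inl 0)))) * h2
  · linear_combination (2 * evalAt z (f (.inr 2)) - 2 * evalAt z (D (.inl 5) (f (.inr 0))) -
    evalAt z (D (.inl 2) (f (.inl 1))) - evalAt z (D (.inl 1) (f (.inl 0)))) * h3
  all_goals ring

end

end ScrollSym

namespace ScrollSym

set_option linter.unusedSectionVars false

set_option linter.unusedSimpArgs false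

open TopologicalSpace SmoothAlg

/-! ### Necessity: integration of the relations. -/

theorem six_mul_sixth {𝕜 : Type*} [RCLike 𝕜] {d : ℕ} {U : Opens (Coord d 3 → 𝕜)} :
    6 * (sixth : SmoothAlg U) = 1 :=
  ext' fun z => by simp [evalAt_sixth, map_ofNat]

section

variable {𝕜 : Type*} [RCLike 𝕜] {U : Opens (Coord 5 3 → 𝕜)}

local notation "𝐱" i:max => X (U := U) (Sum.inl i)
local notation "𝐲" α:max => X (U := U) (Sum.inr α)
local notation "𝐝" i:max f:max => D (U := U) (Sum.inl i) f

set_option maxHeartbeats 4000000 in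
-- The components are integrated in the order a⁵, a⁴, a³, a², a¹, w, u, v, so that the derivatives
-- needed at each stage are known by then. Each time the explicit part is subtracted and the
-- remainder shown to be independent of every variable but x⁴ and x⁵. As ∂₄a⁵ = 0, a⁵ itself is a
-- function of x⁵ alone: this is the single function of one variable.
theorem exists_tripleP {V : Coord 5 3 → SmoothAlg U} (hV : V ∈ algSymmetries (triple 𝕜 5) U) :
    ∃ f, (∀ k, DependsOnly ((Sum.elim (fun _ : Fin 9 => {4, 5}) (fun _ : Fin 1 => {5}) :
      Fin 9 ⊕ Fin 1 → Finset (Fin 5)) k) (f k)) ∧ tripleP f = V := by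
  obtain ⟨⟨base, a21, a31, a32, a41, a42, a43, a51, a52, a53, a54, a34, a44, a45, a55, u1, u2, u3,
    uu, uv, v1, v2, v3, vu, vv⟩, uw, vw, w3⟩ := triple_algRelations hV
  replace base : ∀ (k : Fin 5) β, D (.inr β) (V (.inl k)) = 0 := base
  obtain ⟨e, he⟩ : ∃ e, V (.inl 0) = e := ⟨_, rfl⟩
  obtain ⟨p, hp⟩ : ∃ p, V (.inl 4) = p := ⟨_, rfl⟩
  obtain ⟨g, hg⟩ : ∃ g, 𝐝 3 (V (.inl 3)) = g := ⟨_, rfl⟩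
  simp only [he, hp, hg] at a21 a31 a32 a41 a42 a43 a51 a52 a53 a54 a34 a44 a45 a55
  simp only [hp, hg] at u1 u2 u3 uu uv v1 v2 v3 vu vv w3
  have hc := fun f : SmoothAlg U => D_comm (.inl 4) (.inl 0) f
  have eβ β : Indep (.inr β) e := ⟨he ▸ base 0 β⟩
  have e1 : Indep (.inl 1) e := ⟨a51⟩
  have e2 : Indep (.inl 2) e := ⟨a52⟩
  have e3 : Indep (.inl 3) e := ⟨a53⟩
  have e4 : Indep (.inl 4) e := ⟨a54⟩
  have pβ β : Indep (.inr β) p := ⟨hp ▸ base 4 β⟩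
  have p1 : Indep (.inl 1) p := ⟨a41⟩
  have p2 : Indep (.inl 2) p := ⟨a42⟩
  have p3 : Indep (.inl 3) p := ⟨a43⟩
  have d11 : 𝐝 1 (V (.inl 1)) = 2 * g - 𝐝 0 e := by linear_combination a55
  have d22 : 𝐝 2 (V (.inl 2)) = 𝐝 4 p + g - 𝐝 0 e := by linear_combination d11 - a44
  have gβ β : Indep (.inr β) g := ⟨by rw [← hg, D_comm, base, D_zero]⟩
  have g1 : Indep (.inl 1) g := ⟨by rw [← hg, D_comm, a31, D_zero]⟩
  have g2 : Indep (.inl 2) g := ⟨by rw [← hg, D_comm, a32, D_zero]⟩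
  -- ∂₃g = ∂₃∂₂a², and ∂₂∂₃a² = ∂₂∂₅a⁴ = 0; thus a³ is affine in x³.
  have g3 : Indep (.inl 3) g := ⟨by
    have t := congrArg (D (.inl 3)) d22
    rw [D_comm, ← a45] at t
    simpa using t.symm⟩
  obtain ⟨h, hh⟩ : ∃ h, V (.inl 3) = 𝐱 3 * g + h := ⟨_, (add_sub_cancel _ _).symm⟩
  have hβ β : Indep (.inr β) h := .of_eq hh (by simp [base])
  have h1 : Indep (.inl 1) h := .of_eq hh (by simp [a31])
  have h2 : Indep (.inl 2) h := .of_eq hh (by simp [a32])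
  have h3 : Indep (.inl 3) h := .of_eq hh (by simp [hg])
  obtain ⟨k, hk⟩ : ∃ k, V (.inl 2) = tripleA₂ e p g + k := ⟨_, (add_sub_cancel _ _).symm⟩
  have kβ β : Indep (.inr β) k := .of_eq hk (by simp [tripleA₂, base])
  have k1 : Indep (.inl 1) k := .of_eq hk (by simp [tripleA₂, a21])
  have k2 : Indep (.inl 2) k := .of_eq hk (by simp [tripleA₂, d22])
  have k3 : Indep (.inl 3) k := .of_eq hk (by simp [tripleA₂, ← a45])
  have d12 : 𝐝 2 (V (.inl 1)) = 𝐱 3 * 𝐝 4 g + 𝐝 4 h := by simp [← a34, hh]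
  obtain ⟨m, hm⟩ : ∃ m, 𝐝 3 (V (.inl 1)) = tripleM e g + m := ⟨_, (add_sub_cancel _ _).symm⟩
  have mβ β : Indep (.inr β) m := .of_eq hm (by rw [D_comm, base]; simp [tripleM])
  have m1 : Indep (.inl 1) m := .of_eq hm (by rw [D_comm, d11]; simp [tripleM])
  have m2 : Indep (.inl 2) m := .of_eq hm (by rw [D_comm, d12]; simp [tripleM])
  -- Differentiating the formula for ∂₂ of the u-component along x³, and inserting that for ∂₃,
  -- determines ∂₃²a¹.
  have m3 : Indep (.inl 3) m := .of_eq hm (by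
    have t := congrArg (D (.inl 3)) u2
    rw [D_comm, u3, hk, hh] at t
    simp [tripleA₂, hc] at t
    simp [tripleM]
    linear_combination -t)
  obtain ⟨n, hn⟩ : ∃ n, V (.inl 1) = tripleA₁ e g h m + n := ⟨_, (add_sub_cancel _ _).symm⟩
  have nβ β : Indep (.inr β) n := .of_eq hn (by simp [tripleA₁, base])
  have n1 : Indep (.inl 1) n := .of_eq hn (by simp [tripleA₁, d11])
  have n2 : Indep (.inl 2) n := .of_eq hn (by simp [tripleA₁, d12])
  have n3 : Indep (.inl 3) n := .of_eq hn (by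
    have := two_mul_half (U := U)
    simp [tripleA₁, tripleM, hm]
    grind)
  -- This is the only first-order relation containing the w-component. Comparing mixed derivatives
  -- with the other relations for the v-component yields its derivatives along x¹, x², u, v and w.
  replace v3 : 𝐝 3 (V (.inr 1)) = V (.inr 2) + 𝐝 0 (tripleA₁ e g h m + n)
      - 𝐲 2 * (2 * g - 2 * 𝐝 0 e) := by rw [v3, d11, ← hn]; ring
  have w1 : 𝐝 1 (V (.inr 2)) = 𝐝 0 g - 𝐝 0 (𝐝 0 e) := by
    have t := congrArg (D (.inl 1)) v3
    rw [D_comm, v1, hm, hh] at t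
    simp [tripleM, tripleA₁] at t
    linear_combination -t
  have w2 : 𝐝 2 (V (.inr 2)) = 𝐱 2 * 𝐝 4 (𝐝 4 g) + 𝐱 3 * 𝐝 4 (𝐝 0 g) + 𝐝 4 m - 𝐝 4 (𝐝 0 h) := by
    have t := congrArg (D (.inl 2)) v3
    rw [D_comm, v2, D_comm, hm] at t
    simp [tripleM, tripleA₁, hc] at t ⊢
    linear_combination -t
  have wu : D (.inr 0) (V (.inr 2)) = 𝐝 4 g := by
    have t := congrArg (D (.inr 0)) v3
    rw [D_comm, vu, d12] at t
    simp [tripleA₁] at t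
    linear_combination -t
  have wv : D (.inr 1) (V (.inr 2)) = 0 := by
    have t := congrArg (D (.inr 1)) v3
    rw [D_comm, vv, d11] at t
    simpa [tripleA₁] using t.symm
  have ww : D (.inr 2) (V (.inr 2)) = 2 * g - 2 * 𝐝 0 e := by
    have t := congrArg (D (.inr 2)) v3
    rw [D_comm, vw] at t
    simp [tripleA₁] at t
    linear_combination -t
  -- The derivative along x³ is not reached by mixed derivatives and is taken from the second-order
  -- relation `w3`.
  rw [D_comm (U := U) (.inl 2) (.inl 0) (V _), u2, D_comm (U := U) (.inl 3) (.inl 4) (V _), u3, uu, d11,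
    d22, D_comm (U := U) (.inr 1) (.inl 4), uv, hk, hh, hm, wv] at w3
  simp [tripleM, tripleA₂, hc] at w3
  obtain ⟨s, hs⟩ : ∃ s, V (.inr 2) = tripleW e g h m + s := ⟨_, (add_sub_cancel _ _).symm⟩
  have s0 : Indep (.inr 0) s := .of_eq hs (by simp [tripleW, wu])
  have s1 : Indep (.inr 1) s := .of_eq hs (by simp [tripleW, wv])
  have s2 : Indep (.inr 2) s := .of_eq hs (by simp [tripleW, ww])
  have s3 : Indep (.inl 1) s := .of_eq hs (by simp [tripleW, w1])
  have h2h := two_mul_half (U := U)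
  have s4 : Indep (.inl 2) s := .of_eq hs (by simp [tripleW, w2, hc]; grind)
  have s5 : Indep (.inl 3) s := .of_eq hs (by rw [w3]; simp [tripleW, hc]; grind)
  obtain ⟨y, hy⟩ : ∃ y, V (.inr 0) = tripleU e p g h k m + y := ⟨_, (add_sub_cancel _ _).symm⟩
  have y0 : Indep (.inr 0) y := .of_eq hy (by rw [uu, d11, d22]; simp [tripleU]; ring)
  have y1 : Indep (.inr 1) y := .of_eq hy (by simp [tripleU, uv])
  have y2 : Indep (.inr 2) y := .of_eq hy (by simp [tripleU, uw])
  have y3 : Indep (.inl 1) y := .of_eq hy (by simp [tripleU, u1, ← a45])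
  have y4 : Indep (.inl 2) y := .of_eq hy (by
    rw [u2, hm, hk, hh]; simp [tripleU, tripleM, tripleA₂, hc]; grind)
  have y5 : Indep (.inl 3) y := .of_eq hy (by
    rw [u3, hk]; simp [tripleU, tripleM, tripleA₂, hc]; grind)
  obtain ⟨z, hz⟩ : ∃ z, V (.inr 1) = tripleV e g h m n s + z := ⟨_, (add_sub_cancel _ _).symm⟩
  have z0 : Indep (.inr 0) z := .of_eq hz (by rw [vu, d12]; simp [tripleV])
  have z1 : Indep (.inr 1) z := .of_eq hz (by rw [vv, d11]; simp [tripleV]; ring)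
  have z2 : Indep (.inr 2) z := .of_eq hz (by simp [tripleV, vw])
  have z3 : Indep (.inl 1) z := .of_eq hz (by
    rw [v1, hm, hh]; simp [tripleV, tripleM]; ring)
  have z4 : Indep (.inl 2) z := .of_eq hz (by
    rw [v2, hn]; simp [tripleV, tripleA₁, hc]; grind)
  have h6 := six_mul_sixth (U := U)
  have z5 : Indep (.inl 3) z := .of_eq hz (by
    rw [v3, hs]; simp [tripleV, tripleA₁, tripleW, hc]; grind)
  refine ⟨Sum.elim ![p, g, h, k, m, n, s, y, z] ![e], ?_, ?_⟩
  · have sβ β : Indep (.inr β) s := by fin_cases β <;> assumption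
    have yβ β : Indep (.inr β) y := by fin_cases β <;> assumption
    have zβ β : Indep (.inr β) z := by fin_cases β <;> assumption
    rintro (j | j) <;> fin_cases j <;> refine ⟨fun β => by simp, fun i hi => ?_⟩ <;>
      fin_cases i <;> simp at hi ⊢
  · funext c
    rcases c with c | c <;> fin_cases c
    exacts [he.symm, hn.symm, hk.symm, hh.symm, hp.symm, hy.symm, hz.symm, hs.symm]

end

section

variable {𝕜 : Type*} [RCLike 𝕜] {U : Opens (Coord 6 3 → 𝕜)}

local notation "𝐱" i:max => X (U := U) (Sum.inl i)
local notation "𝐲" α:max => X (U := U) (Sum.inr α)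
local notation "𝐝" i:max f:max => D (U := U) (Sum.inl i) f

set_option maxHeartbeats 8000000 in
-- The procedure is that for (triple), but a⁵ and a⁶ are now both functions of (x⁵, x⁶), and x⁴ has
-- become a variable in which everything is polynomial.
theorem exists_fullP {V : Coord 6 3 → SmoothAlg U}
    (hV : V ∈ algSymmetries (triple 𝕜 6 ++ triple1 𝕜 6) U) :
    ∃ f, (∀ k, DependsOnly ((fun _ : Fin 11 => {5, 6} : Fin 11 → Finset (Fin 6)) k) (f k)) ∧
      fullP f = V := by
  obtain ⟨⟨base, a31, a32, a41, a42, a34, a36, a43, a44, a45, a46, a51, a52, a53, a54, a61, a62, a63,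
    a64, a55, a56, a65, a66, u1, u2, u3, u4, uu, uv, v1, v2, v3, v4, vu, vv⟩, uw, vw⟩ :=
    full_algRelations hV
  replace base : ∀ (k : Fin 6) β, D (.inr β) (V (.inl k)) = 0 := base
  obtain ⟨e, he⟩ : ∃ e, V (.inl 5) = e := ⟨_, rfl⟩
  obtain ⟨p, hp⟩ : ∃ p, V (.inl 0) = p := ⟨_, rfl⟩
  obtain ⟨g, hg⟩ : ∃ g, 𝐝 3 (V (.inl 3)) = g := ⟨_, rfl⟩
  simp only [he, hp, hg] at a31 a32 a41 a42 a34 a36 a43 a44 a45 a46 a51 a52 a53 a54 a61 a62 a63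
  simp only [he, hp, hg] at a64 a55 a56 a65 a66 u1 u2 u3 u4 uu uv v1 v2 v3 v4 vu vv
  have hc := fun f : SmoothAlg U => D_comm (.inl 5) (.inl 0) f
  have h2h := two_mul_half (U := U)
  have h6 := six_mul_sixth (U := U)
  have eβ β : Indep (.inr β) e := ⟨he ▸ base 5 β⟩
  have e1 : Indep (.inl 1) e := ⟨a51⟩
  have e2 : Indep (.inl 2) e := ⟨a52⟩
  have e3 : Indep (.inl 3) e := ⟨a53⟩
  have e4 : Indep (.inl 4) e := ⟨a54⟩
  have pβ β : Indep (.inr β) p := ⟨hp ▸ base 0 β⟩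
  have p1 : Indep (.inl 1) p := ⟨a61⟩
  have p2 : Indep (.inl 2) p := ⟨a62⟩
  have p3 : Indep (.inl 3) p := ⟨a63⟩
  have p4 : Indep (.inl 4) p := ⟨a64⟩
  have d11 : 𝐝 1 (V (.inl 1)) = 2 * g - 𝐝 5 e := by linear_combination a55
  have d22 : 𝐝 2 (V (.inl 2)) = 𝐝 0 p + 2 * g - 2 * 𝐝 5 e := by linear_combination 2 * d11 - a66
  have d44 : 𝐝 4 (V (.inl 4)) = g + 𝐝 0 p - 𝐝 5 e := by linear_combination a44 + d22 - d11
  -- ∂₂a¹ and ∂₁a² are replaced by the derivatives of a⁵ and a⁶ to which they are equal.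
  rw [← a56] at a34 vu
  rw [← a65] at a43 uv
  have gβ β : Indep (.inr β) g := ⟨by rw [← hg, D_comm, base, D_zero]⟩
  have g1 : Indep (.inl 1) g := ⟨by rw [← hg, D_comm, a31, D_zero]⟩
  have g2 : Indep (.inl 2) g := ⟨by rw [← hg, D_comm, a32, D_zero]⟩
  have g3 : Indep (.inl 3) g := ⟨by
    have t := congrArg (D (.inl 3)) d44
    rw [D_comm, a43] at t
    simpa using t.symm⟩
  have g4 : Indep (.inl 4) g := ⟨by rw [← hg, D_comm, a34]; simp⟩
  obtain ⟨h, hh⟩ : ∃ h, V (.inl 3) = fullA₃ e g + h := ⟨_, (add_sub_cancel _ _).symm⟩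
  have hβ β : Indep (.inr β) h := .of_eq hh (by simp [fullA₃, base])
  have h1 : Indep (.inl 1) h := .of_eq hh (by simp [fullA₃, a31])
  have h2 : Indep (.inl 2) h := .of_eq hh (by simp [fullA₃, a32])
  have h3 : Indep (.inl 3) h := .of_eq hh (by simp [fullA₃, hg])
  have h4 : Indep (.inl 4) h := .of_eq hh (by simp [fullA₃, a34])
  obtain ⟨k, hk⟩ : ∃ k, V (.inl 4) = fullA₄ e p g + k := ⟨_, (add_sub_cancel _ _).symm⟩
  have kβ β : Indep (.inr β) k := .of_eq hk (by simp [fullA₄, base])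
  have k1 : Indep (.inl 1) k := .of_eq hk (by simp [fullA₄, a41])
  have k2 : Indep (.inl 2) k := .of_eq hk (by simp [fullA₄, a42])
  have k3 : Indep (.inl 3) k := .of_eq hk (by simp [fullA₄, a43])
  have k4 : Indep (.inl 4) k := .of_eq hk (by simp [fullA₄, d44])
  obtain ⟨m, hm⟩ : ∃ m, 𝐝 3 (V (.inl 1)) = fullM e g + m := ⟨_, (add_sub_cancel _ _).symm⟩
  have mβ β : Indep (.inr β) m := .of_eq hm (by rw [D_comm, base]; simp [fullM])
  have m1 : Indep (.inl 1) m := .of_eq hm (by rw [D_comm, d11]; simp [fullM])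
  have m2 : Indep (.inl 2) m := .of_eq hm (by rw [D_comm, ← a56]; simp [fullM])
  have m4 : Indep (.inl 4) m := .of_eq hm (by rw [D_comm, ← a36, hh]; simp [fullM, fullA₃])
  -- Mixed derivatives of the u-component and of a² isolate ∂₃²a¹ in the derivative of `u2` along
  -- x³.
  have m3 : Indep (.inl 3) m := .of_eq hm (by
    have t := congrArg (D (.inl 3)) u2
    have t2 : 𝐝 3 (𝐝 4 (V (.inl 2))) = 𝐝 4 (𝐝 5 (V (.inl 4))) := by rw [D_comm, ← a45]
    have t3 : 𝐝 3 (𝐝 2 (V (.inr 0))) = 𝐝 5 (𝐝 2 (V (.inl 2))) := by rw [D_comm, u3, D_comm]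
    simp only [t3, d22, D_sub, D_add, t2] at t
    rw [hk, hh] at t
    simp [fullA₃, fullA₄, hc] at t
    simp [fullM]
    grind)
  obtain ⟨n, hn⟩ : ∃ n, V (.inl 1) = fullA₁ e g h m + n := ⟨_, (add_sub_cancel _ _).symm⟩
  have nβ β : Indep (.inr β) n := .of_eq hn (by simp [fullA₁, base])
  have n1 : Indep (.inl 1) n := .of_eq hn (by simp [fullA₁, d11])
  have n2 : Indep (.inl 2) n := .of_eq hn (by simp [fullA₁, ← a56])
  have n3 : Indep (.inl 3) n := .of_eq hn (by rw [hm]; simp [fullA₁, fullM]; grind)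
  have n4 : Indep (.inl 4) n := .of_eq hn (by rw [← a36, hh]; simp [fullA₁, fullA₃]; grind)
  obtain ⟨l, hl⟩ : ∃ l, V (.inl 2) = fullA₂ e p g h k m + l := ⟨_, (add_sub_cancel _ _).symm⟩
  have lβ β : Indep (.inr β) l := .of_eq hl (by simp [fullA₂, base])
  have l1 : Indep (.inl 1) l := .of_eq hl (by simp [fullA₂, ← a65])
  have l2 : Indep (.inl 2) l := .of_eq hl (by simp [fullA₂, d22])
  have l3 : Indep (.inl 3) l := .of_eq hl (by rw [← a45, hk]; simp [fullA₂, fullA₄, hc]; grind)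
  have d24 : 𝐝 4 (V (.inl 2)) = 𝐝 0 (V (.inl 4)) + 𝐝 3 (V (.inl 1)) - 𝐝 5 (V (.inl 3)) := by
    linear_combination -a46
  have l4 : Indep (.inl 4) l := .of_eq hl (by
    rw [d24, hk, hm, hh]; simp [fullA₂, fullA₃, fullA₄, fullM, hc]; grind)
  replace v3 : 𝐝 3 (V (.inr 1)) = V (.inr 2) + 𝐝 5 (fullA₁ e g h m + n)
      - 𝐲 2 * (2 * g - 2 * 𝐝 5 e) := by rw [v3, d11, ← hn]; ring
  replace u4 : 𝐝 4 (V (.inr 0)) = V (.inr 2) + 𝐝 0 (fullA₂ e p g h k m + l)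
      - 𝐲 2 * (2 * g - 2 * 𝐝 5 e) := by rw [u4, d11, ← hl]; ring
  have w1 : 𝐝 1 (V (.inr 2)) = 𝐝 5 g - 𝐝 5 (𝐝 5 e) := by
    have t := congrArg (D (.inl 1)) v3
    rw [D_comm, v1, hm, hh] at t
    simp [fullM, fullA₁, fullA₃] at t
    linear_combination -t
  have w2 : 𝐝 2 (V (.inr 2)) = 𝐝 0 g - 𝐝 0 (𝐝 5 e) := by
    have t := congrArg (D (.inl 2)) v3
    rw [D_comm, v2, D_comm, hm] at t
    simp [fullM, fullA₁, hc] at t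
    linear_combination -t
  -- With six variables the w-component occurs both in `v3` and in `u4`. Comparing `u4` with `u3`
  -- gives its derivative along x³, and `v3` with `v4` that along x⁴; no second-order relation is
  -- needed.
  have w3 : 𝐝 3 (V (.inr 2)) = 𝐱 3 * (𝐝 5 (𝐝 5 g) - 𝐝 5 (𝐝 5 (𝐝 5 e)))
      + 𝐱 4 * (𝐝 0 (𝐝 5 g) - 𝐝 0 (𝐝 5 (𝐝 5 e))) + 𝐝 5 m - 𝐝 5 (𝐝 5 h) := by
    have t := congrArg (D (.inl 3)) u4
    rw [D_comm, u3, hl] at t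
    simp [fullA₂, hc] at t
    grind
  have w4 : 𝐝 4 (V (.inr 2)) = 𝐱 3 * (𝐝 0 (𝐝 5 g) - 𝐝 0 (𝐝 5 (𝐝 5 e)))
      + 𝐱 4 * (𝐝 0 (𝐝 0 g) - 𝐝 0 (𝐝 0 (𝐝 5 e))) + 𝐝 0 m - 𝐝 0 (𝐝 5 h) := by
    have t := congrArg (D (.inl 4)) v3
    rw [D_comm, v4, hn] at t
    simp [fullA₁, hc] at t
    grind
  have wu : D (.inr 0) (V (.inr 2)) = 0 := by
    have t := congrArg (D (.inr 0)) v3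
    rw [D_comm, vu] at t
    simpa [fullA₁] using t.symm
  have wv : D (.inr 1) (V (.inr 2)) = 0 := by
    have t := congrArg (D (.inr 1)) v3
    rw [D_comm, vv, d11] at t
    simpa [fullA₁] using t.symm
  have ww : D (.inr 2) (V (.inr 2)) = 2 * g - 2 * 𝐝 5 e := by
    have t := congrArg (D (.inr 2)) v3
    rw [D_comm, vw] at t
    simp [fullA₁] at t
    linear_combination -t
  obtain ⟨s, hs⟩ : ∃ s, V (.inr 2) = fullW e g h m + s := ⟨_, (add_sub_cancel _ _).symm⟩
  have s0 : Indep (.inr 0) s := .of_eq hs (by simp [fullW, wu])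
  have s1 : Indep (.inr 1) s := .of_eq hs (by simp [fullW, wv])
  have s2 : Indep (.inr 2) s := .of_eq hs (by simp [fullW, ww])
  have s3 : Indep (.inl 1) s := .of_eq hs (by simp [fullW, w1])
  have s4 : Indep (.inl 2) s := .of_eq hs (by simp [fullW, w2, hc])
  have s5 : Indep (.inl 3) s := .of_eq hs (by rw [w3]; simp [fullW, hc]; grind)
  have s6 : Indep (.inl 4) s := .of_eq hs (by rw [w4]; simp [fullW, hc]; grind)
  obtain ⟨y, hy⟩ : ∃ y, V (.inr 0) = fullU e p g h k m l s + y := ⟨_, (add_sub_cancel _ _).symm⟩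
  have y0 : Indep (.inr 0) y := .of_eq hy (by rw [uu, d11, d22]; simp [fullU]; ring)
  have y1 : Indep (.inr 1) y := .of_eq hy (by simp [fullU, uv])
  have y2 : Indep (.inr 2) y := .of_eq hy (by simp [fullU, uw])
  have y3 : Indep (.inl 1) y := .of_eq hy (by rw [u1, ← a45, hk]; simp [fullU, fullA₄, hc])
  have y4 : Indep (.inl 2) y := .of_eq hy (by
    rw [u2, d24, hk, hm, hh]; simp [fullU, fullM, fullA₃, fullA₄, hc]; ring)
  have y5 : Indep (.inl 3) y := .of_eq hy (by
    rw [u3, hl]; simp [fullU, fullA₂, hc]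
    -- Evaluation at a point turns `half` and `sixth` into numerals of the field, and `ring`
    -- applies.
    refine ext' fun z => ?_
    simp only [map_add, map_sub, map_mul, map_neg, map_ofNat, evalAt_half, evalAt_sixth]
    ring)
  have y6 : Indep (.inl 4) y := .of_eq hy (by
    rw [u4, hs]; simp [fullU, fullW, fullA₂, hc]
    refine ext' fun z => ?_
    simp only [map_add, map_sub, map_mul, map_neg, map_ofNat, evalAt_half, evalAt_sixth]
    ring)
  obtain ⟨z, hz⟩ : ∃ z, V (.inr 1) = fullV e g h m n s + z := ⟨_, (add_sub_cancel _ _).symm⟩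
  have z0 : Indep (.inr 0) z := .of_eq hz (by rw [vu]; simp [fullV])
  have z1 : Indep (.inr 1) z := .of_eq hz (by rw [vv, d11]; simp [fullV]; ring)
  have z2 : Indep (.inr 2) z := .of_eq hz (by simp [fullV, vw])
  have z3 : Indep (.inl 1) z := .of_eq hz (by
    rw [v1, hm, hh]; simp [fullV, fullM, fullA₃, hc]; ring)
  have z4 : Indep (.inl 2) z := .of_eq hz (by rw [v2, hn]; simp [fullV, fullA₁, hc]; grind)
  have z5 : Indep (.inl 3) z := .of_eq hz (by
    rw [v3, hs]; simp [fullV, fullA₁, fullW, hc]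
    refine ext' fun z => ?_
    simp only [map_add, map_sub, map_mul, map_neg, map_ofNat, evalAt_half, evalAt_sixth]
    ring)
  have z6 : Indep (.inl 4) z := .of_eq hz (by
    rw [v4, hn]; simp [fullV, fullA₁, hc]
    refine ext' fun z => ?_
    simp only [map_add, map_sub, map_mul, map_neg, map_ofNat, evalAt_half, evalAt_sixth]
    ring)
  refine ⟨![e, p, g, h, k, m, n, l, s, y, z], fun j => ?_, ?_⟩
  · have sβ β : Indep (.inr β) s := by fin_cases β <;> assumption
    have yβ β : Indep (.inr β) y := by fin_cases β <;> assumption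
    have zβ β : Indep (.inr β) z := by fin_cases β <;> assumption
    fin_cases j <;> refine ⟨fun β => by simp, fun i hi => ?_⟩ <;> fin_cases i <;> simp at hi ⊢
  · funext c
    rcases c with c | c <;> fin_cases c
    exacts [hp.symm, hn.symm, hl.symm, hh.symm, hk.symm, he.symm, hy.symm, hz.symm, hs.symm]

end

section

variable {𝕜 : Type*} [RCLike 𝕜] {U : Opens (Coord 5 3 → 𝕜)}

local notation "𝐱" i:max => X (U := U) (Sum.inl i)
local notation "𝐲" α:max => X (U := U) (Sum.inr α)
local notation "𝐝" i:max f:max => D (U := U) (Sum.inl i) f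

set_option maxHeartbeats 4000000 in
-- The base directions split: a¹ and a² are arbitrary functions of (x¹, x²) on which nothing else
-- depends, while the other components are polynomial in x⁴, u, v, w over functions of (x³, x⁵).
-- Again a⁵ depends on x⁵ alone.
theorem exists_alttripleP {V : Coord 5 3 → SmoothAlg U}
    (hV : V ∈ algSymmetries (alttriple 𝕜 5) U) :
    ∃ f, (∀ k, DependsOnly ((Sum.elim (Sum.elim (fun _ : Fin 2 => {1, 2}) (fun _ : Fin 6 => {3, 5}))
      (fun _ : Fin 1 => {5}) : (Fin 2 ⊕ Fin 6) ⊕ Fin 1 → Finset (Fin 5)) k) (f k)) ∧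
      alttripleP f = V := by
  obtain ⟨⟨base, a13, a14, a15, a23, a24, a25, a31, a32, a34, a41, a42, a51, a52, a53, a54, u1, u2, u4,
    uu, uv, uw, v1, v2, v4, vu, vv, vw⟩, w4⟩ := alttriple_algRelations hV
  replace base : ∀ (k : Fin 5) β, D (.inr β) (V (.inl k)) = 0 := base
  obtain ⟨e, he⟩ : ∃ e, V (.inl 0) = e := ⟨_, rfl⟩
  obtain ⟨p, hp⟩ : ∃ p, V (.inl 3) = p := ⟨_, rfl⟩
  obtain ⟨a, ha⟩ : ∃ a, V (.inl 1) = a := ⟨_, rfl⟩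
  obtain ⟨b, hb⟩ : ∃ b, V (.inl 2) = b := ⟨_, rfl⟩
  obtain ⟨g, hg⟩ : ∃ g, 𝐝 4 (V (.inl 4)) = g := ⟨_, rfl⟩
  simp only [he, hp, ha, hb, hg] at a13 a14 a15 a23 a24 a25 a31 a32 a34 a51 a52 a53 a54 u4 uu
  simp only [he, hp, hg] at v4 vu vv
  have hc := fun f : SmoothAlg U => D_comm (.inl 3) (.inl 0) f
  have eβ β : Indep (.inr β) e := ⟨he ▸ base 0 β⟩
  have e1 : Indep (.inl 1) e := ⟨a51⟩
  have e2 : Indep (.inl 2) e := ⟨a52⟩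
  have e3 : Indep (.inl 3) e := ⟨a53⟩
  have e4 : Indep (.inl 4) e := ⟨a54⟩
  have pβ β : Indep (.inr β) p := ⟨hp ▸ base 3 β⟩
  have p1 : Indep (.inl 1) p := ⟨a31⟩
  have p2 : Indep (.inl 2) p := ⟨a32⟩
  have p4 : Indep (.inl 4) p := ⟨a34⟩
  have aβ β : Indep (.inr β) a := ⟨ha ▸ base 1 β⟩
  have a3 : Indep (.inl 3) a := ⟨a13⟩
  have a4 : Indep (.inl 4) a := ⟨a14⟩
  have a0 : Indep (.inl 0) a := ⟨a15⟩
  have bβ β : Indep (.inr β) b := ⟨hb ▸ base 2 β⟩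
  have b3 : Indep (.inl 3) b := ⟨a23⟩
  have b4 : Indep (.inl 4) b := ⟨a24⟩
  have b0 : Indep (.inl 0) b := ⟨a25⟩
  have gβ β : Indep (.inr β) g := ⟨by rw [← hg, D_comm, base, D_zero]⟩
  have g1 : Indep (.inl 1) g := ⟨by rw [← hg, D_comm, a41, D_zero]⟩
  have g2 : Indep (.inl 2) g := ⟨by rw [← hg, D_comm, a42, D_zero]⟩
  -- ∂₄∂_u of the u-component equals ∂_u∂₅a³, which vanishes because a³ depends on x alone.
  have g4 : Indep (.inl 4) g := ⟨by
    have t := congrArg (D (.inl 4)) uu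
    rw [D_comm, u4] at t
    simpa using t.symm⟩
  obtain ⟨h, hh⟩ : ∃ h, V (.inl 4) = 𝐱 4 * g + h := ⟨_, (add_sub_cancel _ _).symm⟩
  have hβ β : Indep (.inr β) h := .of_eq hh (by simp [base])
  have h1 : Indep (.inl 1) h := .of_eq hh (by simp [a41])
  have h2 : Indep (.inl 2) h := .of_eq hh (by simp [a42])
  have h4 : Indep (.inl 4) h := .of_eq hh (by simp [hg])
  rw [hh] at v4 vu
  have w1 : 𝐝 1 (V (.inr 2)) = 0 := by
    have t := congrArg (D (.inl 1)) v4
    rw [D_comm, v1] at t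
    simpa using t
  have w2 : 𝐝 2 (V (.inr 2)) = 0 := by
    have t := congrArg (D (.inl 2)) v4
    rw [D_comm, v2] at t
    simpa using t
  have wu : D (.inr 0) (V (.inr 2)) = -𝐝 3 g := by
    have t := congrArg (D (.inr 0)) v4
    rw [D_comm, vu] at t
    simp at t
    linear_combination t
  have wv : D (.inr 1) (V (.inr 2)) = 0 := by
    have t := congrArg (D (.inr 1)) v4
    rw [D_comm, vv] at t
    simpa using t
  have ww : D (.inr 2) (V (.inr 2)) = g - 𝐝 0 e := by
    have t := congrArg (D (.inr 2)) v4
    rw [D_comm, vw] at t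
    simp at t
    linear_combination t
  -- The relation `v4` does not give ∂₄ of the w-component; the second-order relation does, now that
  -- its derivatives in v and w are known.
  rw [D_comm (U := U) (.inr 2), ww, wv] at w4
  simp at w4
  obtain ⟨s, hs⟩ : ∃ s, V (.inr 2) = alttripleW e g + s := ⟨_, (add_sub_cancel _ _).symm⟩
  have s0 : Indep (.inr 0) s := .of_eq hs (by simp [alttripleW, wu])
  have s1 : Indep (.inr 1) s := .of_eq hs (by simp [alttripleW, wv])
  have s2 : Indep (.inr 2) s := .of_eq hs (by simp [alttripleW, ww])
  have s3 : Indep (.inl 1) s := .of_eq hs (by simp [alttripleW, w1])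
  have s4 : Indep (.inl 2) s := .of_eq hs (by simp [alttripleW, w2])
  have s5 : Indep (.inl 4) s := .of_eq hs (by simp [alttripleW, w4])
  obtain ⟨y, hy⟩ : ∃ y, V (.inr 0) = alttripleU e p g + y := ⟨_, (add_sub_cancel _ _).symm⟩
  have y0 : Indep (.inr 0) y := .of_eq hy (by simp [alttripleU, uu])
  have y1 : Indep (.inr 1) y := .of_eq hy (by simp [alttripleU, uv])
  have y2 : Indep (.inr 2) y := .of_eq hy (by simp [alttripleU, uw])
  have y3 : Indep (.inl 1) y := .of_eq hy (by simp [alttripleU, u1])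
  have y4 : Indep (.inl 2) y := .of_eq hy (by simp [alttripleU, u2])
  have y5 : Indep (.inl 4) y := .of_eq hy (by simp [alttripleU, u4])
  obtain ⟨z, hz⟩ : ∃ z, V (.inr 1) = alttripleV e g h s + z := ⟨_, (add_sub_cancel _ _).symm⟩
  have z0 : Indep (.inr 0) z := .of_eq hz (by simp [alttripleV, vu])
  have z1 : Indep (.inr 1) z := .of_eq hz (by simp [alttripleV, vv])
  have z2 : Indep (.inr 2) z := .of_eq hz (by simp [alttripleV, vw])
  have z3 : Indep (.inl 1) z := .of_eq hz (by simp [alttripleV, v1])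
  have z4 : Indep (.inl 2) z := .of_eq hz (by simp [alttripleV, v2])
  have z5 : Indep (.inl 4) z := .of_eq hz (by
    rw [v4, hs]; simp [alttripleV, alttripleW]
    refine ext' fun z => ?_
    simp only [map_add, map_sub, map_mul, map_neg, map_ofNat, evalAt_half, evalAt_sixth]
    ring)
  refine ⟨Sum.elim (Sum.elim ![a, b] ![p, g, h, s, y, z]) ![e], ?_, ?_⟩
  · have sβ β : Indep (.inr β) s := by fin_cases β <;> assumption
    have yβ β : Indep (.inr β) y := by fin_cases β <;> assumption
    have zβ β : Indep (.inr β) z := by fin_cases β <;> assumption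
    rintro ((j | j) | j) <;> fin_cases j <;> refine ⟨fun β => by simp, fun i hi => ?_⟩ <;>
      fin_cases i <;> simp at hi ⊢
  · funext c
    rcases c with c | c <;> fin_cases c
    exacts [he.symm, ha.symm, hb.symm, hp.symm, hh.symm, hy.symm, hz.symm, hs.symm]

end

section

variable {𝕜 : Type*} [RCLike 𝕜] {U : Opens (Coord 6 3 → 𝕜)}

local notation "𝐱" i:max => X (U := U) (Sum.inl i)
local notation "𝐲" α:max => X (U := U) (Sum.inr α)
local notation "𝐝" i:max f:max => D (U := U) (Sum.inl i) f

set_option maxHeartbeats 4000000 in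
-- As for (alttriple), a¹ and a² decouple. The rest is polynomial in x³, x⁴, u, v, w over functions
-- of (x⁵, x⁶).
theorem exists_altfullP {V : Coord 6 3 → SmoothAlg U}
    (hV : V ∈ algSymmetries (alttriple 𝕜 6 ++ triple2 𝕜 6) U) :
    ∃ f, (∀ k, DependsOnly ((Sum.elim (fun _ : Fin 2 => {1, 2}) (fun _ : Fin 8 => {5, 6}) :
      Fin 2 ⊕ Fin 8 → Finset (Fin 6)) k) (f k)) ∧ altfullP f = V := by
  obtain ⟨base, a13, a14, a15, a16, a23, a24, a25, a26, a31, a32, a41, a42, a51, a52, a53, a54, a61,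
    a62, a63, a64, a56, a65, a66, u1, u2, u3, u4, uu, uv, uw, v1, v2, v3, v4, vu, vv, vw⟩ :=
    altfull_algRelations hV
  replace base : ∀ (k : Fin 6) β, D (.inr β) (V (.inl k)) = 0 := base
  obtain ⟨e, he⟩ : ∃ e, V (.inl 5) = e := ⟨_, rfl⟩
  obtain ⟨p, hp⟩ : ∃ p, V (.inl 0) = p := ⟨_, rfl⟩
  obtain ⟨a, ha⟩ : ∃ a, V (.inl 1) = a := ⟨_, rfl⟩
  obtain ⟨b, hb⟩ : ∃ b, V (.inl 2) = b := ⟨_, rfl⟩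
  obtain ⟨g, hg⟩ : ∃ g, 𝐝 4 (V (.inl 4)) = g := ⟨_, rfl⟩
  simp only [he, hp, ha, hb, hg] at a13 a14 a15 a16 a23 a24 a25 a26 a51 a52 a53 a54 a61 a62 a63
  simp only [he, hp, hg] at a64 a56 a65 a66 u3 uu v4 vv
  have hc := fun f : SmoothAlg U => D_comm (.inl 5) (.inl 0) f
  have eβ β : Indep (.inr β) e := ⟨he ▸ base 5 β⟩
  have e1 : Indep (.inl 1) e := ⟨a51⟩
  have e2 : Indep (.inl 2) e := ⟨a52⟩
  have e3 : Indep (.inl 3) e := ⟨a53⟩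
  have e4 : Indep (.inl 4) e := ⟨a54⟩
  have pβ β : Indep (.inr β) p := ⟨hp ▸ base 0 β⟩
  have p1 : Indep (.inl 1) p := ⟨a61⟩
  have p2 : Indep (.inl 2) p := ⟨a62⟩
  have p3 : Indep (.inl 3) p := ⟨a63⟩
  have p4 : Indep (.inl 4) p := ⟨a64⟩
  have aβ β : Indep (.inr β) a := ⟨ha ▸ base 1 β⟩
  have a3 : Indep (.inl 3) a := ⟨a13⟩
  have a4 : Indep (.inl 4) a := ⟨a14⟩
  have a5 : Indep (.inl 5) a := ⟨a15⟩
  have a0 : Indep (.inl 0) a := ⟨a16⟩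
  have bβ β : Indep (.inr β) b := ⟨hb ▸ base 2 β⟩
  have b3 : Indep (.inl 3) b := ⟨a23⟩
  have b4 : Indep (.inl 4) b := ⟨a24⟩
  have b5 : Indep (.inl 5) b := ⟨a25⟩
  have b0 : Indep (.inl 0) b := ⟨a26⟩
  have d33 : 𝐝 3 (V (.inl 3)) = 𝐝 0 p + g - 𝐝 5 e := by linear_combination -a66
  have gβ β : Indep (.inr β) g := ⟨by rw [← hg, D_comm, base, D_zero]⟩
  have g1 : Indep (.inl 1) g := ⟨by rw [← hg, D_comm, a41, D_zero]⟩
  have g2 : Indep (.inl 2) g := ⟨by rw [← hg, D_comm, a42, D_zero]⟩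
  have g3 : Indep (.inl 3) g := ⟨by rw [← hg, D_comm, ← a56]; simp⟩
  -- ∂₄∂₃a³ = ∂₃∂₄a³ = ∂₃∂₅a⁶ = 0, and ∂₃a³ differs from g by derivatives of a⁵ and a⁶.
  have g4 : Indep (.inl 4) g := ⟨by
    have t := congrArg (D (.inl 4)) d33
    rw [D_comm, ← a65] at t
    simpa using t.symm⟩
  obtain ⟨h, hh⟩ : ∃ h, V (.inl 3) = altfullA₃ e p g + h := ⟨_, (add_sub_cancel _ _).symm⟩
  have hβ β : Indep (.inr β) h := .of_eq hh (by simp [altfullA₃, base])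
  have h1 : Indep (.inl 1) h := .of_eq hh (by simp [altfullA₃, a31])
  have h2 : Indep (.inl 2) h := .of_eq hh (by simp [altfullA₃, a32])
  have h3 : Indep (.inl 3) h := .of_eq hh (by simp [altfullA₃, d33]; ring)
  have h4 : Indep (.inl 4) h := .of_eq hh (by simp [altfullA₃, ← a65])
  obtain ⟨k, hk⟩ : ∃ k, V (.inl 4) = altfullA₄ e g + k := ⟨_, (add_sub_cancel _ _).symm⟩
  have kβ β : Indep (.inr β) k := .of_eq hk (by simp [altfullA₄, base])
  have k1 : Indep (.inl 1) k := .of_eq hk (by simp [altfullA₄, a41])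
  have k2 : Indep (.inl 2) k := .of_eq hk (by simp [altfullA₄, a42])
  have k3 : Indep (.inl 3) k := .of_eq hk (by simp [altfullA₄, ← a56])
  have k4 : Indep (.inl 4) k := .of_eq hk (by simp [altfullA₄, hg])
  rw [← a56] at vu
  rw [← a65] at uv
  rw [d33] at uu
  rw [hh] at u3 u4
  rw [hk] at v3 v4
  have w1 : 𝐝 1 (V (.inr 2)) = 0 := by
    have t := congrArg (D (.inl 1)) v4
    rw [D_comm, v1] at t
    simpa [altfullA₄] using t
  have w2 : 𝐝 2 (V (.inr 2)) = 0 := by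
    have t := congrArg (D (.inl 2)) v4
    rw [D_comm, v2] at t
    simpa [altfullA₄] using t
  -- The w-component occurs in `v4` and in `u3`; mixed derivatives with `v3` and `u4` give both ∂₃
  -- and ∂₄ of it.
  have w3 : 𝐝 3 (V (.inr 2)) = 𝐝 0 (𝐝 5 e) - 𝐝 0 g := by
    have t := congrArg (D (.inl 3)) v4
    rw [D_comm, v3] at t
    simp [altfullA₄, hc] at t
    linear_combination t
  have w4 : 𝐝 4 (V (.inr 2)) = 𝐝 5 (𝐝 5 e) - 𝐝 5 g := by
    have t := congrArg (D (.inl 4)) u3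
    rw [D_comm, u4] at t
    simp [altfullA₃, hc] at t
    linear_combination t
  have wu : D (.inr 0) (V (.inr 2)) = 0 := by
    have t := congrArg (D (.inr 0)) v4
    rw [D_comm, vu] at t
    simpa [altfullA₄] using t
  have wv : D (.inr 1) (V (.inr 2)) = 0 := by
    have t := congrArg (D (.inr 1)) v4
    rw [D_comm, vv] at t
    simpa [altfullA₄] using t
  have ww : D (.inr 2) (V (.inr 2)) = g - 𝐝 5 e := by
    have t := congrArg (D (.inr 2)) v4
    rw [D_comm, vw] at t
    simp [altfullA₄] at t
    linear_combination t
  obtain ⟨s, hs⟩ : ∃ s, V (.inr 2) = altfullW e g + s := ⟨_, (add_sub_cancel _ _).symm⟩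
  have s0 : Indep (.inr 0) s := .of_eq hs (by simp [altfullW, wu])
  have s1 : Indep (.inr 1) s := .of_eq hs (by simp [altfullW, wv])
  have s2 : Indep (.inr 2) s := .of_eq hs (by simp [altfullW, ww])
  have s3 : Indep (.inl 1) s := .of_eq hs (by simp [altfullW, w1])
  have s4 : Indep (.inl 2) s := .of_eq hs (by simp [altfullW, w2])
  have s5 : Indep (.inl 3) s := .of_eq hs (by simp [altfullW, w3, hc])
  have s6 : Indep (.inl 4) s := .of_eq hs (by simp [altfullW, w4, hc])
  obtain ⟨y, hy⟩ : ∃ y, V (.inr 0) = altfullU e p g h s + y := ⟨_, (add_sub_cancel _ _).symm⟩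
  have y0 : Indep (.inr 0) y := .of_eq hy (by simp [altfullU, uu]; ring)
  have y1 : Indep (.inr 1) y := .of_eq hy (by simp [altfullU, uv])
  have y2 : Indep (.inr 2) y := .of_eq hy (by simp [altfullU, uw])
  have y3 : Indep (.inl 1) y := .of_eq hy (by simp [altfullU, u1])
  have y4 : Indep (.inl 2) y := .of_eq hy (by simp [altfullU, u2])
  have y5 : Indep (.inl 3) y := .of_eq hy (by
    rw [u3, hs]; simp [altfullU, altfullA₃, altfullW, hc]
    refine ext' fun z => ?_
    simp only [map_add, map_sub, map_mul, map_neg, map_ofNat, evalAt_half, evalAt_sixth]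
    ring)
  have y6 : Indep (.inl 4) y := .of_eq hy (by
    rw [u4]; simp [altfullU, altfullA₃, hc]
    refine ext' fun z => ?_
    simp only [map_add, map_sub, map_mul, map_neg, map_ofNat, evalAt_half, evalAt_sixth]
    ring)
  obtain ⟨z, hz⟩ : ∃ z, V (.inr 1) = altfullV e g k s + z := ⟨_, (add_sub_cancel _ _).symm⟩
  have z0 : Indep (.inr 0) z := .of_eq hz (by simp [altfullV, vu])
  have z1 : Indep (.inr 1) z := .of_eq hz (by simp [altfullV, vv])
  have z2 : Indep (.inr 2) z := .of_eq hz (by simp [altfullV, vw])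
  have z3 : Indep (.inl 1) z := .of_eq hz (by simp [altfullV, v1])
  have z4 : Indep (.inl 2) z := .of_eq hz (by simp [altfullV, v2])
  have z5 : Indep (.inl 3) z := .of_eq hz (by
    rw [v3]; simp [altfullV, altfullA₄, hc]
    refine ext' fun z => ?_
    simp only [map_add, map_sub, map_mul, map_neg, map_ofNat, evalAt_half, evalAt_sixth]
    ring)
  have z6 : Indep (.inl 4) z := .of_eq hz (by
    rw [v4, hs]; simp [altfullV, altfullA₄, altfullW, hc]
    refine ext' fun z => ?_
    simp only [map_add, map_sub, map_mul, map_neg, map_ofNat, evalAt_half, evalAt_sixth]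
    ring)
  refine ⟨Sum.elim ![a, b] ![e, p, g, h, k, s, y, z], ?_, ?_⟩
  · have sβ β : Indep (.inr β) s := by fin_cases β <;> assumption
    have yβ β : Indep (.inr β) y := by fin_cases β <;> assumption
    have zβ β : Indep (.inr β) z := by fin_cases β <;> assumption
    rintro (j | j) <;> fin_cases j <;> refine ⟨fun β => by simp, fun i hi => ?_⟩ <;>
      fin_cases i <;> simp at hi ⊢
  · funext c
    rcases c with c | c <;> fin_cases c
    exacts [hp.symm, ha.symm, hb.symm, hh.symm, hk.symm, he.symm, hy.symm, hz.symm, hs.symm]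

end

end ScrollSym

namespace ScrollSym

/-! ### Assembly of the results for the four systems. -/

open TopologicalSpace SmoothAlg

/-- A symmetry V is P f for admissible f, and Q P f = f, so Q V is admissible; this need not be
checked separately. -/
theorem dependsOnFunctions_pointSymmetries {𝕜 : Type*} [RCLike 𝕜] {d m : ℕ}
    {U : Opens (Coord d m → 𝕜)} {κ : Type} [Finite κ] {I : Coord d m → Set 𝕜}
    (hI : ∀ c, IsOpen (I c) ∧ IsConnected (I c))
    (hU : (U : Set (Coord d m → 𝕜)) = Set.pi Set.univ I) {Sys : List (Jet2 𝕜 d m → 𝕜)}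
    {args : κ → Finset (Fin d)} {P : (κ → SmoothAlg U) → Coord d m → SmoothAlg U}
    {Q : (Coord d m → SmoothAlg U) → κ → SmoothAlg U}
    (hP : ∀ c, IsAlgOp fun f => P f c) (hQ : ∀ k, IsAlgOp fun V => Q V k)
    (hPQ : ∀ V c, P (Q V) c = V c)
    (hmem : ∀ f, (∀ k, DependsOnly (args k) (f k)) →
      P f ∈ algSymmetries Sys U ∧ ∀ k, Q (P f) k = f k)
    (hex : ∀ V ∈ algSymmetries Sys U, ∃ f, (∀ k, DependsOnly (args k) (f k)) ∧ P f = V) :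
    DependsOnFunctions (U : Set (Coord d m → 𝕜)) (pointSymmetries Sys U) args :=
  dependsOnFunctions_of_isAlgOp hI hU (mem_pointSymmetries_iff Sys U) hP hQ
    (fun f h => (hmem f h).1) (fun f h => (hmem f h).2)
    (fun V hV k => by
      obtain ⟨f, hf, rfl⟩ := hex V hV
      rw [(hmem f hf).2 k]
      exact hf k) hPQ

end ScrollSym

theorem mainTheorem7 {𝕜 : Type*} [RCLike 𝕜]
    (I₅ : ScrollSym.Coord 5 3 → Set 𝕜) (hI₅ : ∀ c, IsOpen (I₅ c) ∧ IsConnected (I₅ c))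
    (I₆ : ScrollSym.Coord 6 3 → Set 𝕜) (hI₆ : ∀ c, IsOpen (I₆ c) ∧ IsConnected (I₆ c))
    (U₅ : Set (ScrollSym.Coord 5 3 → 𝕜)) (hU₅ : U₅ = Set.pi Set.univ I₅)
    (U₆ : Set (ScrollSym.Coord 6 3 → 𝕜)) (hU₆ : U₆ = Set.pi Set.univ I₆) :
    -- `triple`: 9 functions of `(x⁴, x⁵)`, and one function of `x⁵`
    ScrollSym.DependsOnFunctions U₅
      (ScrollSym.pointSymmetries (ScrollSym.triple 𝕜 5) U₅)
      (Sum.elim (fun _ : Fin 9 => {4, 5}) (fun _ : Fin 1 => {5})) ∧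
    -- `alttriple`: 2 functions of `(x¹, x²)` and 6 of `(x³, x⁵)`, and one function of `x⁵`
    ScrollSym.DependsOnFunctions U₅
      (ScrollSym.pointSymmetries (ScrollSym.alttriple 𝕜 5) U₅)
      (Sum.elim (Sum.elim (fun _ : Fin 2 => {1, 2}) (fun _ : Fin 6 => {3, 5}))
        (fun _ : Fin 1 => {5})) ∧
    -- `triple + triple1`: 11 functions of `(x⁵, x⁶)`
    ScrollSym.DependsOnFunctions U₆
      (ScrollSym.pointSymmetries (ScrollSym.triple 𝕜 6 ++ ScrollSym.triple1 𝕜 6) U₆)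
      (fun _ : Fin 11 => {5, 6}) ∧
    -- `alttriple + triple2`: 2 functions of `(x¹, x²)` and 8 of `(x⁵, x⁶)`
    ScrollSym.DependsOnFunctions U₆
      (ScrollSym.pointSymmetries (ScrollSym.alttriple 𝕜 6 ++ ScrollSym.triple2 𝕜 6) U₆)
      (Sum.elim (fun _ : Fin 2 => {1, 2}) (fun _ : Fin 8 => {5, 6})) ∧
    -- jets of symmetries grow only quadratically, those of a function of three variables cubically
    (∀ Sys ∈ [ScrollSym.triple 𝕜 5, ScrollSym.alttriple 𝕜 5], ∀ z ∈ U₅,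
      (fun k : ℕ => (ScrollSym.jetDim (ScrollSym.pointSymmetries Sys U₅) z k : ℝ))
        =O[Filter.atTop] fun k : ℕ => (k : ℝ) ^ 2) ∧
    (∀ Sys ∈ [ScrollSym.triple 𝕜 6 ++ ScrollSym.triple1 𝕜 6,
        ScrollSym.alttriple 𝕜 6 ++ ScrollSym.triple2 𝕜 6], ∀ z ∈ U₆,
      (fun k : ℕ => (ScrollSym.jetDim (ScrollSym.pointSymmetries Sys U₆) z k : ℝ))
        =O[Filter.atTop] fun k : ℕ => (k : ℝ) ^ 2) := by
  obtain ⟨V₅, rfl⟩ : ∃ V : TopologicalSpace.Opens (ScrollSym.Coord 5 3 → 𝕜), (V : Set _) = U₅ :=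
    ⟨⟨U₅, hU₅ ▸ isOpen_set_pi Set.finite_univ fun c _ => (hI₅ c).1⟩, rfl⟩
  obtain ⟨V₆, rfl⟩ : ∃ V : TopologicalSpace.Opens (ScrollSym.Coord 6 3 → 𝕜), (V : Set _) = U₆ :=
    ⟨⟨U₆, hU₆ ▸ isOpen_set_pi Set.finite_univ fun c _ => (hI₆ c).1⟩, rfl⟩
  refine ⟨?_, ?_, ?_, ?_, fun Sys hSys z hz => ?_, fun Sys hSys z hz => ?_⟩
  · exact ScrollSym.dependsOnFunctions_pointSymmetries hI₅ hU₅ ScrollSym.isAlgOp_tripleP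
      ScrollSym.isAlgOp_tripleQ ScrollSym.tripleP_tripleQ ScrollSym.tripleP_mem
      fun _ => ScrollSym.exists_tripleP
  · exact ScrollSym.dependsOnFunctions_pointSymmetries hI₅ hU₅ ScrollSym.isAlgOp_alttripleP
      ScrollSym.isAlgOp_alttripleQ ScrollSym.alttripleP_alttripleQ ScrollSym.alttripleP_mem
      fun _ => ScrollSym.exists_alttripleP
  · exact ScrollSym.dependsOnFunctions_pointSymmetries hI₆ hU₆ ScrollSym.isAlgOp_fullP
      ScrollSym.isAlgOp_fullQ ScrollSym.fullP_fullQ ScrollSym.fullP_mem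
      fun _ => ScrollSym.exists_fullP
  · exact ScrollSym.dependsOnFunctions_pointSymmetries hI₆ hU₆ ScrollSym.isAlgOp_altfullP
      ScrollSym.isAlgOp_altfullQ ScrollSym.altfullP_altfullQ ScrollSym.altfullP_mem
      fun _ => ScrollSym.exists_altfullP
  · simp only [List.mem_cons, List.not_mem_nil, or_false] at hSys
    rcases hSys with rfl | rfl
    -- The parameter depending on x⁵ alone is treated as a function of the pair (x⁵, x⁵), which only
    -- makes the count of derivatives less sharp.
    · exact ScrollSym.jetDim_isBigO (ScrollSym.mem_pointSymmetries_iff _ V₅)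
        ScrollSym.isAlgOp_tripleP (Sum.elim (fun _ => 4) fun _ => 5) (fun _ => 5)
        (by rintro (k | k) <;> simp) (fun _ => ScrollSym.exists_tripleP) z hz
    · exact ScrollSym.jetDim_isBigO (ScrollSym.mem_pointSymmetries_iff _ V₅)
        ScrollSym.isAlgOp_alttripleP
        (Sum.elim (Sum.elim (fun _ => 1) fun _ => 3) fun _ => 5)
        (Sum.elim (Sum.elim (fun _ => 2) fun _ => 5) fun _ => 5)
        (by rintro ((k | k) | k) <;> simp) (fun _ => ScrollSym.exists_alttripleP) z hz
  · simp only [List.mem_cons, List.not_mem_nil, or_false] at hSys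
    rcases hSys with rfl | rfl
    · exact ScrollSym.jetDim_isBigO (ScrollSym.mem_pointSymmetries_iff _ V₆)
        ScrollSym.isAlgOp_fullP (fun _ => 5) (fun _ => 6) (fun _ => by simp)
        (fun _ => ScrollSym.exists_fullP) z hz
    · exact ScrollSym.jetDim_isBigO (ScrollSym.mem_pointSymmetries_iff _ V₆)
        ScrollSym.isAlgOp_altfullP (Sum.elim (fun _ => 1) fun _ => 5)
        (Sum.elim (fun _ => 2) fun _ => 6) (by rintro (k | k) <;> simp)
        (fun _ => ScrollSym.exists_altfullP) z hz
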